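/- For a real number $k>0$ let $d_k$ be the multiplicative function on the positive integers with $d_k(p^a)=\dfrac{\Gamma(k+a)}{\Gamma(k)\,a!}$ for primes $p$ and $a\ge 1$. Put $$c_2(k)=1+\frac{1}{2^{k+2}}+\frac{2}{4^{k+2}}+\frac{4}{4^{k+2}(2^{k+2}-1)},\qquad c_p(k)=1+\frac{2}{p^{k+2}-1}\quad (p>2 \text{ prime}),\qquad \mathcal{C}(k)=c_2(k)\prod_{p>2}c_p(k),$$ and let $g_k$ be the multiplicative function on the positive integers given, for $a\ge 1$, by $$g_k(2^a)=\frac{(-1)^a}{2}\left(1+\frac{2\left(1+(-1)^a\right)}{4^{k+2}(2^{k+2}-1)}\right)c_2(k)^{-1}$$ and, for primes $p>2$, $$g_k(p^a)=\begin{cases}-\dfrac1p\,c_p(k)^{-1} & \text{if } a \text{ is odd},\\[2mm] \left(1-\dfrac2p\right)\left(1+\dfrac{2(p-1)}{(p-2)(p^{k+2}-1)}\right)c_p(k)^{-1} & \text{if } a \text{ is even}.\end{cases}$$ Define $$\mathcal{H}(k)=\mathcal{C}(k)\sum_{m=1}^{\infty}\frac{d_k(m)\,g_k(m)}{m},\qquad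 A_0=\int_0^1\frac{\log\cosh t}{t^2}\,dt+\int_1^\infty\frac{\log\cosh t-t}{t^2}\,dt+1.$$ The two integrals defining $A_0$ converge absolutely. For all sufficiently large real $k$ the product and the series defining $\mathcal{H}(k)$ converge absolutely and $\mathcal{H}(k)>0$. Moreover, as $k\to\infty$ through real numbers, $$\log\mathcal{H}(k)=k\log\log k+k(\gamma-\log 3)+(A_0-1)\frac{k}{\log k}+O\left(\frac{k}{(\log k)^2}\right),$$ where $\gamma$ is the Euler–Mascheroni constant. -/

import Mathlib

open Filter Asymptotics MeasureTheory

namespace ClassNumberMoments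

noncomputable section

/-- The `k`-th divisor function `d_k`: the multiplicative function with
`d_k(p^a) = Γ(k+a) / (Γ(k) a!)`, i.e. the product of these values over the prime powers `p^a`
exactly dividing `m`. -/
def divisorFn (k : ℝ) (m : ℕ) : ℝ :=
  m.factorization.prod fun _ a => Real.Gamma (k + a) / (Real.Gamma k * (a.factorial : ℝ))

/-- The factor at the prime `2` of the constant `C(k)`. -/
def twoFactor (k : ℝ) : ℝ :=
  1 + 1 / (2 : ℝ) ^ (k + 2) + 2 / (4 : ℝ) ^ (k + 2)
    + 4 / ((4 : ℝ) ^ (k + 2) * ((2 : ℝ) ^ (k + 2) - 1))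

/-- The factor at an odd prime `p` of the constant `C(k)`. -/
def oddFactor (k : ℝ) (p : ℕ) : ℝ :=
  1 + 2 / ((p : ℝ) ^ (k + 2) - 1)

/-- `C(k)`: the factor at `2` times the product over all primes `p > 2`. -/
def constC (k : ℝ) : ℝ :=
  twoFactor k * ∏' p : {p : ℕ // p.Prime ∧ 2 < p}, oddFactor k p

/-- The value `g_k(p^a)` for a prime `p` and an exponent `a ≥ 1`. -/
def gPrimePow (k : ℝ) (p a : ℕ) : ℝ :=
  if p = 2 then
    (-1) ^ a / 2 * (1 + 2 * (1 + (-1) ^ a) / ((4 : ℝ) ^ (k + 2) * ((2 : ℝ) ^ (k + 2) - 1)))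
      * (twoFactor k)⁻¹
  else if Odd a then
    -(1 / (p : ℝ)) * (oddFactor k p)⁻¹
  else
    (1 - 2 / (p : ℝ))
      * (1 + 2 * ((p : ℝ) - 1) / (((p : ℝ) - 2) * ((p : ℝ) ^ (k + 2) - 1)))
      * (oddFactor k p)⁻¹

/-- The multiplicative function `g_k`. -/
def gFn (k : ℝ) (m : ℕ) : ℝ :=
  m.factorization.prod fun p a => gPrimePow k p a

/-- The term `d_k(m) g_k(m) / m`; for `m = 0` it is `0`, because of the division by `0`,
so that a sum over `ℕ` is a sum over `m ≥ 1`. -/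
def hTerm (k : ℝ) (m : ℕ) : ℝ :=
  divisorFn k m * gFn k m / (m : ℝ)

/-- `H(k) = C(k) ∑_{m ≥ 1} d_k(m) g_k(m) / m`. -/
def constH (k : ℝ) : ℝ :=
  constC k * ∑' m : ℕ, hTerm k m

/-- `A₀ = ∫_0^1 log cosh t / t² dt + ∫_1^∞ (log cosh t - t) / t² dt + 1`. -/
def constA : ℝ :=
  (∫ t in (0 : ℝ)..1, Real.log (Real.cosh t) / t ^ 2)
    + (∫ t in Set.Ioi (1 : ℝ), (Real.log (Real.cosh t) - t) / t ^ 2) + 1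

end

end ClassNumberMoments

/-! Since `g_k(p^a)` depends only on the parity of `a`, the series at each prime is a combination of
the binomial series of `(1 - 1/p)^(-k)` and `(1 + 1/p)^(-k)`, and `H(k)` is the Euler product of the
resulting factors (`hasProd_localFactor`). For `p ≥ 5` both powers enter with weight about `1/2`, so
the factor is close to `exp (k w) cosh (k/p)` with `w = -log (1 - 1/p) - 1/p`. At `2` and `3` the
coefficient of `(1 - 1/p)^(-k)` is tiny and the factor stays bounded; there the general formula
overshoots by `k log 2` and `k log (3/2)` up to `O(1)`, which together give `-k log 3`. The
logarithmic error at `p` is `O(min(1, k/p^2))`, and the errors add up to `O(k^(3/4))`.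

It remains to expand `∑ log cosh (k/p)` with error `O(k / log^2 k)`. Its derivative in `k` is `∑
tanh (k/p) / p`. The derivative of that sum in `log k` is `∑ (1/p) K(log p - log k)`, where `K(z) =
t / cosh^2 t` at `t = exp (-z)`. The kernel `K` extends to a Schwartz function of total mass one, so
a smoothed prime number theorem applies: for such weights, `∑ (log p / p) f(log p - x) = ∫ f +
O(x^(-2))` (`isBigO_tsum_primes`). That theorem rests on Fourier inversion along `Re s = 1`. There
the logarithmic derivative of `Z(s) = (s - 1) ζ(s)` has temperate growth, because `Z` and its
derivatives are polynomially bounded and the 3-4-1 inequality bounds `Z` below polynomially.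

Expanding `1 / log p` about `1/x` gives the sum with weights `1/p` to order `x^(-3)`
(`isBigO_sechSum`); two integrations give the expansion up to an unknown constant `M`. The mean of
`K` is `A₀`, by integration by parts. An Abelian argument finds `M`: averaging `∑ tanh (u/p) / p` at
`u = exp (s y)` against `exp (-y)` produces the prime zeta function at `1 + 1/s`, while `∫ log y exp
(-y) dy = -γ`. Hence `M = γ - ∑ w`, and `∑ w` cancels against the exponential factors `exp (k w)`.
-/

namespace ClassNumberMoments

/-! ### Polynomial upper and lower bounds for `Z(s) = (s - 1) ζ(s)` in `1 ≤ Re s ≤ 2`. -/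

section ZetaBounds

open Complex Set Topology

/-- The fractional part, cut off to `(1, ∞)`. -/
noncomputable def fractKernel : ℝ → ℂ := (Ioi (1 : ℝ)).indicator fun t => ((Int.fract t : ℝ) : ℂ)

lemma norm_fractKernel_le_one (t : ℝ) : ‖fractKernel t‖ ≤ 1 := by
  unfold fractKernel
  refine (norm_indicator_le_norm_self _ _).trans ?_
  rw [Complex.norm_real, Real.norm_of_nonneg (Int.fract_nonneg t)]
  exact (Int.fract_lt_one t).le

lemma measurable_fractKernel : Measurable fractKernel :=
  (Complex.measurable_ofReal.comp measurable_fract).indicator measurableSet_Ioi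

lemma mellin_fractKernel (s : ℂ) :
    mellin fractKernel (-s) = ∫ t in Ioi (1 : ℝ), (t : ℂ) ^ (-(s + 1)) * (Int.fract t : ℝ) := by
  have h : ∀ t : ℝ, (t : ℂ) ^ (-s - 1) • fractKernel t
      = (Ioi (1 : ℝ)).indicator (fun t : ℝ => (t : ℂ) ^ (-(s + 1)) * (Int.fract t : ℝ)) t := by
    intro t
    by_cases ht : t ∈ Ioi (1 : ℝ)
    · rw [fractKernel, indicator_of_mem ht, indicator_of_mem ht, smul_eq_mul]
      congr 2; ring
    · rw [fractKernel, indicator_of_notMem ht, indicator_of_notMem ht, smul_zero]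
  rw [mellin]
  simp_rw [h]
  rw [setIntegral_indicator measurableSet_Ioi, Ioi_inter_Ioi]
  norm_num

lemma differentiableAt_mellin_fractKernel {s : ℂ} (hs : 0 < s.re) :
    DifferentiableAt ℂ (fun s => mellin fractKernel (-s)) s := by
  have hloc : LocallyIntegrableOn fractKernel (Ioi 0) volume := by
    refine LocallyIntegrable.locallyIntegrableOn ?_ _
    refine (locallyIntegrable_const (1 : ℝ)).mono measurable_fractKernel.aestronglyMeasurable ?_
    filter_upwards with t
    simpa using norm_fractKernel_le_one t
  have h1 : fractKernel =O[atTop] fun x : ℝ => x ^ (-(0 : ℝ)) := by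
    refine IsBigO.of_bound 1 (Eventually.of_forall fun t => ?_)
    simpa using norm_fractKernel_le_one t
  -- The kernel vanishes on `(0, 1]`, so any exponent below `(-s).re` would serve at `0`.
  have h2 : fractKernel =O[𝓝[>] 0] fun x : ℝ => x ^ (-((-s).re - 1)) := by
    refine IsBigO.of_bound 1 ?_
    have : ∀ᶠ t : ℝ in 𝓝[>] 0, t ≤ 1 :=
      mem_nhdsWithin_of_mem_nhds (Iic_mem_nhds one_pos)
    filter_upwards [this] with t ht
    rw [fractKernel, indicator_of_notMem (by simpa using ht), norm_zero]
    positivity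
  have h := mellin_differentiableAt_of_isBigO_rpow (s := -s) hloc h1 (by simpa using hs) h2
    (by linarith)
  exact h.comp s differentiableAt_id.neg

lemma norm_mellin_fractKernel_le {s : ℂ} (hs : 0 < s.re) :
    ‖mellin fractKernel (-s)‖ ≤ 1 / s.re := by
  rw [mellin_fractKernel]
  have hint : ∫ t in Ioi (1 : ℝ), t ^ (-(s.re + 1)) = 1 / s.re := by
    rw [integral_Ioi_rpow_of_lt (by linarith) one_pos]
    simp
  rw [← hint]
  refine norm_integral_le_of_norm_le (integrableOn_Ioi_rpow_of_lt (by linarith) one_pos) ?_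
  filter_upwards [ae_restrict_mem measurableSet_Ioi] with t ht
  have ht0 : (0 : ℝ) < t := lt_trans one_pos ht
  rw [norm_mul, Complex.norm_cpow_eq_rpow_re_of_pos ht0, Complex.norm_real,
    Real.norm_of_nonneg (Int.fract_nonneg t)]
  have : (-(s + 1)).re = -(s.re + 1) := by simp
  rw [this]
  exact mul_le_of_le_one_right (by positivity) (Int.fract_lt_one t).le

/-- Abel summation writes `ζ(s)` as `s` times the integral of `⌊t⌋ t^(-s-1)`. Splitting `⌊t⌋` into
`t` minus its fractional part separates the pole `s / (s - 1)` from an integral that converges for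
`Re s > 0`. -/
lemma riemannZeta₁_eq_of_one_lt_re {s : ℂ} (hs : 1 < s.re) :
    riemannZeta₁ s = s - s * (s - 1) * mellin fractKernel (-s) := by
  have hs1 : s ≠ 1 := by rintro rfl; simp at hs
  have hs1' : s - 1 ≠ 0 := sub_ne_zero.2 hs1
  have hz : riemannZeta s = s * ∫ t in Ioi (1 : ℝ), (⌊t⌋₊ : ℂ) * t ^ (-(s + 1)) := by
    have h := LSeries_eq_mul_integral_of_nonneg (fun _ => (1 : ℝ)) (r := 1) zero_le_one hs
      (by
        refine IsBigO.of_bound 1 (Eventually.of_forall fun n => ?_)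
        simp) (fun _ => zero_le_one)
    rw [← LSeries_one_eq_riemannZeta hs]
    simpa using! h
  have hI1 : IntegrableOn (fun t : ℝ => (t : ℂ) ^ (-s)) (Ioi 1) :=
    integrableOn_Ioi_cpow_of_lt (by simpa using hs) one_pos
  have hI2 : IntegrableOn (fun t : ℝ => (t : ℂ) ^ (-(s + 1)) * (Int.fract t : ℝ)) (Ioi 1) := by
    have h0 : IntegrableOn (fun t : ℝ => (t : ℂ) ^ (-(s + 1))) (Ioi 1) :=
      integrableOn_Ioi_cpow_of_lt (by simp; linarith) one_pos
    refine h0.mul_bdd (c := 1) ?_ ?_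
    · exact (Complex.measurable_ofReal.comp measurable_fract).aestronglyMeasurable
    · filter_upwards with t
      rw [Complex.norm_real, Real.norm_of_nonneg (Int.fract_nonneg t)]
      exact (Int.fract_lt_one t).le
  have hsplit : ∫ t in Ioi (1 : ℝ), (⌊t⌋₊ : ℂ) * t ^ (-(s + 1))
      = (∫ t in Ioi (1 : ℝ), (t : ℂ) ^ (-s)) - mellin fractKernel (-s) := by
    rw [mellin_fractKernel, ← integral_sub hI1 hI2]
    refine setIntegral_congr_fun measurableSet_Ioi fun t ht => ?_
    have ht0 : (0 : ℝ) < t := lt_trans one_pos ht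
    have h1 : (t : ℂ) ^ (-s) = t ^ (-(s + 1)) * t := by
      rw [← sub_add_cancel (-s) 1, Complex.cpow_add _ _ (by exact_mod_cast ht0.ne'), cpow_one]
      congr 2; ring
    have h2 : ((⌊t⌋₊ : ℝ) : ℝ) = t - Int.fract t := by
      rw [natCast_floor_eq_intCast_floor ht0.le, Int.self_sub_fract]
    have h2' : (⌊t⌋₊ : ℂ) = (t : ℂ) - (Int.fract t : ℝ) := by
      rw [← Complex.ofReal_sub, ← h2]; simp
    simp only [h1, h2']
    ring
  have hI : ∫ t in Ioi (1 : ℝ), (t : ℂ) ^ (-s) = 1 / (s - 1) := by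
    rw [integral_Ioi_cpow_of_lt (by simpa using hs) one_pos]
    simp only [ofReal_one, one_cpow]
    rw [show -s + 1 = -(s - 1) by ring, neg_div_neg_eq]
  have hz1 := riemannZeta_eq_inv_sub_mul hs1
  rw [hz, hsplit, hI] at hz1
  field_simp at hz1
  linear_combination -hz1

/-- The integral representation of `(s - 1) ζ(s)` in the half plane `Re s > 0`. -/
lemma riemannZeta₁_eq {s : ℂ} (hs : 0 < s.re) :
    riemannZeta₁ s = s - s * (s - 1) * mellin fractKernel (-s) := by
  have hopen : IsOpen {s : ℂ | 0 < s.re} := isOpen_lt continuous_const continuous_re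
  have hf : AnalyticOnNhd ℂ riemannZeta₁ {s : ℂ | 0 < s.re} :=
    differentiable_riemannZeta₁.differentiableOn.analyticOnNhd hopen
  have hg : AnalyticOnNhd ℂ (fun s => s - s * (s - 1) * mellin fractKernel (-s))
      {s : ℂ | 0 < s.re} := by
    refine DifferentiableOn.analyticOnNhd (fun s hs => ?_) hopen
    have := differentiableAt_mellin_fractKernel (s := s) hs
    exact DifferentiableAt.differentiableWithinAt (by fun_prop)
  have hpre : IsPreconnected {s : ℂ | 0 < s.re} := (convex_halfSpace_re_gt 0).isPreconnected
  -- Identity theorem: both sides are analytic on the half plane and agree near `2`.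
  refine hf.eqOn_of_preconnected_of_eventuallyEq hg hpre (z₀ := 2) (by simp) ?_ hs
  have : {s : ℂ | 1 < s.re} ∈ 𝓝 (2 : ℂ) :=
    (isOpen_lt continuous_const continuous_re).mem_nhds (by simp)
  filter_upwards [this] with s hs
  exact riemannZeta₁_eq_of_one_lt_re hs

lemma norm_riemannZeta₁_le {s : ℂ} (hs : 1 / 2 ≤ s.re) :
    ‖riemannZeta₁ s‖ ≤ 3 * (1 + ‖s‖) ^ 2 := by
  rw [riemannZeta₁_eq (by linarith)]
  have h1 : ‖mellin fractKernel (-s)‖ ≤ 2 := by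
    refine (norm_mellin_fractKernel_le (by linarith)).trans ?_
    rw [div_le_iff₀ (by linarith)]; linarith
  have h2 : ‖s - 1‖ ≤ ‖s‖ + 1 := by simpa using norm_sub_le s 1
  have h3 := norm_nonneg s
  calc ‖s - s * (s - 1) * mellin fractKernel (-s)‖
      ≤ ‖s‖ + ‖s‖ * ‖s - 1‖ * ‖mellin fractKernel (-s)‖ := by
        refine (norm_sub_le _ _).trans ?_
        rw [norm_mul, norm_mul]
    _ ≤ ‖s‖ + ‖s‖ * (‖s‖ + 1) * 2 := by gcongr
    _ ≤ 3 * (1 + ‖s‖) ^ 2 := by nlinarith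

/-- Cauchy's estimate on the circle of radius `1/2`, which stays in `Re z ≥ 1/2`. The constant `12 =
3 * 2^2` comes from `1 + ‖z‖ ≤ 2 (1 + ‖s‖)` on that circle. -/
lemma norm_iteratedDeriv_riemannZeta₁_le (n : ℕ) {s : ℂ} (hs : 1 ≤ s.re) :
    ‖iteratedDeriv n riemannZeta₁ s‖ ≤ (n.factorial * 12 * 2 ^ n) * (1 + ‖s‖) ^ 2 := by
  have h := norm_iteratedDeriv_le_of_forall_mem_sphere_norm_le (c := s) (R := 1 / 2)
    (C := 12 * (1 + ‖s‖) ^ 2) (f := riemannZeta₁) n (by norm_num)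
    differentiable_riemannZeta₁.diffContOnCl ?_
  · refine h.trans (le_of_eq ?_)
    rw [one_div, inv_pow, div_inv_eq_mul]; ring
  · intro z hz
    rw [mem_sphere_iff_norm] at hz
    have h1 : |(z - s).re| ≤ 1 / 2 := hz ▸ abs_re_le_norm _
    have h2 : 1 / 2 ≤ z.re := by
      have := (abs_le.1 h1).1
      simp only [sub_re] at this
      linarith
    have h3 : ‖z‖ ≤ ‖s‖ + 1 / 2 := by
      have := norm_add_le s (z - s)
      rw [hz] at this
      simpa using this
    refine (norm_riemannZeta₁_le h2).trans ?_
    have : (1 + ‖z‖) ^ 2 ≤ (2 * (1 + ‖s‖)) ^ 2 := by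
      gcongr
      linarith [norm_nonneg s]
    nlinarith

lemma riemannZeta₁_ne_zero {s : ℂ} (hs : 1 ≤ s.re) : riemannZeta₁ s ≠ 0 := by
  rcases eq_or_ne s 1 with rfl | h1
  · simp
  · have h := riemannZeta_ne_zero_of_one_le_re hs
    rw [riemannZeta_eq_inv_sub_mul h1] at h
    exact right_ne_zero_of_mul h

/-- The consequence of `3 + 4 cos θ + cos 2θ ≥ 0` for `(s - 1) ζ(s)`. -/
lemma riemannZeta₁_product_ge {x y : ℝ} (hx : 0 < x) (hy : 1 ≤ |y|) :
    x ^ 3 ≤ ‖riemannZeta₁ (1 + x)‖ ^ 3 * ‖riemannZeta₁ (1 + x + I * y)‖ ^ 4 *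
      ‖riemannZeta₁ (1 + x + 2 * I * y)‖ := by
  have h := DirichletCharacter.norm_LSeries_product_ge_one (1 : DirichletCharacter ℂ 1) hx y
  have e : ∀ s : ℂ, 1 < s.re → LSeries (fun n => (1 : DirichletCharacter ℂ 1) n) s
      = (s - 1)⁻¹ * riemannZeta₁ s := by
    intro s hs
    have hs1 : s ≠ 1 := by rintro rfl; simp at hs
    rw [← riemannZeta_eq_inv_sub_mul hs1, ← LSeries_one_eq_riemannZeta hs]
    congr 1
    ext n
    simp [Subsingleton.elim ((n : ZMod 1)) 1]
  have e1 : (1 + (x : ℂ) - 1) = x := by ring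
  have e2 : (1 + (x : ℂ) + I * y - 1) = x + I * y := by ring
  have e3 : (1 + (x : ℂ) + 2 * I * y - 1) = x + 2 * I * y := by ring
  rw [one_pow, e _ (by simpa using hx), e _ (by simpa using hx), e _ (by simpa using hx),
    e1, e2, e3] at h
  have n1 : ‖(x : ℂ)‖ = x := by rw [Complex.norm_real, Real.norm_of_nonneg hx.le]
  have n2 : 1 ≤ ‖(x : ℂ) + I * y‖ := by
    refine hy.trans ?_
    simpa using abs_im_le_norm ((x : ℂ) + I * y)
  have n3 : 1 ≤ ‖(x : ℂ) + 2 * I * y‖ := by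
    have h4 := abs_im_le_norm ((x : ℂ) + 2 * I * y)
    simp [abs_mul] at h4
    linarith [abs_nonneg y]
  simp only [norm_mul, norm_pow, norm_inv, mul_pow, n1, inv_pow] at h
  set A := ‖riemannZeta₁ (1 + x)‖
  set B := ‖riemannZeta₁ (1 + x + I * y)‖
  set D := ‖riemannZeta₁ (1 + x + 2 * I * y)‖
  have hAB : 0 ≤ A ^ 3 * B ^ 4 * D := by positivity
  -- For `|y| ≥ 1` the polar factors at the two points off the real axis have modulus at most one
  -- and can be dropped; only `x^(-3)` survives.
  have i2 : (‖(x : ℂ) + I * y‖ ^ 4)⁻¹ ≤ 1 := inv_le_one_of_one_le₀ (one_le_pow₀ n2)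
  have i3 : (‖(x : ℂ) + 2 * I * y‖)⁻¹ ≤ 1 := inv_le_one_of_one_le₀ n3
  have h5 : (1 : ℝ) ≤ (x ^ 3)⁻¹ * (A ^ 3 * B ^ 4 * D) := by
    refine h.le.trans ?_
    calc _ = ((‖(x : ℂ) + I * y‖ ^ 4)⁻¹ * (‖(x : ℂ) + 2 * I * y‖)⁻¹) *
          ((x ^ 3)⁻¹ * (A ^ 3 * B ^ 4 * D)) := by ring
      _ ≤ 1 * ((x ^ 3)⁻¹ * (A ^ 3 * B ^ 4 * D)) := by
          gcongr
          exact mul_le_one₀ i2 (by positivity) i3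
      _ = _ := one_mul _
  have hx3 : 0 < x ^ 3 := by positivity
  rwa [inv_mul_eq_div, le_div_iff₀ hx3, one_mul] at h5

/-- At distance at least `x₀ = ε / Y^10` from the line `Re s = 1`, the 3-4-1 inequality gives the
lower bound `768 ε / Y^8`. Closer to the line, the mean value inequality with `‖Z'‖ ≤ 384 Y^2` moves
the bound from `x₀` to `x` and loses at most half of it. -/
lemma le_norm_riemannZeta₁_of_one_le_abs {x y : ℝ} (hx0 : 0 ≤ x) (hx1 : x ≤ 1) (hy : 1 ≤ |y|) :
    384 * (1 / (27 ^ 3 * 75 * 768 ^ 4)) / |y| ^ 8 ≤ ‖riemannZeta₁ (1 + x + I * y)‖ := by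
  set Y := |y| with hY
  have hY0 : 0 < Y := by linarith
  -- This `ε` solves `(768 ε / Y^8)^4 * 27^3 * 75 Y^2 = (ε / Y^10)^3`, where `27` and `75 Y^2` bound
  -- `Z` at `1 + x` and `1 + x + 2iy`.
  set ε : ℝ := 1 / (27 ^ 3 * 75 * 768 ^ 4) with hε
  have hε0 : 0 < ε := by positivity
  have hε1 : ε ≤ 1 := by rw [hε]; norm_num
  have hone : ∀ x : ℝ, 0 < x → x ≤ 1 → ‖riemannZeta₁ (1 + x)‖ ≤ 27 := by
    intro x h0 h1
    refine (norm_riemannZeta₁_le (s := 1 + x) (by simp; linarith)).trans ?_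
    have : ‖(1 + x : ℂ)‖ ≤ 2 := by
      refine (norm_add_le _ _).trans ?_
      rw [norm_one, Complex.norm_real, Real.norm_of_nonneg h0.le]; linarith
    calc 3 * (1 + ‖(1 + x : ℂ)‖) ^ 2 ≤ 3 * (1 + 2) ^ 2 := by gcongr
      _ = 27 := by norm_num
  have htwo : ∀ x : ℝ, 0 < x → x ≤ 1 → ‖riemannZeta₁ (1 + x + 2 * I * y)‖ ≤ 75 * Y ^ 2 := by
    intro x h0 h1
    refine (norm_riemannZeta₁_le (s := 1 + x + 2 * I * y) (by simp; linarith)).trans ?_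
    have : ‖(1 + x + 2 * I * y : ℂ)‖ ≤ 2 + 2 * Y := by
      refine (norm_add₃_le).trans ?_
      rw [norm_one, Complex.norm_real, Real.norm_of_nonneg h0.le]
      simp
      linarith
    calc 3 * (1 + ‖(1 + x + 2 * I * y : ℂ)‖) ^ 2 ≤ 3 * (1 + (2 + 2 * Y)) ^ 2 := by gcongr
      _ ≤ 75 * Y ^ 2 := by nlinarith
  have hbig : ∀ x : ℝ, ε / Y ^ 10 ≤ x → x ≤ 1 →
      768 * ε / Y ^ 8 ≤ ‖riemannZeta₁ (1 + x + I * y)‖ := by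
    intro x h0 h1
    have hxpos : 0 < x := lt_of_lt_of_le (by positivity) h0
    have h := riemannZeta₁_product_ge hxpos hy
    set B := ‖riemannZeta₁ (1 + x + I * y)‖
    have h2 : x ^ 3 ≤ 27 ^ 3 * B ^ 4 * (75 * Y ^ 2) := by
      refine h.trans ?_
      gcongr
      · exact hone x hxpos h1
      · exact htwo x hxpos h1
    have h3 : (ε / Y ^ 10) ^ 3 ≤ 27 ^ 3 * B ^ 4 * (75 * Y ^ 2) := le_trans (by gcongr) h2
    refine le_of_pow_le_pow_left₀ (n := 4) (by norm_num) (norm_nonneg _) ?_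
    have h4 : (768 * ε / Y ^ 8) ^ 4 * (27 ^ 3 * 75 * Y ^ 2) = (ε / Y ^ 10) ^ 3 := by
      rw [hε]; field_simp
    have h5 : (768 * ε / Y ^ 8) ^ 4 * (27 ^ 3 * 75 * Y ^ 2) ≤ B ^ 4 * (27 ^ 3 * 75 * Y ^ 2) := by
      rw [h4]; linarith
    exact le_of_mul_le_mul_right h5 (by positivity)
  have hsmall : ε / Y ^ 10 ≤ 1 := by
    rw [div_le_one (by positivity)]
    exact hε1.trans (one_le_pow₀ hy)
  rcases le_total (ε / Y ^ 10) x with h | h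
  · refine le_trans ?_ (hbig x h hx1)
    gcongr
    norm_num
  · set x₀ := ε / Y ^ 10
    have hconv : Convex ℝ {s : ℂ | 1 ≤ s.re ∧ s.re ≤ 2 ∧ s.im = y} := by
      refine (convex_halfSpace_re_ge 1).inter ((convex_halfSpace_re_le 2).inter ?_)
      exact convex_hyperplane ⟨fun a b => Complex.add_im a b, fun c a => Complex.smul_im c a⟩ y
    have hdiff := hconv.norm_image_sub_le_of_norm_deriv_le (𝕜 := ℂ) (f := riemannZeta₁)
      (C := 384 * Y ^ 2) (x := 1 + x + I * y) (y := 1 + x₀ + I * y)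
      (fun s _ => differentiable_riemannZeta₁ s) ?_ ?_ ?_
    · have e : ((1 + x₀ + I * y : ℂ) - (1 + x + I * y)) = ((x₀ - x : ℝ) : ℂ) := by
        push_cast; ring
      rw [e, Complex.norm_real, Real.norm_of_nonneg (by linarith)] at hdiff
      have h1 := hbig x₀ le_rfl hsmall
      have h2 : 384 * Y ^ 2 * (x₀ - x) ≤ 384 * ε / Y ^ 8 := by
        calc 384 * Y ^ 2 * (x₀ - x) ≤ 384 * Y ^ 2 * x₀ := by gcongr; linarith
          _ = 384 * ε / Y ^ 8 := by simp only [x₀]; field_simp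
      have h3 : 768 * ε / Y ^ 8 = 384 * ε / Y ^ 8 + 384 * ε / Y ^ 8 := by ring
      have h4 := norm_sub_norm_le (riemannZeta₁ (1 + x₀ + I * y)) (riemannZeta₁ (1 + x + I * y))
      linarith
    · rintro s ⟨h1, h2, h3⟩
      have h4 := norm_iteratedDeriv_riemannZeta₁_le 1 h1
      rw [iteratedDeriv_one] at h4
      refine h4.trans ?_
      have h5 : ‖s‖ ≤ 2 + Y := by
        refine (norm_le_abs_re_add_abs_im s).trans ?_
        rw [h3, abs_of_nonneg (by linarith)]
        linarith
      calc _ ≤ ((1 : ℕ).factorial * 12 * 2 ^ 1) * (1 + (2 + Y)) ^ 2 := by gcongr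
        _ ≤ 384 * Y ^ 2 := by simp; nlinarith
    · refine ⟨?_, ?_, ?_⟩ <;> simp <;> linarith
    · have hx₀ : 0 ≤ x₀ := by positivity
      refine ⟨?_, ?_, ?_⟩ <;> simp <;> linarith

/-- `(s - 1) ζ(s)` decays at most polynomially in `1 ≤ Re s ≤ 2`. -/
lemma exists_le_norm_riemannZeta₁ :
    ∃ c : ℝ, 0 < c ∧ ∀ x y : ℝ, 0 ≤ x → x ≤ 1 →
      c / (1 + |y|) ^ 8 ≤ ‖riemannZeta₁ (1 + x + I * y)‖ := by
  -- For `|y| ≤ 1` the bound is the minimum over a compact rectangle, positive because `Z` has no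
  -- zero with `Re s ≥ 1`.
  have hcomp : IsCompact (Icc (1 : ℝ) 2 ×ℂ Icc (-1 : ℝ) 1) := isCompact_Icc.reProdIm isCompact_Icc
  obtain ⟨s₀, hs₀, hmin⟩ := hcomp.exists_isMinOn (f := fun s => ‖riemannZeta₁ s‖)
    ⟨1, by simp [mem_reProdIm]⟩ differentiable_riemannZeta₁.continuous.norm.continuousOn
  have hpos : 0 < ‖riemannZeta₁ s₀‖ :=
    norm_pos_iff.2 (riemannZeta₁_ne_zero (mem_reProdIm.1 hs₀).1.1)
  set c₁ : ℝ := 384 * (1 / (27 ^ 3 * 75 * 768 ^ 4))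
  have hc₁ : 0 < c₁ := by positivity
  refine ⟨min ‖riemannZeta₁ s₀‖ c₁, lt_min hpos hc₁, fun x y hx0 hx1 => ?_⟩
  rcases le_total 1 |y| with hy | hy
  · refine le_trans ?_ (le_norm_riemannZeta₁_of_one_le_abs hx0 hx1 hy)
    have : 0 < |y| := by linarith
    gcongr
    · exact min_le_right _ _
    · linarith
  · have hmem : (1 + x + I * y : ℂ) ∈ Icc (1 : ℝ) 2 ×ℂ Icc (-1 : ℝ) 1 := by
      rw [mem_reProdIm]
      refine ⟨⟨?_, ?_⟩, ?_⟩
      · simp; linarith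
      · simp; linarith
      · simpa using abs_le.1 hy
    refine le_trans ?_ (hmin hmem)
    have h1 : (1 : ℝ) ≤ (1 + |y|) ^ 8 := one_le_pow₀ (by linarith [abs_nonneg y])
    exact (div_le_self (le_min hpos.le hc₁.le) h1).trans (min_le_left _ _)

end ZetaBounds

/-! ### Temperate growth of `Z'/Z` on the line `Re s = 1`. -/

section TemperateGrowth

open Complex Set Topology
open scoped ContDiff

/-- Leibniz' rule for the constant product `f⁻¹ * f = 1` expresses the `n`-th derivative of `f⁻¹` as
`f⁻¹` times products of lower derivatives of `f⁻¹` with derivatives of `f`. Strong induction on `n`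
then closes. -/
lemma hasTemperateGrowth_inv {f : ℝ → ℂ} (hf : f.HasTemperateGrowth) {c : ℝ} (hc : 0 < c) {N : ℕ}
    (h : ∀ x, c / (1 + ‖x‖) ^ N ≤ ‖f x‖) : (fun x => (f x)⁻¹).HasTemperateGrowth := by
  have hpos : ∀ x : ℝ, 0 < 1 + ‖x‖ := fun x => by positivity
  have hne : ∀ x, f x ≠ 0 := fun x hx => by
    have := h x
    rw [hx, norm_zero] at this
    have h2 : 0 < c / (1 + ‖x‖) ^ N := div_pos hc (pow_pos (hpos x) _)
    linarith
  have hinv : ContDiff ℝ ∞ (fun x => (f x)⁻¹) := hf.1.inv hne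
  have hinvb : ∀ x, ‖(f x)⁻¹‖ ≤ c⁻¹ * (1 + ‖x‖) ^ N := by
    intro x
    rw [norm_inv]
    have h2 : 0 < c / (1 + ‖x‖) ^ N := div_pos hc (pow_pos (hpos x) _)
    calc ‖f x‖⁻¹ ≤ (c / (1 + ‖x‖) ^ N)⁻¹ := inv_anti₀ h2 (h x)
      _ = _ := by rw [inv_div, div_eq_inv_mul]
  refine ⟨hinv, fun n => ?_⟩
  simp_rw [norm_iteratedFDeriv_eq_norm_iteratedDeriv]
  induction n using Nat.strong_induction_on with
  | _ n ih =>
  rcases Nat.eq_zero_or_pos n with rfl | hn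
  · exact ⟨N, c⁻¹, by simpa using! hinvb⟩
  obtain ⟨k₁, C₁, hC₁, hf₁⟩ := hf.norm_iteratedFDeriv_le_uniform n
  choose! k C hkC using ih
  have hC0 : ∀ m < n, 0 ≤ C m := fun m hm => by
    have := (norm_nonneg _).trans (hkC m hm 0)
    simpa using this
  have hmul : ∀ x, f x * iteratedDeriv n (fun x => (f x)⁻¹) x
      = - ∑ i ∈ Finset.range n, (n.choose i : ℂ) * iteratedDeriv i (fun x => (f x)⁻¹) x
          * iteratedDeriv (n - i) f x := by
    intro x
    have h1 := iteratedDeriv_mul (n := n) (x := x) (f := fun x => (f x)⁻¹) (g := f)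
      (hinv.contDiffAt.of_le (by exact_mod_cast le_top))
      (hf.1.contDiffAt.of_le (by exact_mod_cast le_top))
    have h2 : ((fun x => (f x)⁻¹) * f) = fun _ => (1 : ℂ) := by
      ext x; simp [hne x]
    rw [h2, Finset.sum_range_succ, iteratedDeriv_const, if_neg hn.ne'] at h1
    simp only [Nat.choose_self, Nat.cast_one, one_mul, Nat.sub_self, iteratedDeriv_zero] at h1
    linear_combination -h1
  refine ⟨N + (∑ i ∈ Finset.range n, k i + k₁), c⁻¹ * ∑ i ∈ Finset.range n, (n.choose i) * C i * C₁,
    fun x => ?_⟩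
  have hx1 : 1 ≤ 1 + ‖x‖ := by linarith [norm_nonneg x]
  have h3 : iteratedDeriv n (fun x => (f x)⁻¹) x = (f x)⁻¹ *
      - ∑ i ∈ Finset.range n, (n.choose i : ℂ) * iteratedDeriv i (fun x => (f x)⁻¹) x
          * iteratedDeriv (n - i) f x := by
    rw [← hmul x, inv_mul_cancel_left₀ (hne x)]
  rw [h3, norm_mul, norm_neg, pow_add, mul_mul_mul_comm, Finset.sum_mul]
  gcongr
  · exact hinvb x
  refine (norm_sum_le _ _).trans (Finset.sum_le_sum fun i hi => ?_)
  rw [norm_mul, norm_mul, Complex.norm_natCast]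
  have hi' := Finset.mem_range.1 hi
  have h4 : (1 + ‖x‖) ^ k i * (1 + ‖x‖) ^ k₁ ≤ (1 + ‖x‖) ^ (∑ i ∈ Finset.range n, k i + k₁) := by
    rw [← pow_add]
    refine pow_le_pow_right₀ hx1 ?_
    gcongr
    exact Finset.single_le_sum (f := k) (fun _ _ => Nat.zero_le _) hi
  have h5 : ‖iteratedDeriv (n - i) f x‖ ≤ C₁ * (1 + ‖x‖) ^ k₁ := by
    rw [← norm_iteratedFDeriv_eq_norm_iteratedDeriv]
    exact hf₁ _ (Nat.sub_le _ _) x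
  calc _ ≤ (n.choose i) * (C i * (1 + ‖x‖) ^ k i) * (C₁ * (1 + ‖x‖) ^ k₁) := by
        have := hC0 i hi'
        gcongr
        exact hkC i hi' x
    _ = (n.choose i) * C i * C₁ * ((1 + ‖x‖) ^ k i * (1 + ‖x‖) ^ k₁) := by ring
    _ ≤ _ := by
        have := hC0 i hi'
        gcongr

lemma iteratedDeriv_comp_ofReal_affine {F : ℂ → ℂ} (hF : Differentiable ℂ F) (a b : ℂ) (n : ℕ) :
    iteratedDeriv n (fun ξ : ℝ => F (a + b * ξ)) =
      fun ξ : ℝ => b ^ n * iteratedDeriv n F (a + b * ξ) := by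
  induction n with
  | zero => ext ξ; simp
  | succ n ih =>
    ext ξ
    rw [iteratedDeriv_succ, ih, iteratedDeriv_succ]
    have hd : HasDerivAt (iteratedDeriv n F) (deriv (iteratedDeriv n F) (a + b * ξ)) (a + b * ξ) :=
      ((hF.contDiff (n := (n + 1 : ℕ))).differentiable_iteratedDeriv n (by exact_mod_cast Nat.lt_succ_self n) _).hasDerivAt
    have hl : HasDerivAt (fun ξ : ℝ => a + b * (ξ : ℂ)) b ξ := by
      simpa using ((Complex.ofRealCLM.hasDerivAt (x := ξ)).const_mul b).const_add a
    have := (hd.scomp ξ hl).const_mul (b ^ n)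
    refine (HasDerivAt.deriv this).trans ?_
    rw [smul_eq_mul]
    ring

/-- The point `1 + 2πiξ` of the line `Re s = 1`. -/
noncomputable def edgePoint (ξ : ℝ) : ℂ := 1 + (2 * Real.pi * I) * ξ

lemma norm_edgePoint_le (ξ : ℝ) : 1 + ‖edgePoint ξ‖ ≤ 8 * (1 + ‖ξ‖) := by
  have h : ‖edgePoint ξ‖ ≤ 1 + 2 * Real.pi * ‖ξ‖ := by
    refine (norm_add_le _ _).trans (le_of_eq ?_)
    simp [abs_of_pos Real.pi_pos]
  have := Real.pi_le_four
  nlinarith [norm_nonneg ξ]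

lemma hasTemperateGrowth_comp_edgePoint {F : ℂ → ℂ} (hF : Differentiable ℂ F) {A : ℕ → ℝ}
    (hA : ∀ n s, 1 ≤ s.re → ‖iteratedDeriv n F s‖ ≤ A n * (1 + ‖s‖) ^ 2) :
    (fun ξ : ℝ => F (edgePoint ξ)).HasTemperateGrowth := by
  have hre : ∀ ξ : ℝ, 1 ≤ (edgePoint ξ).re := fun ξ => by simp [edgePoint]
  have hA0 : ∀ n, 0 ≤ A n := fun n => by
    have := (norm_nonneg _).trans (hA n 1 (by simp))
    exact nonneg_of_mul_nonneg_left this (by positivity)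
  refine ⟨?_, fun n => ?_⟩
  · have h1 : ContDiff ℝ ∞ F := (hF.contDiff (n := ∞)).restrict_scalars ℝ
    have h2 : ContDiff ℝ ∞ edgePoint := by
      unfold edgePoint
      exact contDiff_const.add (contDiff_const.mul Complex.ofRealCLM.contDiff)
    exact h1.comp h2
  · refine ⟨2, (2 * Real.pi) ^ n * (A n * 64), fun ξ => ?_⟩
    rw [norm_iteratedFDeriv_eq_norm_iteratedDeriv]
    simp only [edgePoint]
    rw [iteratedDeriv_comp_ofReal_affine hF, norm_mul, norm_pow]
    have h1 : ‖(2 * Real.pi * I : ℂ)‖ = 2 * Real.pi := by simp [abs_of_pos Real.pi_pos]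
    rw [h1]
    calc (2 * Real.pi) ^ n * ‖iteratedDeriv n F (edgePoint ξ)‖
        ≤ (2 * Real.pi) ^ n * (A n * (8 * (1 + ‖ξ‖)) ^ 2) := by
          have := hA0 n
          gcongr
          refine (hA n _ (hre ξ)).trans ?_
          gcongr
          exact norm_edgePoint_le ξ
      _ = _ := by ring

lemma hasTemperateGrowth_riemannZeta₁_edgePoint :
    (fun ξ : ℝ => riemannZeta₁ (edgePoint ξ)).HasTemperateGrowth :=
  hasTemperateGrowth_comp_edgePoint differentiable_riemannZeta₁
    fun n _ hs => norm_iteratedDeriv_riemannZeta₁_le n hs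

lemma hasTemperateGrowth_deriv_riemannZeta₁_edgePoint :
    (fun ξ : ℝ => deriv riemannZeta₁ (edgePoint ξ)).HasTemperateGrowth := by
  refine hasTemperateGrowth_comp_edgePoint (A := fun n => (n + 1).factorial * 12 * 2 ^ (n + 1))
    ?_ fun n s hs => ?_
  · have := (differentiable_riemannZeta₁.contDiff (n := 2)).differentiable_iteratedDeriv 1
      (by norm_num)
    rwa [iteratedDeriv_one] at this
  · rw [← iteratedDeriv_succ']
    exact norm_iteratedDeriv_riemannZeta₁_le (n + 1) hs

/-- `-Z'/Z` on the line `Re s = 1`, where `Z(s) = (s - 1) ζ(s)`. -/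
noncomputable def edgeLogDeriv (ξ : ℝ) : ℂ :=
  -(deriv riemannZeta₁ (edgePoint ξ) * (riemannZeta₁ (edgePoint ξ))⁻¹)

lemma hasTemperateGrowth_edgeLogDeriv : edgeLogDeriv.HasTemperateGrowth := by
  obtain ⟨c, hc, h⟩ := exists_le_norm_riemannZeta₁
  have hinv := hasTemperateGrowth_inv hasTemperateGrowth_riemannZeta₁_edgePoint
    (c := c / 8 ^ 8) (by positivity) (N := 8) fun ξ => by
      have h1 := h 0 (2 * Real.pi * ξ) le_rfl zero_le_one
      have h2 : (1 + ((0 : ℝ) : ℂ) + I * ((2 * Real.pi * ξ : ℝ) : ℂ)) = edgePoint ξ := by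
        simp only [edgePoint]; push_cast; ring
      rw [h2] at h1
      refine le_trans ?_ h1
      rw [div_div, ← mul_pow]
      gcongr
      rw [abs_mul, abs_of_pos (by positivity : 0 < 2 * Real.pi), Real.norm_eq_abs]
      have := Real.pi_le_four
      nlinarith [abs_nonneg ξ]
  exact (hasTemperateGrowth_deriv_riemannZeta₁_edgePoint.mul hinv).neg

/-- `Z'/Z` is polynomially bounded in `1 ≤ Re s ≤ 2`, uniformly. -/
lemma exists_norm_logDeriv_riemannZeta₁_le : ∃ C : ℝ, 0 ≤ C ∧ ∀ δ ξ : ℝ, 0 ≤ δ → δ ≤ 1 →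
    ‖deriv riemannZeta₁ (edgePoint ξ + δ) * (riemannZeta₁ (edgePoint ξ + δ))⁻¹‖
      ≤ C * (1 + ‖ξ‖) ^ 10 := by
  obtain ⟨c, hc, h⟩ := exists_le_norm_riemannZeta₁
  refine ⟨24 * 9 ^ 2 * (8 ^ 8 / c), by positivity, fun δ ξ h0 h1 => ?_⟩
  have hre : 1 ≤ (edgePoint ξ + δ).re := by simp [edgePoint, h0]
  have hb := norm_iteratedDeriv_riemannZeta₁_le 1 hre
  rw [iteratedDeriv_one] at hb
  have h3 : 1 + ‖edgePoint ξ + δ‖ ≤ 9 * (1 + ‖ξ‖) := by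
    have h4 := norm_edgePoint_le ξ
    have h5 := norm_add_le (edgePoint ξ) (δ : ℂ)
    rw [Complex.norm_real, Real.norm_of_nonneg h0] at h5
    linarith [norm_nonneg ξ]
  have hl := h δ (2 * Real.pi * ξ) h0 h1
  have h2 : (1 + (δ : ℂ) + I * ((2 * Real.pi * ξ : ℝ) : ℂ)) = edgePoint ξ + δ := by
    simp only [edgePoint]; push_cast; ring
  rw [h2] at hl
  have hl' : c / (8 * (1 + ‖ξ‖)) ^ 8 ≤ ‖riemannZeta₁ (edgePoint ξ + δ)‖ := by
    refine le_trans ?_ hl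
    gcongr
    rw [abs_mul, abs_of_pos (by positivity : 0 < 2 * Real.pi), Real.norm_eq_abs]
    have := Real.pi_le_four
    nlinarith [abs_nonneg ξ]
  rw [norm_mul, norm_inv]
  have hpos : 0 < c / (8 * (1 + ‖ξ‖)) ^ 8 := by positivity
  calc _ ≤ (((1 : ℕ).factorial * 12 * 2 ^ 1) * (9 * (1 + ‖ξ‖)) ^ 2) *
        (c / (8 * (1 + ‖ξ‖)) ^ 8)⁻¹ := by
        gcongr
        refine hb.trans ?_
        gcongr
    _ = _ := by
        simp only [Nat.factorial_one, Nat.cast_one]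
        rw [inv_div, mul_pow, mul_pow]; ring

end TemperateGrowth

/-! ### A smoothed prime number theorem for the von Mangoldt function. -/

section SmoothedPNT

open Complex Set Topology FourierTransform SchwartzMap ArithmeticFunction

/-- The oscillating factor times the inverse Fourier transform of `f`. -/
noncomputable def twistedInv (f : 𝓢(ℝ, ℂ)) (x ξ : ℝ) : ℂ :=
  exp (2 * Real.pi * I * ξ * x) * 𝓕⁻ f ξ

lemma norm_twistedInv (f : 𝓢(ℝ, ℂ)) (x ξ : ℝ) : ‖twistedInv f x ξ‖ = ‖𝓕⁻ f ξ‖ := by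
  rw [twistedInv, norm_mul]
  have : (2 * Real.pi * I * ξ * x : ℂ) = ((2 * Real.pi * ξ * x : ℝ) : ℂ) * I := by
    push_cast; ring
  rw [this, norm_exp_ofReal_mul_I, one_mul]

lemma continuous_twistedInv (f : 𝓢(ℝ, ℂ)) (x : ℝ) : Continuous (twistedInv f x) := by
  unfold twistedInv
  have := (𝓕⁻ f).continuous
  fun_prop

lemma integrable_twistedInv (f : 𝓢(ℝ, ℂ)) (x : ℝ) : Integrable (twistedInv f x) :=
  (𝓕⁻ f).integrable.mono (continuous_twistedInv f x).aestronglyMeasurable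
    (Eventually.of_forall fun ξ => (norm_twistedInv f x ξ).le)

lemma integral_twistedInv_mul_exp (f : 𝓢(ℝ, ℂ)) (x y : ℝ) :
    ∫ ξ : ℝ, twistedInv f x ξ * exp (-(2 * Real.pi * I * ξ * y)) = f (y - x) := by
  have h1 : f (y - x) = 𝓕 (𝓕⁻ f) (y - x) := by rw [fourier_fourierInv_eq]
  rw [h1, fourier_coe, Real.fourier_real_eq_integral_exp_smul]
  refine integral_congr_ae (Eventually.of_forall fun ξ => ?_)
  simp only [twistedInv, smul_eq_mul]
  rw [mul_right_comm, ← Complex.exp_add]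
  congr 2
  push_cast; ring

lemma fourier_twistedInv (f : 𝓢(ℝ, ℂ)) (x y : ℝ) : 𝓕 (twistedInv f x) y = f (y - x) := by
  rw [← integral_twistedInv_mul_exp, Real.fourier_real_eq_integral_exp_smul]
  refine integral_congr_ae (Eventually.of_forall fun ξ => ?_)
  simp only [smul_eq_mul]
  rw [mul_comm]
  congr 2
  push_cast; ring

lemma edgePoint_add_re (ξ δ : ℝ) : (edgePoint ξ + δ).re = 1 + δ := by simp [edgePoint]

lemma continuous_edgePoint : Continuous edgePoint := by unfold edgePoint; fun_prop

/-- On the line, `n^(-2πiξ)` is a character of frequency `log n`, so Fourier inversion turns each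
Dirichlet term into a sample of `f` at `log n - x`. -/
lemma integral_twistedInv_mul_term (f : 𝓢(ℝ, ℂ)) (x δ : ℝ) (n : ℕ) :
    ∫ ξ : ℝ, twistedInv f x ξ * LSeries.term (fun n => (vonMangoldt n : ℂ)) (edgePoint ξ + δ) n
      = ((vonMangoldt n / (n : ℝ) ^ (1 + δ) : ℝ) : ℂ) * f (Real.log n - x) := by
  rcases Nat.eq_zero_or_pos n with rfl | hn
  · simp
  have hn' : (n : ℂ) ≠ 0 := by exact_mod_cast hn.ne'
  rw [← integral_twistedInv_mul_exp f x, ← integral_const_mul]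
  refine integral_congr_ae (Eventually.of_forall fun ξ => ?_)
  simp only
  rw [LSeries.term_of_ne_zero hn.ne']
  have h1 : (n : ℂ) ^ (edgePoint ξ + δ)
      = ((n : ℝ) ^ (1 + δ) : ℝ) * exp (2 * Real.pi * I * ξ * Real.log n) := by
    rw [Complex.ofReal_cpow (Nat.cast_nonneg n), Complex.ofReal_natCast, ofReal_log (Nat.cast_nonneg n),
      Complex.ofReal_natCast, Complex.cpow_def_of_ne_zero hn', Complex.cpow_def_of_ne_zero hn',
      ← Complex.exp_add]
    congr 1
    simp only [edgePoint]; push_cast; ring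
  rw [h1, Complex.exp_neg]
  push_cast
  have : exp (2 * Real.pi * I * ξ * (Real.log n : ℂ)) ≠ 0 := Complex.exp_ne_zero _
  field_simp

lemma norm_term_vonMangoldt (ξ δ : ℝ) (n : ℕ) :
    ‖LSeries.term (fun n => (vonMangoldt n : ℂ)) (edgePoint ξ + δ) n‖
      = vonMangoldt n / (n : ℝ) ^ (1 + δ) := by
  rw [LSeries.norm_term_eq, edgePoint_add_re]
  rcases Nat.eq_zero_or_pos n with rfl | hn
  · simp
  · rw [if_neg hn.ne', Complex.norm_real, Real.norm_of_nonneg vonMangoldt_nonneg]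

lemma summable_vonMangoldt_div_rpow {a : ℝ} (ha : 1 < a) :
    Summable fun n : ℕ => vonMangoldt n / (n : ℝ) ^ a := by
  have h := (LSeriesSummable_vonMangoldt (s := a) (by simpa using ha)).norm
  refine h.congr fun n => ?_
  have := norm_term_vonMangoldt 0 (a - 1) n
  rw [show edgePoint 0 + ((a - 1 : ℝ) : ℂ) = a by simp [edgePoint], add_sub_cancel] at this
  exact this

/-- Sum and integral may be exchanged because the modulus of a Dirichlet term does not depend on
`ξ`. -/
lemma hasSum_vonMangoldt_rpow (f : 𝓢(ℝ, ℂ)) (x : ℝ) {δ : ℝ} (hδ : 0 < δ) :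
    HasSum (fun n : ℕ => ((vonMangoldt n / (n : ℝ) ^ (1 + δ) : ℝ) : ℂ) * f (Real.log n - x))
      (∫ ξ : ℝ, twistedInv f x ξ *
        LSeries (fun n => (vonMangoldt n : ℂ)) (edgePoint ξ + δ)) := by
  simp_rw [← integral_twistedInv_mul_term f x δ]
  have hcont : ∀ n, Continuous fun ξ : ℝ =>
      LSeries.term (fun n => (vonMangoldt n : ℂ)) (edgePoint ξ + δ) n := by
    intro n
    rcases Nat.eq_zero_or_pos n with rfl | hn
    · simpa using continuous_const
    · have hn' : (n : ℂ) ≠ 0 := by exact_mod_cast hn.ne'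
      simp_rw [LSeries.term_of_ne_zero hn.ne']
      have := continuous_edgePoint
      refine continuous_const.div ?_ fun ξ => by simp [Complex.cpow_eq_zero_iff, hn']
      exact (this.add continuous_const).const_cpow (Or.inl hn')
  have hnorm : ∀ n ξ, ‖twistedInv f x ξ *
      LSeries.term (fun n => (vonMangoldt n : ℂ)) (edgePoint ξ + δ) n‖
      = ‖𝓕⁻ f ξ‖ * (vonMangoldt n / (n : ℝ) ^ (1 + δ)) := fun n ξ => by
    rw [norm_mul, norm_twistedInv, norm_term_vonMangoldt]
  have := hasSum_integral_of_summable_integral_norm (μ := (volume : Measure ℝ)) (E := ℂ) (F := fun (n : ℕ) (ξ : ℝ) =>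
    twistedInv f x ξ * LSeries.term (fun n => (vonMangoldt n : ℂ)) (edgePoint ξ + δ) n) ?_ ?_
  · simp only [tsum_mul_left] at this
    exact this
  · intro n
    refine ((𝓕⁻ f).integrable.norm.mul_const (vonMangoldt n / (n : ℝ) ^ (1 + δ))).mono'
      ((continuous_twistedInv f x).mul (hcont n)).aestronglyMeasurable ?_
    exact Eventually.of_forall fun ξ => (hnorm n ξ).le
  · simp_rw [hnorm, integral_mul_const]
    exact (summable_vonMangoldt_div_rpow (by linarith)).mul_left _

/-- The polar term `1 / (s - 1)` at `s = 1 + δ + 2πiξ` is the Fourier transform of `exp (-δ y)` on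
`y > 0`, and the Fourier transform is symmetric under the integral pairing. -/
lemma integral_exp_mul_eq (f : 𝓢(ℝ, ℂ)) (x : ℝ) {δ : ℝ} (hδ : 0 < δ) :
    ∫ y in Ioi (0 : ℝ), Real.exp (-δ * y) * f (y - x)
      = ∫ ξ : ℝ, twistedInv f x ξ * (δ + 2 * Real.pi * I * ξ)⁻¹ := by
  set g : ℝ → ℂ := (Ioi (0 : ℝ)).indicator fun y => ((Real.exp (-δ * y) : ℝ) : ℂ) with hg
  have hgi : Integrable g := by
    rw [hg, integrable_indicator_iff measurableSet_Ioi]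
    exact (integrableOn_exp_mul_Ioi (by linarith) 0).ofReal
  have h := VectorFourier.integral_fourierIntegral_smul_eq_flip (e := Real.fourierChar)
    (μ := (volume : Measure ℝ)) (ν := (volume : Measure ℝ)) (L := innerₗ ℝ)
    Real.continuous_fourierChar continuous_inner (integrable_twistedInv f x) hgi
  have e1 : ∀ y, VectorFourier.fourierIntegral Real.fourierChar volume (innerₗ ℝ) (twistedInv f x) y
      = f (y - x) := fun y => fourier_twistedInv f x y
  have e2 : ∀ ξ, VectorFourier.fourierIntegral Real.fourierChar volume (innerₗ ℝ).flip g ξ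
      = (δ + 2 * Real.pi * I * ξ)⁻¹ := by
    intro ξ
    rw [flip_innerₗ]
    change 𝓕 g ξ = _
    rw [Real.fourier_real_eq_integral_exp_smul]
    have h1 : ∀ v : ℝ, exp (((-2 * Real.pi * v * ξ : ℝ) : ℂ) * I) • g v
        = (Ioi (0 : ℝ)).indicator (fun v : ℝ => exp (-(δ + 2 * Real.pi * I * ξ) * v)) v := by
      intro v
      by_cases hv : v ∈ Ioi (0 : ℝ)
      · rw [hg, indicator_of_mem hv, indicator_of_mem hv, smul_eq_mul, Complex.ofReal_exp,
          ← Complex.exp_add]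
        congr 1; push_cast; ring
      · rw [hg, indicator_of_notMem hv, indicator_of_notMem hv, smul_zero]
    simp_rw [h1]
    rw [integral_indicator measurableSet_Ioi, integral_exp_mul_complex_Ioi (by simpa using hδ),
      ofReal_zero, mul_zero, Complex.exp_zero, neg_div_neg_eq, one_div]
  simp_rw [e1, e2, smul_eq_mul] at h
  rw [← h, ← integral_indicator measurableSet_Ioi]
  refine integral_congr_ae (Eventually.of_forall fun y => ?_)
  by_cases hy : y ∈ Ioi (0 : ℝ)
  · simp only [hg, indicator_of_mem hy]; ring
  · simp only [hg, indicator_of_notMem hy, mul_zero]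

lemma LSeries_vonMangoldt_edgePoint (ξ : ℝ) {δ : ℝ} (hδ : 0 < δ) :
    LSeries (fun n => (vonMangoldt n : ℂ)) (edgePoint ξ + δ) = (δ + 2 * Real.pi * I * ξ)⁻¹
      - deriv riemannZeta₁ (edgePoint ξ + δ) * (riemannZeta₁ (edgePoint ξ + δ))⁻¹ := by
  set s := edgePoint ξ + δ with hs
  have hre : 1 < s.re := by rw [hs, edgePoint_add_re]; linarith
  have hs1 : s ≠ 1 := by intro h; rw [h] at hre; simp at hre
  have hs1' : s - 1 ≠ 0 := sub_ne_zero.2 hs1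
  have hw : (δ + 2 * Real.pi * I * ξ : ℂ) = s - 1 := by rw [hs, edgePoint]; ring
  have hZ : riemannZeta₁ s ≠ 0 := riemannZeta₁_ne_zero hre.le
  rw [LSeries_vonMangoldt_eq_deriv_riemannZeta_div hre,
    deriv_riemannZeta_eq_neg_inv_sub_sq_mul_add hs1, riemannZeta_eq_inv_sub_mul hs1, hw]
  field_simp
  ring

lemma continuous_logDeriv_shift {δ : ℝ} (hδ : 0 ≤ δ) : Continuous fun ξ : ℝ =>
    deriv riemannZeta₁ (edgePoint ξ + δ) * (riemannZeta₁ (edgePoint ξ + δ))⁻¹ := by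
  have h1 : Continuous fun ξ : ℝ => edgePoint ξ + δ := continuous_edgePoint.add continuous_const
  have h2 := (differentiable_riemannZeta₁.contDiff (n := 1)).continuous_deriv le_rfl
  refine (h2.comp h1).mul ((differentiable_riemannZeta₁.continuous.comp h1).inv₀ fun ξ => ?_)
  exact riemannZeta₁_ne_zero (by rw [edgePoint_add_re]; linarith)

lemma integrable_norm_fourierInv_mul (f : 𝓢(ℝ, ℂ)) (C : ℝ) (k : ℕ) :
    Integrable fun ξ : ℝ => ‖𝓕⁻ f ξ‖ * (C * (1 + ‖ξ‖) ^ k) := by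
  have h : Integrable fun ξ : ℝ => ∑ j ∈ Finset.range (k + 1),
      (C * k.choose j) * (‖ξ‖ ^ j * ‖𝓕⁻ f ξ‖) :=
    integrable_finsetSum _ fun j _ => ((𝓕⁻ f).integrable_pow_mul volume j).const_mul _
  refine h.congr (Eventually.of_forall fun ξ => ?_)
  simp only
  rw [add_comm (1 : ℝ), add_pow, Finset.mul_sum, Finset.mul_sum]
  refine Finset.sum_congr rfl fun j _ => ?_
  simp; ring

/-- Subtracting the integral removes the pole of `-ζ'/ζ`. The remaining integrand stays regular at
`δ = 0`. -/
lemma sum_sub_integral_eq (f : 𝓢(ℝ, ℂ)) (x : ℝ) {δ : ℝ} (hδ : 0 < δ) (hδ1 : δ ≤ 1) :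
    (∑' n : ℕ, ((vonMangoldt n / (n : ℝ) ^ (1 + δ) : ℝ) : ℂ) * f (Real.log n - x))
      - ∫ y in Ioi (0 : ℝ), Real.exp (-δ * y) * f (y - x)
      = ∫ ξ : ℝ, twistedInv f x ξ * -(deriv riemannZeta₁ (edgePoint ξ + δ)
          * (riemannZeta₁ (edgePoint ξ + δ))⁻¹) := by
  obtain ⟨C, hC, hb⟩ := exists_norm_logDeriv_riemannZeta₁_le
  rw [(hasSum_vonMangoldt_rpow f x hδ).tsum_eq, integral_exp_mul_eq f x hδ, sub_eq_iff_eq_add,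
    ← integral_add]
  · refine integral_congr_ae (Eventually.of_forall fun ξ => ?_)
    simp only [LSeries_vonMangoldt_edgePoint ξ hδ]
    ring
  · refine (integrable_norm_fourierInv_mul f C 10).mono'
      ((continuous_twistedInv f x).mul (continuous_logDeriv_shift hδ.le).neg).aestronglyMeasurable
      (Eventually.of_forall fun ξ => ?_)
    rw [norm_mul, norm_twistedInv, norm_neg]
    gcongr
    exact hb δ ξ hδ.le hδ1
  · have hne : ∀ ξ : ℝ, (δ + 2 * Real.pi * I * ξ : ℂ) ≠ 0 := fun ξ h => by
      have := congrArg Complex.re h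
      simp at this
      linarith
    refine ((𝓕⁻ f).integrable.norm.mul_const δ⁻¹).mono'
      ((continuous_twistedInv f x).mul (Continuous.inv₀ (by fun_prop) hne)).aestronglyMeasurable
      (Eventually.of_forall fun ξ => ?_)
    rw [norm_mul, norm_twistedInv, norm_inv]
    gcongr
    have := abs_re_le_norm (δ + 2 * Real.pi * I * ξ : ℂ)
    simp at this
    linarith [le_abs_self δ]

/-- The decay of `f` yields `n^(-1/2)` at the price of `exp (x/2)`. The result is a summable
majorant that also dominates the sums for every `δ > 0`. -/
lemma norm_vonMangoldt_mul_le {f : 𝓢(ℝ, ℂ)} {C : ℝ}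
    (hf : ∀ z, ‖f z‖ ≤ C * Real.exp (-|z| / 2)) (x : ℝ) (n : ℕ) :
    ‖((vonMangoldt n / n : ℝ) : ℂ) * f (Real.log n - x)‖
      ≤ C * Real.exp (x / 2) * (vonMangoldt n / (n : ℝ) ^ (3 / 2 : ℝ)) := by
  rcases Nat.eq_zero_or_pos n with rfl | hn
  · simp
  have hn0 : (0 : ℝ) < n := by exact_mod_cast hn
  have hC : 0 ≤ C := by simpa using (norm_nonneg _).trans (hf 0)
  have h1 : ‖f (Real.log n - x)‖ ≤ C * (Real.exp (x / 2) * (n : ℝ) ^ (-(1 / 2) : ℝ)) := by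
    refine (hf _).trans ?_
    gcongr
    rw [Real.rpow_def_of_pos hn0, ← Real.exp_add]
    gcongr
    linarith [le_abs_self (Real.log n - x)]
  have h2 : (n : ℝ) ^ (3 / 2 : ℝ) = n * ((n : ℝ) ^ (-(1 / 2) : ℝ))⁻¹ := by
    rw [← Real.rpow_neg hn0.le, ← Real.rpow_one_add' hn0.le (by norm_num)]
    norm_num
  rw [norm_mul, Complex.norm_real, Real.norm_of_nonneg (div_nonneg vonMangoldt_nonneg hn0.le)]
  calc _ ≤ vonMangoldt n / n * (C * (Real.exp (x / 2) * (n : ℝ) ^ (-(1 / 2) : ℝ))) := by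
        have := div_nonneg (vonMangoldt_nonneg (n := n)) hn0.le
        gcongr
    _ = _ := by
        rw [h2]
        field_simp

/-- All three terms of `sum_sub_integral_eq` pass to the limit `δ → 0+` by dominated convergence;
for the integral over the line this uses that the bound on `Z'/Z` is uniform in `δ`. -/
lemma tsum_sub_integral_eq {f : 𝓢(ℝ, ℂ)} {C : ℝ} (hf : ∀ z, ‖f z‖ ≤ C * Real.exp (-|z| / 2))
    (x : ℝ) :
    (∑' n : ℕ, ((vonMangoldt n / n : ℝ) : ℂ) * f (Real.log n - x))
      - ∫ y in Ioi (0 : ℝ), f (y - x) = ∫ ξ : ℝ, twistedInv f x ξ * edgeLogDeriv ξ := by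
  obtain ⟨C', hC', hb⟩ := exists_norm_logDeriv_riemannZeta₁_le
  have hev : ∀ᶠ δ : ℝ in 𝓝[>] 0, 0 < δ ∧ δ ≤ 1 := by
    filter_upwards [self_mem_nhdsWithin, mem_nhdsWithin_of_mem_nhds (Iic_mem_nhds one_pos)]
      with δ h1 h2 using ⟨h1, h2⟩
  have hid : Tendsto (fun δ : ℝ => δ) (𝓝[>] 0) (𝓝 0) := tendsto_id.mono_left nhdsWithin_le_nhds
  have hT1 : Tendsto (fun δ : ℝ =>
      ∑' n : ℕ, ((vonMangoldt n / (n : ℝ) ^ (1 + δ) : ℝ) : ℂ) * f (Real.log n - x)) (𝓝[>] 0)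
      (𝓝 (∑' n : ℕ, ((vonMangoldt n / n : ℝ) : ℂ) * f (Real.log n - x))) := by
    refine tendsto_tsum_of_dominated_convergence
      ((summable_vonMangoldt_div_rpow (a := 3 / 2) (by norm_num)).mul_left
        (C * Real.exp (x / 2))) (fun n => ?_) ?_
    · rcases Nat.eq_zero_or_pos n with rfl | hn
      · simp
      have hn0 : (0 : ℝ) < n := by exact_mod_cast hn
      refine Tendsto.mul_const _ ((Complex.continuous_ofReal.tendsto _).comp ?_)
      refine Tendsto.div tendsto_const_nhds ?_ hn0.ne'
      have : Tendsto (fun δ : ℝ => (n : ℝ) ^ (1 + δ)) (𝓝[>] 0) (𝓝 ((n : ℝ) ^ (1 + 0 : ℝ))) :=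
        (Real.continuousAt_const_rpow hn0.ne').tendsto.comp (tendsto_const_nhds.add hid)
      simpa using this
    · filter_upwards [hev] with δ hδ n
      refine le_trans ?_ (norm_vonMangoldt_mul_le hf x n)
      rcases Nat.eq_zero_or_pos n with rfl | hn
      · simp
      have hn0 : (1 : ℝ) ≤ n := by exact_mod_cast hn
      rw [norm_mul, norm_mul]
      gcongr
      rw [Complex.norm_real, Complex.norm_real, Real.norm_of_nonneg (by positivity),
        Real.norm_of_nonneg (by positivity)]
      gcongr
      nth_rw 1 [← Real.rpow_one (n : ℝ)]
      exact Real.rpow_le_rpow_of_exponent_le hn0 (by linarith [hδ.1])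
  have hT2 : Tendsto (fun δ : ℝ => ∫ y in Ioi (0 : ℝ), Real.exp (-δ * y) * f (y - x)) (𝓝[>] 0)
      (𝓝 (∫ y in Ioi (0 : ℝ), f (y - x))) := by
    refine tendsto_integral_filter_of_dominated_convergence (fun y => ‖f (y - x)‖) ?_ ?_ ?_ ?_
    · have := f.continuous
      exact Eventually.of_forall fun δ => Continuous.aestronglyMeasurable (by fun_prop)
    · filter_upwards [hev] with δ hδ
      filter_upwards [ae_restrict_mem measurableSet_Ioi] with y hy
      rw [norm_mul, Complex.norm_real, Real.norm_of_nonneg (Real.exp_pos _).le]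
      refine mul_le_of_le_one_left (norm_nonneg _) (Real.exp_le_one_iff.2 ?_)
      have : 0 < δ * y := mul_pos hδ.1 hy
      linarith
    · exact (f.integrable.comp_sub_right x).norm.integrableOn
    · refine Eventually.of_forall fun y => ?_
      have : Tendsto (fun δ : ℝ => (Real.exp (-δ * y) : ℂ) * f (y - x)) (𝓝 0)
          (𝓝 ((Real.exp (-0 * y) : ℂ) * f (y - x))) := Continuous.tendsto (by fun_prop) 0
      simpa using this.mono_left nhdsWithin_le_nhds
  have hT3 : Tendsto (fun δ : ℝ => ∫ ξ : ℝ, twistedInv f x ξ *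
      -(deriv riemannZeta₁ (edgePoint ξ + δ) * (riemannZeta₁ (edgePoint ξ + δ))⁻¹)) (𝓝[>] 0)
      (𝓝 (∫ ξ : ℝ, twistedInv f x ξ * edgeLogDeriv ξ)) := by
    refine tendsto_integral_filter_of_dominated_convergence
      (fun ξ => ‖𝓕⁻ f ξ‖ * (C' * (1 + ‖ξ‖) ^ 10)) ?_ ?_ (integrable_norm_fourierInv_mul f C' 10) ?_
    · filter_upwards [hev] with δ hδ
      exact ((continuous_twistedInv f x).mul
        (continuous_logDeriv_shift hδ.1.le).neg).aestronglyMeasurable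
    · filter_upwards [hev] with δ hδ
      filter_upwards with ξ
      rw [norm_mul, norm_twistedInv, norm_neg]
      gcongr
      exact hb δ ξ hδ.1.le hδ.2
    · refine Eventually.of_forall fun ξ => Tendsto.const_mul _ (Tendsto.neg ?_)
      have hl : Tendsto (fun δ : ℝ => edgePoint ξ + δ) (𝓝[>] 0) (𝓝 (edgePoint ξ)) := by
        have : Tendsto (fun δ : ℝ => edgePoint ξ + (δ : ℂ)) (𝓝 0)
          (𝓝 (edgePoint ξ + ((0 : ℝ) : ℂ))) := Continuous.tendsto (by fun_prop) 0
        simpa using this.mono_left nhdsWithin_le_nhds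
      have h2 := (differentiable_riemannZeta₁.contDiff (n := 1)).continuous_deriv le_rfl
      refine ((h2.tendsto _).comp hl).mul
        (((differentiable_riemannZeta₁.continuous.tendsto _).comp hl).inv₀ ?_)
      exact riemannZeta₁_ne_zero (by simp [edgePoint])
  refine tendsto_nhds_unique ((hT1.sub hT2).congr' ?_) hT3
  filter_upwards [hev] with δ hδ using sum_sub_integral_eq f x hδ.1 hδ.2

/-- Multiplying the Schwartz function `𝓕⁻ f` by a function of temperate growth keeps it Schwartz, so
the integral is a Schwartz function of `x`. Every power of decay is available; the second suffices.
-/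
lemma isBigO_integral_twistedInv_mul (f : 𝓢(ℝ, ℂ)) :
    (fun x : ℝ => ∫ ξ : ℝ, twistedInv f x ξ * edgeLogDeriv ξ) =O[atTop] fun x : ℝ => 1 / x ^ 2 := by
  set G : 𝓢(ℝ, ℂ) := 𝓕⁻ (smulLeftCLM ℂ edgeLogDeriv (𝓕⁻ f)) with hG
  have h : ∀ x, ∫ ξ : ℝ, twistedInv f x ξ * edgeLogDeriv ξ = G x := by
    intro x
    rw [hG, fourierInv_coe, Real.fourierInv_eq']
    refine integral_congr_ae (Eventually.of_forall fun ξ => ?_)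
    simp only [smulLeftCLM_apply hasTemperateGrowth_edgeLogDeriv, twistedInv, smul_eq_mul]
    rw [mul_assoc, mul_comm (𝓕⁻ f ξ)]
    congr 2
    simp; ring
  obtain ⟨C, hC, hd⟩ := G.decay 2 0
  refine IsBigO.of_bound C ?_
  filter_upwards [eventually_gt_atTop 0] with x hx
  have := hd x
  rw [norm_iteratedFDeriv_zero, Real.norm_of_nonneg hx.le] at this
  rw [h, norm_div, norm_one, norm_pow, Real.norm_of_nonneg hx.le, mul_one_div, le_div_iff₀ (by positivity), mul_comm]
  exact this

lemma isBigO_integral_sub {f : 𝓢(ℝ, ℂ)} {C : ℝ} (hf : ∀ z, ‖f z‖ ≤ C * Real.exp (-|z| / 2)) :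
    (fun x : ℝ => (∫ y in Ioi (0 : ℝ), f (y - x)) - ∫ y, f y) =O[atTop] fun x : ℝ => 1 / x ^ 2 := by
  have hC : 0 ≤ C := by simpa using (norm_nonneg _).trans (hf 0)
  have h1 : (fun x : ℝ => (∫ y in Ioi (0 : ℝ), f (y - x)) - ∫ y, f y) =O[atTop]
      fun x : ℝ => Real.exp (-(1 / 2) * x) := by
    refine IsBigO.of_bound (2 * C) ?_
    filter_upwards [eventually_gt_atTop 0] with x hx
    have e1 : ∫ y, f y = ∫ y, f (y - x) := (integral_sub_right_eq_self (μ := volume) (fun y => f y) x).symm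
    have hint := (f.integrable (μ := volume)).comp_sub_right x
    rw [e1, ← integral_add_compl (measurableSet_Ioi (a := (0 : ℝ))) hint, sub_add_cancel_left,
      norm_neg, compl_Ioi, Real.norm_of_nonneg (Real.exp_pos _).le]
    have e2 : ∫ y in Iic (0 : ℝ), C * Real.exp (-x / 2) * Real.exp ((1 / 2) * y)
        = 2 * C * Real.exp (-(1 / 2) * x) := by
      rw [integral_const_mul, integral_exp_mul_Iic (by norm_num)]
      rw [show -x / 2 = -(1 / 2) * x by ring]
      simp; ring
    rw [← e2]
    refine norm_integral_le_of_norm_le ((integrableOn_exp_mul_Iic (by norm_num) 0).const_mul _) ?_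
    filter_upwards [ae_restrict_mem measurableSet_Iic] with y hy
    refine (hf _).trans ?_
    rw [mul_assoc, ← Real.exp_add, abs_of_nonpos (by linarith [mem_Iic.1 hy])]
    refine le_of_eq ?_
    congr 2; ring
  refine h1.trans ?_
  have := isLittleO_exp_neg_mul_rpow_atTop (a := 1 / 2) (by norm_num) (-2)
  refine (this.isBigO).trans (IsBigO.of_bound 1 ?_)
  filter_upwards [eventually_gt_atTop 0] with x hx
  rw [Real.rpow_neg hx.le]
  simp

/-- The smoothed prime number theorem for the von Mangoldt function. -/
lemma isBigO_tsum_vonMangoldt {f : 𝓢(ℝ, ℂ)} {C : ℝ}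
    (hf : ∀ z, ‖f z‖ ≤ C * Real.exp (-|z| / 2)) :
    (fun x : ℝ => (∑' n : ℕ, ((vonMangoldt n / n : ℝ) : ℂ) * f (Real.log n - x)) - ∫ y, f y)
      =O[atTop] fun x : ℝ => 1 / x ^ 2 := by
  refine ((isBigO_integral_twistedInv_mul f).add (isBigO_integral_sub hf)).congr_left fun x => ?_
  rw [← tsum_sub_integral_eq hf x]
  ring

end SmoothedPNT

/-! ### Passing from prime powers to primes. -/

section SmoothedPNTPrimes

open Complex Set Topology SchwartzMap ArithmeticFunction

lemma summable_primes_rpow_neg {a : ℝ} (ha : 1 < a) :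
    Summable fun p : Nat.Primes => (p : ℝ) ^ (-a) :=
  Nat.Primes.summable_rpow.2 (by linarith)

lemma summable_primes_log_mul_rpow_neg {a : ℝ} (ha : 1 < a) :
    Summable fun p : Nat.Primes => Real.log p * (p : ℝ) ^ (-a) := by
  refine (((summable_vonMangoldt_div_rpow ha).comp_injective
    (i := fun p : Nat.Primes => (p : ℕ)) Subtype.val_injective)).congr fun p => ?_
  simp [vonMangoldt_apply_prime p.2, Real.rpow_neg, div_eq_mul_inv]

lemma summable_of_summable_primePow {F : ℕ → ℝ} (h0 : ∀ n, ¬ IsPrimePow n → F n = 0)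
    (h : Summable fun x : Nat.Primes × ℕ => F ((x.1 : ℕ) ^ (x.2 + 1))) : Summable F := by
  have h1 : Summable fun n : {n : ℕ // IsPrimePow n} => F n := by
    rw [← Nat.Primes.prodNatEquiv.summable_iff]
    exact h.congr fun x => by rw [Function.comp_apply, Nat.Primes.prodNatEquiv_apply]
  have h2 := (summable_subtype_iff_indicator (s := {n : ℕ | IsPrimePow n}) (f := F)).1 h1
  have h3 : {n : ℕ | IsPrimePow n}.indicator F = F :=
    indicator_eq_self.2 (Function.support_subset_iff'.2 fun n hn => h0 n hn)
  rwa [h3] at h2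

/-- The prime powers that are not primes contribute little to the von Mangoldt function. -/
lemma summable_vonMangoldt_not_prime :
    Summable fun n : ℕ => (if n.Prime then 0 else vonMangoldt n) * (n : ℝ) ^ (-(3 / 4) : ℝ) := by
  set F : ℕ → ℝ := fun n => (if n.Prime then 0 else vonMangoldt n) * (n : ℝ) ^ (-(3 / 4) : ℝ) with hF
  have hsupp : ∀ n, ¬ IsPrimePow n → F n = 0 := fun n hn => by
    have : vonMangoldt n = 0 := vonMangoldt_eq_zero_iff.2 hn
    simp [hF, this]
  refine summable_of_summable_primePow (F := F) hsupp ?_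
  set r : ℝ := (2 : ℝ) ^ (-(3 / 4) : ℝ) with hr
  have hr0 : 0 < r := by positivity
  have hr1 : r < 1 := Real.rpow_lt_one_of_one_lt_of_neg (by norm_num) (by norm_num)
  -- An exponent `k + 1 ≥ 2` contributes `p^(-3/2)` times `k - 1` further factors `p^(-3/4) ≤ r`;
  -- the factor `r⁻¹` accounts for the index shift.
  have h1 := (summable_primes_log_mul_rpow_neg (a := 3 / 2) (by norm_num)).mul_of_nonneg
    ((summable_geometric_of_lt_one hr0.le hr1).mul_left r⁻¹)
    (fun p => mul_nonneg (Real.log_nonneg (by exact_mod_cast p.2.one_lt.le)) (by positivity))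
    (fun k => by positivity)
  refine Summable.of_nonneg_of_le (fun x => ?_) (fun x => ?_) h1
  · refine mul_nonneg ?_ (by positivity)
    split_ifs
    · exact le_rfl
    · exact vonMangoldt_nonneg
  · obtain ⟨p, k⟩ := x
    have hlog : 0 ≤ Real.log p := Real.log_nonneg (by exact_mod_cast p.2.one_lt.le)
    have hp0 : (0 : ℝ) < p := by exact_mod_cast p.2.pos
    simp only [hF]
    rcases Nat.eq_zero_or_pos k with rfl | hk
    · simp [p.2]
      positivity
    · have hnp : ¬ ((p : ℕ) ^ (k + 1)).Prime := Nat.Prime.not_prime_pow (by omega)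
      rw [if_neg hnp, vonMangoldt_apply_pow (by omega), vonMangoldt_apply_prime p.2, mul_assoc]
      gcongr
      obtain ⟨j, rfl⟩ := Nat.exists_eq_add_of_le' hk
      have e1 : (((p : ℕ) ^ (j + 1 + 1) : ℕ) : ℝ) ^ (-(3 / 4) : ℝ)
          = (p : ℝ) ^ (-(3 / 2) : ℝ) * ((p : ℝ) ^ (-(3 / 4) : ℝ)) ^ j := by
        push_cast
        rw [← Real.rpow_natCast, ← Real.rpow_mul hp0.le, ← Real.rpow_natCast,
          ← Real.rpow_mul hp0.le, ← Real.rpow_add hp0]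
        congr 1
        push_cast; ring
      rw [e1, pow_succ, mul_comm (r ^ j), inv_mul_cancel_left₀ hr0.ne']
      gcongr
      refine Real.rpow_le_rpow_of_nonpos (by norm_num) ?_ (by norm_num)
      exact_mod_cast p.2.two_le

lemma tsum_primes_add_tsum_not_prime {g : ℕ → ℂ} (hg : Summable g) :
    ∑' n, g n = (∑' p : Nat.Primes, g p) + ∑' n, if n.Prime then 0 else g n := by
  have h1 := hg.tsum_subtype_add_tsum_subtype_compl {n : ℕ | n.Prime}
  rw [← h1]
  congr 1
  rw [tsum_subtype]
  refine tsum_congr fun n => ?_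
  by_cases hn : n.Prime <;> simp [indicator, hn]

/-- The smoothed prime number theorem, over the primes. -/
lemma isBigO_tsum_primes {f : 𝓢(ℝ, ℂ)} {C : ℝ}
    (hf : ∀ z, ‖f z‖ ≤ C * Real.exp (-|z| / 2)) :
    (fun x : ℝ => (∑' p : Nat.Primes, ((Real.log p / p : ℝ) : ℂ) * f (Real.log p - x)) - ∫ y, f y)
      =O[atTop] fun x : ℝ => 1 / x ^ 2 := by
  have hC : 0 ≤ C := by simpa using (norm_nonneg _).trans (hf 0)
  have hsum : ∀ x : ℝ, Summable fun n : ℕ =>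
      ((vonMangoldt n / n : ℝ) : ℂ) * f (Real.log n - x) := fun x =>
    Summable.of_norm_bounded ((summable_vonMangoldt_div_rpow (a := 3 / 2) (by norm_num)).mul_left
        (C * Real.exp (x / 2))) fun n => norm_vonMangoldt_mul_le hf x n
  set K : ℝ := ∑' n : ℕ, (if n.Prime then 0 else vonMangoldt n) * (n : ℝ) ^ (-(3 / 4) : ℝ) with hK
  have hrest : (fun x : ℝ => ∑' n : ℕ, if n.Prime then 0 else
      ((vonMangoldt n / n : ℝ) : ℂ) * f (Real.log n - x)) =O[atTop] fun x : ℝ => 1 / x ^ 2 := by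
    have h1 : (fun x : ℝ => ∑' n : ℕ, if n.Prime then 0 else
        ((vonMangoldt n / n : ℝ) : ℂ) * f (Real.log n - x)) =O[atTop]
        fun x : ℝ => Real.exp (-(1 / 4) * x) := by
      refine IsBigO.of_bound (C * K) (Eventually.of_forall fun x => ?_)
      have h2 : HasSum (fun n : ℕ => C * Real.exp (-(1 / 4) * x) *
          ((if n.Prime then 0 else vonMangoldt n) * (n : ℝ) ^ (-(3 / 4) : ℝ)))
          (C * Real.exp (-(1 / 4) * x) * K) :=
        summable_vonMangoldt_not_prime.hasSum.mul_left _
      rw [Real.norm_of_nonneg (Real.exp_pos _).le, mul_right_comm]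
      refine tsum_of_norm_bounded h2 fun n => ?_
      split_ifs
      · simp
      · rcases Nat.eq_zero_or_pos n with rfl | hn
        · simp
        have hn0 : (0 : ℝ) < n := by exact_mod_cast hn
        rw [norm_mul, Complex.norm_real, Real.norm_of_nonneg (div_nonneg vonMangoldt_nonneg hn0.le)]
        -- Here `-|z| / 2 ≤ z / 4`: giving up `n^(1/4)` gains `exp (-x/4)`, and `n^(-3/4)` is still
        -- summable over the higher prime powers.
        have h3 : ‖f (Real.log n - x)‖
            ≤ C * (Real.exp (-(1 / 4) * x) * (n : ℝ) ^ (1 / 4 : ℝ)) := by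
          refine (hf _).trans ?_
          gcongr
          rw [Real.rpow_def_of_pos hn0, ← Real.exp_add]
          gcongr
          linarith [neg_abs_le (Real.log n - x), abs_nonneg (Real.log n - x)]
        have h4 : (n : ℝ) ^ (-(3 / 4) : ℝ) = (n : ℝ) ^ (1 / 4 : ℝ) / n := by
          rw [← Real.rpow_sub_one hn0.ne']; norm_num
        calc _ ≤ vonMangoldt n / n * (C * (Real.exp (-(1 / 4) * x) * (n : ℝ) ^ (1 / 4 : ℝ))) := by
              have := div_nonneg (vonMangoldt_nonneg (n := n)) hn0.le
              gcongr
          _ = _ := by rw [h4]; ring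
    refine h1.trans ?_
    have := isLittleO_exp_neg_mul_rpow_atTop (a := 1 / 4) (by norm_num) (-2)
    refine (this.isBigO).trans (IsBigO.of_bound 1 ?_)
    filter_upwards [eventually_gt_atTop 0] with x hx
    rw [Real.rpow_neg hx.le]
    simp
  refine ((isBigO_tsum_vonMangoldt hf).sub hrest).congr_left fun x => ?_
  rw [tsum_primes_add_tsum_not_prime (hsum x)]
  have : ∀ p : Nat.Primes, vonMangoldt (p : ℕ) = Real.log p := fun p => vonMangoldt_apply_prime p.2
  simp_rw [this]
  ring

end SmoothedPNTPrimes

/-! ### The kernel `t / cosh^2 t`, `t = exp (-z)`, as a Schwartz function. -/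

section SechKernel

open Set Topology SchwartzMap
open scoped ContDiff

/-- `t^a tanh(t)^b / cosh(t)^2` at `t = exp (-z)`. -/
noncomputable def sechFamily (a b : ℕ) (z : ℝ) : ℝ :=
  Real.exp (-z) ^ a * Real.tanh (Real.exp (-z)) ^ b / Real.cosh (Real.exp (-z)) ^ 2

lemma hasDerivAt_tanh (t : ℝ) : HasDerivAt Real.tanh (1 - Real.tanh t ^ 2) t := by
  have h := (Real.hasDerivAt_sinh t).div (Real.hasDerivAt_cosh t) (Real.cosh_pos t).ne'
  have e : Real.tanh = fun x => Real.sinh x / Real.cosh x := funext Real.tanh_eq_sinh_div_cosh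
  rw [e]
  refine h.congr_deriv ?_
  have := (Real.cosh_pos t).ne'
  simp only
  field_simp

lemma one_sub_tanh_sq (t : ℝ) : 1 - Real.tanh t ^ 2 = 1 / Real.cosh t ^ 2 := by
  have h := Real.cosh_sq t
  have h2 := (Real.cosh_pos t).ne'
  rw [Real.tanh_eq_sinh_div_cosh]
  field_simp
  linarith

lemma abs_tanh_le_one (t : ℝ) : |Real.tanh t| ≤ 1 := (Real.abs_tanh_lt_one t).le

lemma contDiff_tanh {n : WithTop ℕ∞} : ContDiff ℝ n Real.tanh := by
  have e : Real.tanh = fun x => Real.sinh x / Real.cosh x := funext Real.tanh_eq_sinh_div_cosh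
  rw [e]
  exact Real.contDiff_sinh.div Real.contDiff_cosh fun x => (Real.cosh_pos x).ne'

lemma contDiff_sechFamily (a b : ℕ) {n : WithTop ℕ∞} : ContDiff ℝ n (sechFamily a b) := by
  unfold sechFamily
  have h1 : ContDiff ℝ n fun z : ℝ => Real.exp (-z) := Real.contDiff_exp.comp contDiff_neg
  exact ((h1.pow a).mul ((contDiff_tanh.comp h1).pow b)).div ((Real.contDiff_cosh.comp h1).pow 2)
    fun x => pow_ne_zero _ (Real.cosh_pos _).ne'

lemma sechFamily_eq (a b : ℕ) (z : ℝ) : sechFamily a b z =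
    Real.exp (-z) ^ a * Real.tanh (Real.exp (-z)) ^ b * (1 - Real.tanh (Real.exp (-z)) ^ 2) := by
  rw [sechFamily, one_sub_tanh_sq, mul_one_div]

/-- The family is closed under differentiation and the exponent `a` never drops, so a bound for all
members with `a ≥ 1` controls every derivative of the kernel. The truncated `b - 1` is harmless, as
its coefficient vanishes at `b = 0`. -/
lemma deriv_sechFamily (a b : ℕ) :
    deriv (sechFamily a b) = fun z => -a * sechFamily a b z + -b * sechFamily (a + 1) (b - 1) z
      + (b + 2) * sechFamily (a + 1) (b + 1) z := by
  ext z
  set t := Real.exp (-z) with ht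
  have h1 : HasDerivAt (fun z : ℝ => Real.exp (-z)) (-t) z := by
    simpa using (hasDerivAt_neg z).exp
  have h2 : HasDerivAt (fun z : ℝ => Real.tanh (Real.exp (-z))) ((1 - Real.tanh t ^ 2) * -t) z := by
    have := (hasDerivAt_tanh (Real.exp (-z))).comp z h1
    exact this
  have h3 : HasDerivAt (fun z : ℝ => 1 - Real.tanh (Real.exp (-z)) ^ 2)
      (-(2 * Real.tanh t * ((1 - Real.tanh t ^ 2) * -t))) z := by
    simpa using (h2.pow 2).const_sub 1
  have h4 := ((h1.pow a).mul (h2.pow b)).mul h3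
  rw [(h4.congr_of_eventuallyEq (Eventually.of_forall fun w => sechFamily_eq a b w)).deriv]
  simp only [sechFamily_eq, ← ht, Pi.mul_apply, Pi.pow_apply]
  rcases Nat.eq_zero_or_pos a with rfl | ha
  · rcases Nat.eq_zero_or_pos b with rfl | hb
    · simp; ring
    · obtain ⟨b, rfl⟩ := Nat.exists_eq_add_of_le' hb
      simp; ring
  · obtain ⟨a, rfl⟩ := Nat.exists_eq_add_of_le' ha
    rcases Nat.eq_zero_or_pos b with rfl | hb
    · simp; ring
    · obtain ⟨b, rfl⟩ := Nat.exists_eq_add_of_le' hb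
      simp; ring

lemma pow_div_cosh_sq_le (m : ℕ) {t : ℝ} (ht : 0 ≤ t) :
    t ^ m / Real.cosh t ^ 2 ≤ 4 * m.factorial := by
  have h1 : t ^ m / m.factorial ≤ Real.exp t := Real.pow_div_factorial_le_exp t ht m
  have hm : (0 : ℝ) < m.factorial := by exact_mod_cast m.factorial_pos
  rw [div_le_iff₀ hm] at h1
  have h2 : Real.exp t ≤ 2 * Real.cosh t := by
    rw [Real.cosh_eq]; linarith [Real.exp_pos (-t)]
  have h3 : (1 : ℝ) ≤ Real.cosh t := Real.one_le_cosh t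
  rw [div_le_iff₀ (by positivity)]
  calc t ^ m ≤ Real.exp t * m.factorial := h1
    _ ≤ (2 * Real.cosh t) * m.factorial := by gcongr
    _ ≤ 4 * m.factorial * Real.cosh t ^ 2 := by
        have h4 : Real.cosh t ≤ Real.cosh t ^ 2 := by nlinarith
        nlinarith [mul_le_mul_of_nonneg_left h4 hm.le, mul_nonneg hm.le (sq_nonneg (Real.cosh t))]

/-- For `z ≥ 0` one factor of `t^a` is `exp (-z)`, which is where `a ≥ 1` enters. For `z ≤ 0` the
square of `cosh` absorbs one more power of `t` than is present. -/
lemma abs_sechFamily_le {a : ℕ} (ha : 1 ≤ a) (b : ℕ) (z : ℝ) :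
    |sechFamily a b z| ≤ 4 * (a + 1).factorial * Real.exp (-|z|) := by
  set t := Real.exp (-z) with ht
  have ht0 : 0 < t := Real.exp_pos _
  have hc : 0 < Real.cosh t ^ 2 := by have := Real.cosh_pos t; positivity
  have h1 : |sechFamily a b z| ≤ t ^ a / Real.cosh t ^ 2 := by
    rw [sechFamily, ← ht, abs_div, abs_mul, abs_of_pos hc, abs_of_pos (pow_pos ht0 a), abs_pow]
    gcongr
    exact mul_le_of_le_one_right (by positivity) (pow_le_one₀ (abs_nonneg _) (abs_tanh_le_one t))
  refine h1.trans ?_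
  rcases le_total 0 z with hz | hz
  · rw [abs_of_nonneg hz, ← ht]
    obtain ⟨a, rfl⟩ := Nat.exists_eq_add_of_le' ha
    have := pow_div_cosh_sq_le a ht0.le
    have h3 : (a.factorial : ℝ) ≤ (a + 1 + 1).factorial := by
      exact_mod_cast Nat.factorial_le (by omega)
    rw [pow_succ, mul_div_right_comm]
    gcongr
    linarith
  · rw [abs_of_nonpos hz, neg_neg]
    have := pow_div_cosh_sq_le (a + 1) ht0.le
    have h4 : Real.exp z = t⁻¹ := by rw [ht, ← Real.exp_neg, neg_neg]
    rw [h4, ← div_eq_mul_inv, le_div_iff₀ ht0, div_mul_eq_mul_div, ← pow_succ]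
    exact this

lemma exists_iteratedDeriv_sechFamily_le (n : ℕ) : ∀ a : ℕ, 1 ≤ a → ∀ b : ℕ,
    ∃ C, ∀ z, |iteratedDeriv n (sechFamily a b) z| ≤ C * Real.exp (-|z|) := by
  induction n with
  | zero => intro a ha b; exact ⟨_, by simpa using abs_sechFamily_le ha b⟩
  | succ n ih =>
    intro a ha b
    obtain ⟨C₁, h₁⟩ := ih a ha b
    obtain ⟨C₂, h₂⟩ := ih (a + 1) (by omega) (b - 1)
    obtain ⟨C₃, h₃⟩ := ih (a + 1) (by omega) (b + 1)
    refine ⟨a * C₁ + b * C₂ + (b + 2) * C₃, fun z => ?_⟩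
    have c : ∀ a b, ContDiffAt ℝ n (sechFamily a b) z := fun a b => (contDiff_sechFamily a b).contDiffAt
    rw [iteratedDeriv_succ', deriv_sechFamily, iteratedDeriv_fun_add, iteratedDeriv_fun_add,
      iteratedDeriv_const_mul_field, iteratedDeriv_const_mul_field, iteratedDeriv_const_mul_field]
    · refine (abs_add_three _ _ _).trans ?_
      rw [abs_mul, abs_mul, abs_mul, abs_neg, abs_neg, Nat.abs_cast, Nat.abs_cast,
        abs_of_nonneg (by positivity : (0 : ℝ) ≤ b + 2), 
        add_mul _ _ (Real.exp (-|z|)), add_mul _ _ (Real.exp (-|z|)), mul_assoc _ C₁, mul_assoc _ C₂,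
        mul_assoc _ C₃]
      gcongr
      · exact h₁ z
      · exact h₂ z
      · exact h₃ z
    · exact contDiffAt_const.mul (c _ _)
    · exact contDiffAt_const.mul (c _ _)
    · exact (contDiffAt_const.mul (c _ _)).add (contDiffAt_const.mul (c _ _))
    · exact contDiffAt_const.mul (c _ _)

lemma pow_mul_exp_neg_abs_le (k : ℕ) (z : ℝ) : |z| ^ k * Real.exp (-|z|) ≤ k.factorial := by
  have h1 : |z| ^ k / k.factorial ≤ Real.exp |z| := Real.pow_div_factorial_le_exp _ (abs_nonneg z) k
  have hm : (0 : ℝ) < k.factorial := by exact_mod_cast k.factorial_pos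
  rw [div_le_iff₀ hm] at h1
  rw [Real.exp_neg, ← div_eq_mul_inv, div_le_iff₀ (Real.exp_pos _), mul_comm]
  exact h1

/-- The kernel `t / cosh(t)^2` at `t = exp (-z)`, as a Schwartz function. -/
noncomputable def sechSchwartz : 𝓢(ℝ, ℂ) where
  toFun z := (sechFamily 1 0 z : ℂ)
  smooth' := Complex.ofRealCLM.contDiff.comp (contDiff_sechFamily 1 0)
  decay' k n := by
    obtain ⟨C, hC⟩ := exists_iteratedDeriv_sechFamily_le n 1 le_rfl 0
    have hC0 : 0 ≤ C := by simpa using (abs_nonneg _).trans (hC 0)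
    refine ⟨C * k.factorial, fun z => ?_⟩
    have h1 : ‖iteratedFDeriv ℝ n (fun z => (sechFamily 1 0 z : ℂ)) z‖
        = ‖iteratedFDeriv ℝ n (sechFamily 1 0) z‖ :=
      Complex.ofRealLI.norm_iteratedFDeriv_comp_left (contDiff_sechFamily 1 0 (n := n)).contDiffAt
        le_rfl
    rw [h1, norm_iteratedFDeriv_eq_norm_iteratedDeriv, Real.norm_eq_abs, Real.norm_eq_abs]
    calc |z| ^ k * |iteratedDeriv n (sechFamily 1 0) z| ≤ |z| ^ k * (C * Real.exp (-|z|)) := by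
          gcongr
          exact hC z
      _ = C * (|z| ^ k * Real.exp (-|z|)) := by ring
      _ ≤ _ := by
          gcongr
          exact pow_mul_exp_neg_abs_le k z

/-- `z^j` times the kernel `t / cosh(t)^2` at `t = exp (-z)`. -/
noncomputable def sechMoment (j : ℕ) (z : ℝ) : ℝ := z ^ j * sechFamily 1 0 z

lemma hasTemperateGrowth_ofReal_pow (j : ℕ) : (fun z : ℝ => (z : ℂ) ^ j).HasTemperateGrowth :=
  Function.HasTemperateGrowth.pow Function.Complex.hasTemperateGrowth_ofReal j

lemma smulLeftCLM_sechSchwartz_apply (j : ℕ) (z : ℝ) :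
    smulLeftCLM ℂ (fun z : ℝ => (z : ℂ) ^ j) sechSchwartz z = (sechMoment j z : ℂ) := by
  rw [smulLeftCLM_apply (hasTemperateGrowth_ofReal_pow j)]
  have : sechSchwartz z = (sechFamily 1 0 z : ℂ) := rfl
  simp [sechMoment, this]

lemma sechFamily_nonneg (z : ℝ) : 0 ≤ sechFamily 1 0 z := by
  simp only [sechFamily]; positivity

/-- Half of the exponential decay absorbs the factor `z^j`. -/
lemma exists_abs_sechMoment_le (j : ℕ) :
    ∃ C, ∀ z, |sechMoment j z| ≤ C * Real.exp (-|z| / 2) := by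
  refine ⟨2 ^ j * j.factorial * (4 * (1 + 1).factorial), fun z => ?_⟩
  have h1 := pow_mul_exp_neg_abs_le j (z / 2)
  have h2 := abs_sechFamily_le (le_refl 1) 0 z
  rw [abs_div, abs_two, div_pow, div_mul_eq_mul_div, div_le_iff₀ (by positivity)] at h1
  rw [sechMoment, abs_mul, abs_pow]
  have h3 : Real.exp (-|z|) = Real.exp (-(|z| / 2)) * Real.exp (-|z| / 2) := by
    rw [← Real.exp_add]; ring_nf
  calc |z| ^ j * |sechFamily 1 0 z| ≤ |z| ^ j * (4 * (1 + 1).factorial * Real.exp (-|z|)) := by gcongr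
    _ = (|z| ^ j * Real.exp (-(|z| / 2))) * (4 * (1 + 1).factorial) * Real.exp (-|z| / 2) := by
        rw [h3]; ring
    _ ≤ (j.factorial * 2 ^ j) * (4 * (1 + 1).factorial) * Real.exp (-|z| / 2) := by gcongr
    _ = _ := by ring

lemma summable_log_mul_sechMoment (j : ℕ) (x : ℝ) :
    Summable fun p : Nat.Primes => Real.log p / p * sechMoment j (Real.log p - x) := by
  obtain ⟨C, hC⟩ := exists_abs_sechMoment_le j
  have hC0 : 0 ≤ C := by simpa using (abs_nonneg _).trans (hC 0)
  refine Summable.of_norm_bounded ((summable_primes_log_mul_rpow_neg (a := 3 / 2)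
    (by norm_num)).mul_left (C * Real.exp (x / 2))) fun p => ?_
  have hp0 : (0 : ℝ) < p := by exact_mod_cast p.2.pos
  have hlog : 0 ≤ Real.log p := Real.log_nonneg (by exact_mod_cast p.2.one_lt.le)
  have h2 : (p : ℝ) ^ (-(3 / 2) : ℝ) = (p : ℝ) ^ (-(1 / 2) : ℝ) / p := by
    rw [← Real.rpow_sub_one hp0.ne']; norm_num
  rw [Real.norm_eq_abs, abs_mul, abs_of_nonneg (by positivity)]
  calc _ ≤ Real.log p / p * (C * (Real.exp (x / 2) * (p : ℝ) ^ (-(1 / 2) : ℝ))) := by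
        gcongr
        refine (hC _).trans ?_
        gcongr
        rw [Real.rpow_def_of_pos hp0, ← Real.exp_add]
        gcongr
        linarith [le_abs_self (Real.log p - x)]
    _ = _ := by rw [h2]; ring

lemma isBigO_tsum_sechMoment (j : ℕ) :
    (fun x : ℝ => (∑' p : Nat.Primes, Real.log p / p * sechMoment j (Real.log p - x))
      - ∫ z, sechMoment j z) =O[atTop] fun x : ℝ => 1 / x ^ 2 := by
  obtain ⟨C, hC⟩ := exists_abs_sechMoment_le j
  have h := isBigO_tsum_primes (f := smulLeftCLM ℂ (fun z : ℝ => (z : ℂ) ^ j) sechSchwartz) (C := C)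
    (fun z => by rw [smulLeftCLM_sechSchwartz_apply, Complex.norm_real]; exact hC z)
  simp_rw [smulLeftCLM_sechSchwartz_apply] at h
  refine IsBigO.of_norm_left ((isBigO_norm_left.2 h).congr_left fun x => ?_)
  rw [← Complex.norm_real, Complex.ofReal_sub, Complex.ofReal_tsum, integral_complex_ofReal]
  simp only [Complex.ofReal_mul]

end SechKernel

/-! ### Elementary bounds for `tanh` and `log cosh`. -/

section Hyperbolic

open Set Topology

lemma tanh_nonneg {t : ℝ} (ht : 0 ≤ t) : 0 ≤ Real.tanh t := by
  rw [Real.tanh_eq_sinh_div_cosh]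
  exact div_nonneg (Real.sinh_nonneg_iff.2 ht) (Real.cosh_pos t).le

lemma tanh_le_self {t : ℝ} (ht : 0 ≤ t) : Real.tanh t ≤ t := by
  have hd : ∀ x, HasDerivAt (fun x => x - Real.tanh x) (Real.tanh x ^ 2) x := fun x => by
    refine ((hasDerivAt_id x).sub (hasDerivAt_tanh x)).congr_deriv (by ring)
  have hm : Monotone fun x => x - Real.tanh x := by
    refine monotone_of_deriv_nonneg (fun x => (hd x).differentiableAt) fun x => ?_
    rw [(hd x).deriv]; positivity
  have := hm ht
  simp at this
  linarith

lemma abs_tanh_le_abs (t : ℝ) : |Real.tanh t| ≤ |t| := by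
  rcases le_total 0 t with ht | ht
  · rw [abs_of_nonneg (tanh_nonneg ht), abs_of_nonneg ht]; exact tanh_le_self ht
  · rw [← abs_neg, ← Real.tanh_neg, ← abs_neg t, abs_of_nonneg (tanh_nonneg (by linarith)),
      abs_of_nonneg (by linarith : 0 ≤ -t)]
    exact tanh_le_self (by linarith)

lemma one_sub_tanh_nonneg (t : ℝ) : 0 ≤ 1 - Real.tanh t := by
  linarith [(abs_le.1 (abs_tanh_le_one t)).2]

lemma one_sub_tanh_le (t : ℝ) : 1 - Real.tanh t ≤ 2 * Real.exp (-(2 * t)) := by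
  have hc := Real.cosh_pos t
  rw [Real.tanh_eq_sinh_div_cosh, one_sub_div hc.ne', Real.cosh_sub_sinh, div_le_iff₀ hc,
    Real.cosh_eq]
  have h1 : Real.exp (-(2 * t)) * Real.exp t = Real.exp (-t) := by rw [← Real.exp_add]; ring_nf
  have h2 : 0 < Real.exp (-(2 * t)) * Real.exp (-t) := by positivity
  linarith

lemma tendsto_tanh_atTop : Tendsto Real.tanh atTop (𝓝 1) := by
  have h1 : Tendsto (fun t : ℝ => 1 - 2 * Real.exp (-(2 * t))) atTop (𝓝 (1 - 2 * 0)) := by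
    refine tendsto_const_nhds.sub (Tendsto.const_mul _ (Real.tendsto_exp_neg_atTop_nhds_zero.comp ?_))
    exact tendsto_id.const_mul_atTop two_pos
  rw [mul_zero, sub_zero] at h1
  refine tendsto_of_tendsto_of_tendsto_of_le_of_le h1 tendsto_const_nhds (fun t => ?_) fun t => ?_
  · linarith [one_sub_tanh_le t]
  · linarith [one_sub_tanh_nonneg t]

lemma hasDerivAt_log_cosh (t : ℝ) : HasDerivAt (fun t => Real.log (Real.cosh t)) (Real.tanh t) t := by
  rw [Real.tanh_eq_sinh_div_cosh]
  exact (Real.hasDerivAt_cosh t).log (Real.cosh_pos t).ne'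

lemma log_cosh_nonneg (t : ℝ) : 0 ≤ Real.log (Real.cosh t) := Real.log_nonneg (Real.one_le_cosh t)

lemma log_cosh_le_sq (t : ℝ) : Real.log (Real.cosh t) ≤ t ^ 2 / 2 := by
  rw [Real.log_le_iff_le_exp (Real.cosh_pos t)]
  exact Real.cosh_le_exp_half_sq t

lemma log_cosh_le_self {t : ℝ} (ht : 0 ≤ t) : Real.log (Real.cosh t) ≤ t := by
  rw [Real.log_le_iff_le_exp (Real.cosh_pos t), Real.cosh_eq]
  linarith [Real.exp_le_exp.2 (by linarith : -t ≤ t)]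

lemma self_sub_log_two_le_log_cosh (t : ℝ) : t - Real.log 2 ≤ Real.log (Real.cosh t) := by
  rw [Real.le_log_iff_exp_le (Real.cosh_pos t), Real.exp_sub, Real.exp_log two_pos, Real.cosh_eq]
  linarith [Real.exp_pos (-t)]

lemma abs_log_cosh_sub_self_le {t : ℝ} (ht : 0 ≤ t) : |Real.log (Real.cosh t) - t| ≤ 1 := by
  rw [abs_le]
  have := Real.log_two_lt_d9
  constructor <;> linarith [log_cosh_le_self ht, self_sub_log_two_le_log_cosh t]

end Hyperbolic

/-! ### Sums over primes of `log cosh`, `tanh` and the kernel, and their derivatives. -/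

section PrimeSums

open Set Topology

lemma summable_primes_inv_sq : Summable fun p : Nat.Primes => 1 / (p : ℝ) ^ 2 :=
  (summable_primes_rpow_neg (a := 2) (by norm_num)).congr fun p => by
    rw [Real.rpow_neg (Nat.cast_nonneg _), one_div]; norm_cast

/-- The sum over the primes of `log cosh (u / p)`. -/
noncomputable def logCoshSum (u : ℝ) : ℝ := ∑' p : Nat.Primes, Real.log (Real.cosh (u / p))

/-- The sum over the primes of `tanh (u / p) / p`. -/
noncomputable def tanhSum (u : ℝ) : ℝ := ∑' p : Nat.Primes, 1 / (p : ℝ) * Real.tanh (u / p)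

/-- The sum over the primes of `1 / p` times the kernel centred at `x`. -/
noncomputable def sechSum (x : ℝ) : ℝ :=
  ∑' p : Nat.Primes, 1 / (p : ℝ) * sechFamily 1 0 (Real.log p - x)

lemma prime_cast_pos (p : Nat.Primes) : (0 : ℝ) < p := by exact_mod_cast p.2.pos

lemma two_le_prime_cast (p : Nat.Primes) : (2 : ℝ) ≤ p := by exact_mod_cast p.2.two_le

lemma sechFamily_log_sub {u : ℝ} (hu : 0 < u) {p : ℝ} (hp : 0 < p) :
    sechFamily 1 0 (Real.log p - Real.log u) = (u / p) / Real.cosh (u / p) ^ 2 := by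
  have : Real.exp (-(Real.log p - Real.log u)) = u / p := by
    rw [neg_sub, Real.exp_sub, Real.exp_log hu, Real.exp_log hp]
  rw [sechFamily, this]; simp

lemma summable_tanhSum (u : ℝ) :
    Summable fun p : Nat.Primes => 1 / (p : ℝ) * Real.tanh (u / p) := by
  refine Summable.of_norm_bounded (summable_primes_inv_sq.mul_left |u|) fun p => ?_
  have hp := prime_cast_pos p
  rw [Real.norm_eq_abs, abs_mul, abs_of_nonneg (by positivity)]
  calc 1 / (p : ℝ) * |Real.tanh (u / p)| ≤ 1 / p * |u / p| :=
        mul_le_mul_of_nonneg_left (abs_tanh_le_abs _) (by positivity)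
    _ = |u| * (1 / (p : ℝ) ^ 2) := by rw [abs_div, abs_of_pos hp]; field_simp

lemma summable_logCoshSum (u : ℝ) :
    Summable fun p : Nat.Primes => Real.log (Real.cosh (u / p)) := by
  refine Summable.of_nonneg_of_le (fun p => log_cosh_nonneg _) (fun p => log_cosh_le_sq _)
    ((summable_primes_inv_sq.mul_left (u ^ 2 / 2)).congr fun p => ?_)
  have hp := prime_cast_pos p
  field_simp

/-- The derivative of `tanh (u/p) / p` is `1 / (p^2 cosh^2 (u/p))`, that is `1 / (p u)` times `t /
cosh^2 t` at `t = u/p`: the kernel centred at `log u`. -/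
lemma hasDerivAt_tanhSum {u : ℝ} (hu : 0 < u) :
    HasDerivAt tanhSum (sechSum (Real.log u) / u) u := by
  have h := hasDerivAt_tsum (u := fun p : Nat.Primes => 1 / (p : ℝ) ^ 2)
    (g := fun (p : Nat.Primes) u => 1 / (p : ℝ) * Real.tanh (u / p))
    (g' := fun (p : Nat.Primes) u => 1 / (p : ℝ) ^ 2 * (1 - Real.tanh (u / p) ^ 2))
    summable_primes_inv_sq ?_ ?_ (summable_tanhSum 0) u
  · refine h.congr_deriv ?_
    rw [sechSum, ← tsum_div_const]
    refine tsum_congr fun p => ?_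
    have hp := prime_cast_pos p
    have hc := Real.cosh_pos (u / p)
    rw [one_sub_tanh_sq, sechFamily_log_sub hu hp]
    field_simp
  · intro p y
    have := (((hasDerivAt_tanh (y / p)).comp y ((hasDerivAt_id y).div_const (p : ℝ)))).const_mul
      (1 / (p : ℝ))
    refine this.congr_deriv ?_
    have hp := prime_cast_pos p
    field_simp
  · intro p y
    have hp := prime_cast_pos p
    have h1 := abs_tanh_le_one (y / p)
    have h2 : 0 ≤ 1 - Real.tanh (y / p) ^ 2 := by
      rw [one_sub_tanh_sq]; have := Real.cosh_pos (y / p); positivity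
    rw [Real.norm_of_nonneg (by positivity)]
    refine mul_le_of_le_one_right (by positivity) ?_
    nlinarith [sq_nonneg (Real.tanh (y / p))]

lemma hasDerivAt_logCoshSum (u : ℝ) : HasDerivAt logCoshSum (tanhSum u) u := by
  -- The majorant `|y| / p^2` of the derivatives grows with `y`, so the series is differentiated on
  -- a bounded interval around `u`.
  have h := hasDerivAt_tsum_of_isPreconnected
    (u := fun p : Nat.Primes => (|u| + 1) * (1 / (p : ℝ) ^ 2))
    (g := fun (p : Nat.Primes) u => Real.log (Real.cosh (u / p)))
    (g' := fun (p : Nat.Primes) u => 1 / (p : ℝ) * Real.tanh (u / p))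
    (t := Ioo (-(|u| + 1)) (|u| + 1)) (y := u) (y₀ := u)
    (summable_primes_inv_sq.mul_left _) isOpen_Ioo isPreconnected_Ioo ?_ ?_ ?_
    (summable_logCoshSum u) ?_
  · exact h
  · intro p y _
    have hp := prime_cast_pos p
    have := (hasDerivAt_log_cosh (y / p)).comp y ((hasDerivAt_id y).div_const (p : ℝ))
    exact this.congr_deriv (mul_comm _ _)
  · intro p y hy
    have hp := prime_cast_pos p
    have hy' : |y| ≤ |u| + 1 := (abs_lt.2 ⟨hy.1, hy.2⟩).le
    rw [Real.norm_eq_abs, abs_mul, abs_of_nonneg (by positivity : 0 ≤ 1 / (p : ℝ))]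
    calc 1 / (p : ℝ) * |Real.tanh (y / p)| ≤ 1 / p * |y / p| :=
        mul_le_mul_of_nonneg_left (abs_tanh_le_abs _) (by positivity)
      _ = |y| * (1 / (p : ℝ) ^ 2) := by rw [abs_div, abs_of_pos hp]; field_simp
      _ ≤ _ := by gcongr
  · have := abs_le.1 (le_refl |u|)
    constructor <;> linarith
  · have := abs_le.1 (le_refl |u|)
    constructor <;> linarith

lemma integrable_sechFamily : Integrable (sechFamily 1 0) := by
  have h := (sechSchwartz.integrable (μ := volume)).re
  exact h

/-- The kernel is the derivative of `-tanh (exp (-z))`. Its unit mass is what gives `sechSum` the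
main term `1/x`. -/
lemma integral_sechFamily : ∫ z, sechFamily 1 0 z = 1 := by
  have hd : ∀ z, HasDerivAt (fun z : ℝ => -Real.tanh (Real.exp (-z))) (sechFamily 1 0 z) z := by
    intro z
    have h1 : HasDerivAt (fun z : ℝ => Real.exp (-z)) (-Real.exp (-z)) z := by
      simpa using (hasDerivAt_neg z).exp
    refine ((hasDerivAt_tanh _).comp z h1).neg.congr_deriv ?_
    rw [sechFamily_eq]; ring
  have h := integral_of_hasDerivAt_of_tendsto hd integrable_sechFamily (m := -1) (n := -0) ?_ ?_
  · rw [h]; norm_num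
  · exact (tendsto_tanh_atTop.comp (Real.tendsto_exp_atTop.comp tendsto_neg_atBot_atTop)).neg
  · have h0 : Tendsto Real.tanh (𝓝 0) (𝓝 0) := by
      simpa using (hasDerivAt_tanh 0).continuousAt.tendsto
    exact (h0.comp Real.tendsto_exp_neg_atTop_nhds_zero).neg

/-- The first moment of the kernel. -/
noncomputable def sechMean : ℝ := ∫ z, sechMoment 1 z

lemma isBigO_one_div_sq_one_div : (fun x : ℝ => 1 / x ^ 2) =O[atTop] fun x : ℝ => 1 / x := by
  refine IsBigO.of_bound 1 ?_
  filter_upwards [eventually_ge_atTop 1] with x hx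
  rw [Real.norm_of_nonneg (by positivity), Real.norm_of_nonneg (by positivity), one_mul]
  gcongr
  nlinarith

/-- With `y = log p`, write `1/p = (log p / p) / y` and use `1/y = 1/x - (y - x)/x^2 + (y -
x)^2/(x^2 y)`. The smoothed prime number theorem evaluates the first two terms through the moments
`0` and `1` of the kernel; the last is controlled by the moments `2` and `4`. -/
lemma isBigO_sechSum : (fun x : ℝ => sechSum x - (1 / x - sechMean / x ^ 2))
    =O[atTop] fun x : ℝ => 1 / x ^ 3 := by
  set A : ℕ → ℝ → ℝ := fun j x => ∑' p : Nat.Primes, Real.log p / p * sechMoment j (Real.log p - x)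
    with hA
  set R : ℝ → ℝ := fun x => ∑' p : Nat.Primes, 1 / (p : ℝ) * sechMoment 2 (Real.log p - x) with hR
  have hAbd : ∀ j, A j =O[atTop] fun _ : ℝ => (1 : ℝ) := by
    intro j
    have h1 := (isBigO_tsum_sechMoment j).trans (isBigO_one_div_sq_one_div.trans
      (g := fun x : ℝ => 1 / x) (k := fun _ : ℝ => (1 : ℝ)) ?_)
    · have h2 := h1.add (isBigO_const_const (∫ z, sechMoment j z) (one_ne_zero (α := ℝ)) atTop)
      refine h2.congr_left fun x => ?_
      simp only [hA]; ring
    · refine IsBigO.of_bound 1 ?_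
      filter_upwards [eventually_ge_atTop 1] with x hx
      rw [Real.norm_of_nonneg (by positivity), norm_one, mul_one, div_le_one (by linarith)]
      exact hx
  have hsum2 : ∀ x, Summable fun p : Nat.Primes => 1 / (p : ℝ) * sechMoment 2 (Real.log p - x) := by
    intro x
    refine Summable.of_nonneg_of_le (fun p => ?_) (fun p => ?_)
      ((summable_log_mul_sechMoment 2 x).mul_left (Real.log 2)⁻¹)
    · have := prime_cast_pos p
      exact mul_nonneg (by positivity) (mul_nonneg (by positivity) (sechFamily_nonneg _))
    · have hp := prime_cast_pos p
      have h2 : Real.log 2 ≤ Real.log p := Real.log_le_log two_pos (two_le_prime_cast p)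
      have h3 : 0 < Real.log 2 := Real.log_pos one_lt_two
      have h4 : 0 ≤ sechMoment 2 (Real.log p - x) :=
        mul_nonneg (by positivity) (sechFamily_nonneg _)
      rw [← mul_assoc]
      gcongr
      rw [← mul_div_assoc]
      gcongr
      rw [inv_mul_eq_div, one_le_div h3]
      exact h2
  -- the expansion of `1 / log p` around `1 / x`
  have hexp : ∀ x : ℝ, 0 < x → sechSum x = 1 / x * A 0 x - 1 / x ^ 2 * A 1 x + 1 / x ^ 2 * R x := by
    intro x hx
    rw [sechSum, hA, hR]
    simp only
    rw [← tsum_mul_left, ← tsum_mul_left, ← tsum_mul_left,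
      ← ((summable_log_mul_sechMoment 0 x).mul_left _).tsum_sub
        ((summable_log_mul_sechMoment 1 x).mul_left _),
      ← (((summable_log_mul_sechMoment 0 x).mul_left _).sub
        ((summable_log_mul_sechMoment 1 x).mul_left _)).tsum_add ((hsum2 x).mul_left _)]
    refine tsum_congr fun p => ?_
    have hp := prime_cast_pos p
    simp only [sechMoment]
    field_simp
    ring
  have hRO : R =O[atTop] fun x : ℝ => 1 / x := by
    have h3 : 0 < Real.log 2 := Real.log_pos one_lt_two
    have hle : ∀ x : ℝ, 0 < x → ‖R x‖ ≤ ‖2 / x * A 2 x + 4 / (Real.log 2 * x ^ 2) * A 4 x‖ := by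
      intro x hx
      have hR0 : 0 ≤ R x := tsum_nonneg fun p => by
        have := prime_cast_pos p
        exact mul_nonneg (by positivity) (mul_nonneg (by positivity) (sechFamily_nonneg _))
      rw [Real.norm_of_nonneg hR0]
      refine le_trans ?_ (Real.le_norm_self _)
      simp only [hR, hA]
      rw [← tsum_mul_left, ← tsum_mul_left, ← ((summable_log_mul_sechMoment 2 x).mul_left _).tsum_add
        ((summable_log_mul_sechMoment 4 x).mul_left _)]
      refine (hsum2 x).tsum_le_tsum (fun p => ?_) (((summable_log_mul_sechMoment 2 x).mul_left _).add
        ((summable_log_mul_sechMoment 4 x).mul_left _))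
      have hp := prime_cast_pos p
      have h2 : Real.log 2 ≤ Real.log p := Real.log_le_log two_pos (two_le_prime_cast p)
      set y := Real.log p with hy
      have hK := sechFamily_nonneg (y - x)
      -- This restores the weight `y = log p` missing from the remainder: for `y ≥ x/2` the first
      -- term suffices, and for smaller `y` one has `|y - x| ≥ x/2` and `y ≥ log 2`.
      have key : 1 ≤ 2 / x * y + 4 / (Real.log 2 * x ^ 2) * y * (y - x) ^ 2 := by
        have hy0 : 0 < y := by linarith
        rcases le_total (x / 2) y with h | h
        · have h5 : 1 ≤ 2 / x * y := by
            rw [div_mul_eq_mul_div, one_le_div hx]; linarith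
          have h6 : 0 ≤ 4 / (Real.log 2 * x ^ 2) * y * (y - x) ^ 2 := by positivity
          linarith
        · have h5 : 0 ≤ 2 / x * y := by positivity
          have h6 : 1 ≤ 4 / (Real.log 2 * x ^ 2) * y * (y - x) ^ 2 := by
            rw [div_mul_eq_mul_div, div_mul_eq_mul_div, one_le_div (by positivity)]
            have h7 : x ^ 2 ≤ 4 * (y - x) ^ 2 := by nlinarith
            calc Real.log 2 * x ^ 2 ≤ y * (4 * (y - x) ^ 2) := by gcongr
              _ = _ := by ring
          linarith
      simp only [sechMoment]
      calc 1 / (p : ℝ) * ((y - x) ^ 2 * sechFamily 1 0 (y - x))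
          = 1 * (1 / (p : ℝ) * ((y - x) ^ 2 * sechFamily 1 0 (y - x))) := (one_mul _).symm
        _ ≤ (2 / x * y + 4 / (Real.log 2 * x ^ 2) * y * (y - x) ^ 2) *
            (1 / (p : ℝ) * ((y - x) ^ 2 * sechFamily 1 0 (y - x))) := by gcongr
        _ = _ := by ring
    refine (IsBigO.of_bound 1 ?_ : R =O[atTop] fun x =>
      2 / x * A 2 x + 4 / (Real.log 2 * x ^ 2) * A 4 x).trans ?_
    · filter_upwards [eventually_gt_atTop 0] with x hx
      rw [one_mul]; exact hle x hx
    · have e1 : (fun x : ℝ => 2 / x * A 2 x) =O[atTop] fun x : ℝ => 1 / x := by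
        have := ((isBigO_refl (fun x : ℝ => 1 / x) atTop).mul (hAbd 2)).const_mul_left 2
        refine (this.congr_left fun x => by ring).congr_right fun x => by ring
      have e2 : (fun x : ℝ => 4 / (Real.log 2 * x ^ 2) * A 4 x) =O[atTop] fun x : ℝ => 1 / x := by
        have := (isBigO_one_div_sq_one_div.mul (hAbd 4)).const_mul_left (4 / Real.log 2)
        refine (this.congr_left fun x => ?_).congr_right fun x => by ring
        field_simp
      exact e1.add e2
  have t0 : (fun x : ℝ => 1 / x * (A 0 x - 1)) =O[atTop] fun x : ℝ => 1 / x ^ 3 := by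
    have h := (isBigO_refl (fun x : ℝ => 1 / x) atTop).mul (isBigO_tsum_sechMoment 0)
    have e : ∫ z, sechMoment 0 z = 1 := by simpa [sechMoment] using integral_sechFamily
    rw [e] at h
    refine h.congr_right fun x => ?_
    ring
  have t1 : (fun x : ℝ => 1 / x ^ 2 * (A 1 x - sechMean)) =O[atTop] fun x : ℝ => 1 / x ^ 3 := by
    have h := (isBigO_refl (fun x : ℝ => 1 / x ^ 2) atTop).mul
      ((isBigO_tsum_sechMoment 1).trans isBigO_one_div_sq_one_div)
    refine h.congr_right fun x => ?_
    ring
  have t2 : (fun x : ℝ => 1 / x ^ 2 * R x) =O[atTop] fun x : ℝ => 1 / x ^ 3 := by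
    have h := (isBigO_refl (fun x : ℝ => 1 / x ^ 2) atTop).mul hRO
    refine h.congr_right fun x => ?_
    ring
  refine ((t0.sub t1).add t2).congr' ?_ EventuallyEq.rfl
  filter_upwards [eventually_gt_atTop 0] with x hx
  rw [hexp x hx]
  ring

end PrimeSums

/-! ### Integrating the expansion twice, up to an unknown constant. -/

section Integration

open Set Topology

lemma monotoneOn_Ici_of_hasDerivAt {f f' : ℝ → ℝ} {a : ℝ}
    (hf : ∀ u, a ≤ u → HasDerivAt f (f' u) u) (h0 : ∀ u, a ≤ u → 0 ≤ f' u) :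
    MonotoneOn f (Ici a) := by
  refine monotoneOn_of_deriv_nonneg (convex_Ici a)
    (fun u hu => (hf u hu).continuousAt.continuousWithinAt)
    (fun u hu => (hf u (interior_subset hu)).differentiableAt.differentiableWithinAt) fun u hu => ?_
  rw [(hf u (interior_subset hu)).deriv]
  exact h0 u (interior_subset hu)

lemma antitoneOn_Ici_of_hasDerivAt {f f' : ℝ → ℝ} {a : ℝ}
    (hf : ∀ u, a ≤ u → HasDerivAt f (f' u) u) (h0 : ∀ u, a ≤ u → f' u ≤ 0) :
    AntitoneOn f (Ici a) := by
  refine antitoneOn_of_deriv_nonpos (convex_Ici a)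
    (fun u hu => (hf u hu).continuousAt.continuousWithinAt)
    (fun u hu => (hf u (interior_subset hu)).differentiableAt.differentiableWithinAt) fun u hu => ?_
  rw [(hf u (interior_subset hu)).deriv]
  exact h0 u (interior_subset hu)

lemma hasDerivAt_one_div_log_sq {u : ℝ} (hu : 1 < u) :
    HasDerivAt (fun u => 1 / Real.log u ^ 2) (-2 / (u * Real.log u ^ 3)) u := by
  have hl : 0 < Real.log u := Real.log_pos hu
  have h := ((Real.hasDerivAt_log (by linarith : u ≠ 0)).pow 2).inv (pow_pos hl 2).ne'
  simp_rw [one_div]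
  refine h.congr_deriv ?_
  simp only [Pi.pow_apply]
  field_simp
  norm_num [mul_comm]

lemma hasDerivAt_one_div_log {u : ℝ} (hu : 1 < u) :
    HasDerivAt (fun u => 1 / Real.log u) (-1 / (u * Real.log u ^ 2)) u := by
  have hl : 0 < Real.log u := Real.log_pos hu
  have h := (Real.hasDerivAt_log (by linarith : u ≠ 0)).inv hl.ne'
  simp_rw [one_div]
  refine h.congr_deriv ?_
  field_simp

lemma hasDerivAt_log_log {u : ℝ} (hu : 1 < u) :
    HasDerivAt (fun u => Real.log (Real.log u)) (1 / (u * Real.log u)) u := by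
  have hl : 0 < Real.log u := Real.log_pos hu
  refine ((Real.hasDerivAt_log (by linarith : u ≠ 0)).log hl.ne').congr_deriv ?_
  field_simp

/-- A function with derivative `O(1 / (u log³ u))` converges with error `O(1 / log² u)`. -/
lemma exists_limit_of_abs_deriv_le {D D' : ℝ → ℝ} {a C : ℝ} (ha : 1 < a)
    (hD : ∀ u, a ≤ u → HasDerivAt D (D' u) u)
    (hb : ∀ u, a ≤ u → |D' u| ≤ C * (1 / (u * Real.log u ^ 3))) :
    ∃ L, ∀ u, a ≤ u → |D u - L| ≤ C / 2 * (1 / Real.log u ^ 2) := by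
  have hC : 0 ≤ C := by
    have hl : 0 < Real.log a := Real.log_pos ha
    exact nonneg_of_mul_nonneg_left ((abs_nonneg _).trans (hb a le_rfl)) (by positivity)
  have hd : ∀ u, a ≤ u → HasDerivAt (fun u => C / 2 * (1 / Real.log u ^ 2))
      (-(C * (1 / (u * Real.log u ^ 3)))) u := fun u hu =>
    ((hasDerivAt_one_div_log_sq (ha.trans_le hu)).const_mul (C / 2)).congr_deriv (by ring)
  set K : ℝ → ℝ := fun u => C / 2 * (1 / Real.log u ^ 2) with hK
  have hK0 : ∀ u, 0 ≤ K u := fun u => by positivity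
  -- Since `-K'` is the bound on `|D'|`, `D - K` increases and `D + K` decreases. Every value of the
  -- first lies below every value of the second, and the supremum of the first is the limit sought.
  have hmono : MonotoneOn (fun u => D u - K u) (Ici a) :=
    monotoneOn_Ici_of_hasDerivAt (fun u hu => (hD u hu).sub (hd u hu)) fun u hu => by
      have := (abs_le.1 (hb u hu)).1; linarith
  have hanti : AntitoneOn (fun u => D u + K u) (Ici a) :=
    antitoneOn_Ici_of_hasDerivAt (fun u hu => (hD u hu).add (hd u hu)) fun u hu => by
      have := (abs_le.1 (hb u hu)).2; linarith
  have hle : ∀ u v, a ≤ u → a ≤ v → D u - K u ≤ D v + K v := by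
    intro u v hu hv
    rcases le_total u v with h | h
    · have := hmono hu hv h
      simp only at this
      linarith [hK0 v]
    · have := hanti hv hu h
      simp only at this
      linarith [hK0 u]
  set S : Set ℝ := (fun u => D u - K u) '' Ici a
  have hbdd : BddAbove S := ⟨D a + K a, by
    rintro _ ⟨u, hu, rfl⟩; exact hle u a hu le_rfl⟩
  refine ⟨sSup S, fun u hu => ?_⟩
  have h1 : D u - K u ≤ sSup S := le_csSup hbdd ⟨u, hu, rfl⟩
  have h2 : sSup S ≤ D u + K u := by
    refine csSup_le ⟨_, ⟨a, self_mem_Ici, rfl⟩⟩ ?_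
    rintro _ ⟨v, hv, rfl⟩; exact hle v u hv hu
  change |D u - sSup S| ≤ K u
  rw [abs_le]
  constructor <;> linarith

/-- A function with derivative `O(1 / log² u)` is `O(u / log² u)`. -/
lemma isBigO_of_abs_deriv_le {D D' : ℝ → ℝ} {a C : ℝ} (ha : Real.exp 4 ≤ a)
    (hD : ∀ u, a ≤ u → HasDerivAt D (D' u) u)
    (hb : ∀ u, a ≤ u → |D' u| ≤ C * (1 / Real.log u ^ 2)) :
    D =O[atTop] fun u => u / Real.log u ^ 2 := by
  have hlog : ∀ u, a ≤ u → 4 ≤ Real.log u := fun u hu => by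
    rw [Real.le_log_iff_exp_le ((Real.exp_pos 4).trans_le (ha.trans hu))]
    exact ha.trans hu
  have hpos : ∀ u, a ≤ u → 1 < u := fun u hu =>
    (Real.one_lt_exp_iff.2 (by norm_num : (0 : ℝ) < 4)).trans_le (ha.trans hu)
  have hC : 0 ≤ C := by
    have hl := hlog a le_rfl
    exact nonneg_of_mul_nonneg_left ((abs_nonneg _).trans (hb a le_rfl)) (by positivity)
  -- The derivative of `u / log^2 u` is `1 / log^2 u - 2 / log^3 u`, at least half its first term
  -- once `log u ≥ 4`; hence the factor `2` and the threshold `exp 4`.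
  set W : ℝ → ℝ := fun u => 2 * C * (u * (1 / Real.log u ^ 2)) with hW
  set W' : ℝ → ℝ := fun u => 2 * C * (1 / Real.log u ^ 2 - 2 / Real.log u ^ 3) with hW'
  have hd : ∀ u, a ≤ u → HasDerivAt W (W' u) u := fun u hu => by
    have hl := hlog u hu
    have hu1 := hpos u hu
    refine (((hasDerivAt_id u).mul (hasDerivAt_one_div_log_sq hu1)).const_mul (2 * C)).congr_deriv ?_
    simp only [hW', id]
    field_simp
    ring
  have hW'b : ∀ u, a ≤ u → C * (1 / Real.log u ^ 2) ≤ W' u := fun u hu => by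
    have hl := hlog u hu
    have h3 : 2 / Real.log u ^ 3 ≤ 1 / 2 * (1 / Real.log u ^ 2) := by
      rw [div_le_iff₀ (by positivity)]
      have : 1 / 2 * (1 / Real.log u ^ 2) * Real.log u ^ 3 = Real.log u / 2 := by field_simp
      rw [this]; linarith
    simp only [hW']
    nlinarith
  have hW0 : ∀ u, a ≤ u → 0 ≤ W u := fun u hu => by
    have := hpos u hu
    positivity
  have hmono : MonotoneOn (fun u => D u + W u) (Ici a) :=
    monotoneOn_Ici_of_hasDerivAt (fun u hu => (hD u hu).add (hd u hu)) fun u hu => by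
      have := (abs_le.1 (hb u hu)).1; have := hW'b u hu; linarith
  have hanti : AntitoneOn (fun u => D u - W u) (Ici a) :=
    antitoneOn_Ici_of_hasDerivAt (fun u hu => (hD u hu).sub (hd u hu)) fun u hu => by
      have := (abs_le.1 (hb u hu)).2; have := hW'b u hu; linarith
  have h1 : D =O[atTop] fun u => (|D a| + W a) + W u := by
    refine IsBigO.of_bound 1 ?_
    filter_upwards [eventually_ge_atTop a] with u hu
    have e1 := hmono (self_mem_Ici) hu hu
    have e2 := hanti (self_mem_Ici) hu hu
    simp only at e1 e2
    have e3 := hW0 u hu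
    have e4 := hW0 a le_rfl
    have e5 := abs_le.1 (le_refl |D a|)
    rw [one_mul, Real.norm_eq_abs, Real.norm_of_nonneg (by positivity), abs_le]
    constructor <;> linarith
  refine h1.trans (IsBigO.add ?_ ?_)
  · refine IsBigO.of_bound ‖|D a| + W a‖ ?_
    filter_upwards [(Real.isLittleO_pow_log_id_atTop (n := 2)).bound one_pos, eventually_ge_atTop a]
      with u hu hau
    have hl := hlog u hau
    have hu1 := hpos u hau
    have hl0 : 0 < Real.log u := by linarith
    rw [id, Real.norm_of_nonneg (by positivity), Real.norm_of_nonneg (by linarith), one_mul] at hu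
    refine le_mul_of_one_le_right (norm_nonneg _) ?_
    rw [Real.norm_of_nonneg (by positivity), one_le_div (by positivity)]
    exact hu
  · have := (isBigO_refl (fun u : ℝ => u / Real.log u ^ 2) atTop).const_mul_left (2 * C)
    refine this.congr_left fun u => ?_
    simp only [hW]; ring

/-- The derivative is `sechSum (log u) / u`, whose main terms `1 / (u log u)` and `-sechMean / (u
log^2 u)` integrate to `log log u` and `sechMean / log u`. The constant `M` is left undetermined
here. -/
lemma exists_isBigO_tanhSum : ∃ M, (fun u : ℝ => tanhSum u -
    (Real.log (Real.log u) + M + sechMean * (1 / Real.log u))) =O[atTop]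
      fun u : ℝ => 1 / Real.log u ^ 2 := by
  obtain ⟨C, hC⟩ := isBigO_sechSum.bound
  obtain ⟨x₀, hx₀⟩ := eventually_atTop.1 hC
  set a : ℝ := Real.exp (max x₀ 1) with ha
  have hlog : ∀ u, a ≤ u → max x₀ 1 ≤ Real.log u := fun u hu => by
    rw [Real.le_log_iff_exp_le ((Real.exp_pos _).trans_le hu)]
    exact hu
  have ha1 : 1 < a := Real.one_lt_exp_iff.2 (lt_of_lt_of_le one_pos (le_max_right _ _))
  have key : ∃ L, ∀ u, a ≤ u →
      |tanhSum u - (Real.log (Real.log u) + sechMean * (1 / Real.log u)) - L| ≤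
        C / 2 * (1 / Real.log u ^ 2) := by
    refine exists_limit_of_abs_deriv_le (D' := fun u => sechSum (Real.log u) / u -
      (1 / (u * Real.log u) + sechMean * (-1 / (u * Real.log u ^ 2)))) ha1 ?_ ?_
    · intro u hu
      have hu1 := ha1.trans_le hu
      exact (hasDerivAt_tanhSum (by linarith)).sub
        ((hasDerivAt_log_log hu1).add ((hasDerivAt_one_div_log hu1).const_mul _))
    · intro u hu
      have hu1 := ha1.trans_le hu
      have hl := hlog u hu
      have hl1 : 1 ≤ Real.log u := (le_max_right _ _).trans hl
      have h := hx₀ _ ((le_max_left _ _).trans hl)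
      rw [Real.norm_eq_abs, Real.norm_of_nonneg (by positivity)] at h
      have hu0 : 0 < u := by linarith
      have hl0 : 0 < Real.log u := by linarith
      have e : sechSum (Real.log u) / u - (1 / (u * Real.log u) +
        sechMean * (-1 / (u * Real.log u ^ 2)))
        = (sechSum (Real.log u) - (1 / Real.log u - sechMean / Real.log u ^ 2)) / u := by
        field_simp
        ring
      rw [e, abs_div, abs_of_pos hu0, div_le_iff₀ hu0]
      refine h.trans (le_of_eq ?_)
      field_simp
  obtain ⟨L, hL⟩ := key
  refine ⟨L, IsBigO.of_bound (C / 2) ?_⟩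
  filter_upwards [eventually_ge_atTop a] with u hu
  have h0 : 0 ≤ 1 / Real.log u ^ 2 := by positivity
  rw [Real.norm_eq_abs, Real.norm_of_nonneg h0]
  refine le_trans (le_of_eq ?_) (hL u hu)
  congr 1; ring

/-- The derivative of `k log log k` exceeds `log log k` by `1 / log k`. Compensating for this turns
the coefficient `sechMean` into `sechMean - 1`. -/
lemma isBigO_logCoshSum {M : ℝ} (hM : (fun u : ℝ => tanhSum u -
    (Real.log (Real.log u) + M + sechMean * (1 / Real.log u))) =O[atTop]
      fun u : ℝ => 1 / Real.log u ^ 2) :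
    (fun k : ℝ => logCoshSum k - (k * Real.log (Real.log k) + k * M +
      (sechMean - 1) * (k / Real.log k))) =O[atTop] fun k : ℝ => k / Real.log k ^ 2 := by
  obtain ⟨C, hC⟩ := hM.bound
  obtain ⟨x₀, hx₀⟩ := eventually_atTop.1 hC
  set a : ℝ := max x₀ (Real.exp 4) with ha
  have hpos : ∀ u, a ≤ u → 1 < u := fun u hu =>
    (Real.one_lt_exp_iff.2 (by norm_num : (0 : ℝ) < 4)).trans_le ((le_max_right _ _).trans hu)
  have hlog : ∀ u, a ≤ u → 4 ≤ Real.log u := fun u hu => by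
    rw [Real.le_log_iff_exp_le (by linarith [hpos u hu])]
    exact (le_max_right _ _).trans hu
  refine isBigO_of_abs_deriv_le (a := a) (C := C + |sechMean - 1|)
    (D' := fun u => tanhSum u - ((Real.log (Real.log u) + 1 / Real.log u) + M +
      (sechMean - 1) * (1 / Real.log u - 1 / Real.log u ^ 2))) (le_max_right _ _) ?_ ?_
  · intro u hu
    have hu1 := hpos u hu
    have hl := hlog u hu
    have h1 : HasDerivAt (fun k : ℝ => k * Real.log (Real.log k))
        (Real.log (Real.log u) + 1 / Real.log u) u := by
      refine ((hasDerivAt_id u).mul (hasDerivAt_log_log hu1)).congr_deriv ?_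
      simp only [id]
      field_simp
    have h2 : HasDerivAt (fun k : ℝ => k / Real.log k)
        (1 / Real.log u - 1 / Real.log u ^ 2) u := by
      have e : (fun k : ℝ => k / Real.log k) = fun k => k * (1 / Real.log k) := by
        ext k; ring
      rw [e]
      refine ((hasDerivAt_id u).mul (hasDerivAt_one_div_log hu1)).congr_deriv ?_
      simp only [id]
      field_simp
      ring
    have h3 : HasDerivAt (fun k : ℝ => k * M) M u := by
      simpa using (hasDerivAt_id u).mul_const M
    exact (hasDerivAt_logCoshSum u).sub ((h1.add h3).add (h2.const_mul _))
  · intro u hu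
    have hl := hlog u hu
    have h := hx₀ u ((le_max_left _ _).trans hu)
    have h0 : 0 ≤ 1 / Real.log u ^ 2 := by positivity
    rw [Real.norm_eq_abs, Real.norm_of_nonneg h0] at h
    have e : tanhSum u - ((Real.log (Real.log u) + 1 / Real.log u) + M +
      (sechMean - 1) * (1 / Real.log u - 1 / Real.log u ^ 2))
      = (tanhSum u - (Real.log (Real.log u) + M + sechMean * (1 / Real.log u)))
        + (sechMean - 1) * (1 / Real.log u ^ 2) := by ring
    rw [e, add_mul]
    refine (abs_add_le _ _).trans (add_le_add h ?_)
    rw [abs_mul, abs_of_nonneg h0]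

end Integration

/-! ### Identification of `A₀` with the mean of the kernel. -/

section ConstantA

open Set Topology

lemma integrable_sechMoment (j : ℕ) : Integrable (sechMoment j) := by
  have h := ((SchwartzMap.smulLeftCLM ℂ (fun z : ℝ => (z : ℂ) ^ j) sechSchwartz).integrable
    (μ := volume)).re
  refine h.congr (ae_of_all _ fun z => ?_)
  simp only [smulLeftCLM_sechSchwartz_apply]
  rfl

lemma image_exp_neg_univ : (fun z : ℝ => Real.exp (-z)) '' univ = Ioi 0 := by
  ext t
  simp only [image_univ, mem_range, mem_Ioi]
  constructor
  · rintro ⟨z, rfl⟩; exact Real.exp_pos _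
  · intro ht; exact ⟨-Real.log t, by rw [neg_neg, Real.exp_log ht]⟩

lemma hasDerivAt_exp_neg (z : ℝ) : HasDerivAt (fun z : ℝ => Real.exp (-z)) (-Real.exp (-z)) z := by
  simpa using (hasDerivAt_neg z).exp

lemma injOn_exp_neg (s : Set ℝ) : InjOn (fun z : ℝ => Real.exp (-z)) s := fun _ _ _ _ h =>
  neg_injective (Real.exp_injective h)

lemma abs_deriv_smul_log_div_cosh_sq (z : ℝ) :
    |-Real.exp (-z)| • (Real.log (Real.exp (-z)) / Real.cosh (Real.exp (-z)) ^ 2)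
      = -sechMoment 1 z := by
  rw [abs_neg, abs_of_pos (Real.exp_pos _), Real.log_exp, smul_eq_mul, sechMoment, sechFamily]
  ring

lemma integrableOn_log_div_cosh_sq :
    IntegrableOn (fun t : ℝ => Real.log t / Real.cosh t ^ 2) (Ioi 0) := by
  rw [← image_exp_neg_univ, integrableOn_image_iff_integrableOn_abs_deriv_smul MeasurableSet.univ
    (fun z _ => (hasDerivAt_exp_neg z).hasDerivWithinAt) (injOn_exp_neg _)]
  simp only [abs_deriv_smul_log_div_cosh_sq]
  exact (integrable_sechMoment 1).neg.integrableOn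

/-- Under `t = exp (-z)` the kernel times `dz` becomes `dt / cosh^2 t`, and `z = -log t`. -/
lemma integral_log_div_cosh_sq :
    ∫ t in Ioi (0 : ℝ), Real.log t / Real.cosh t ^ 2 = -sechMean := by
  rw [← image_exp_neg_univ, integral_image_eq_integral_abs_deriv_smul MeasurableSet.univ
    (fun z _ => (hasDerivAt_exp_neg z).hasDerivWithinAt) (injOn_exp_neg _)]
  simp only [abs_deriv_smul_log_div_cosh_sq]
  rw [setIntegral_univ, integral_neg, sechMean]

lemma continuous_log_cosh : Continuous fun t => Real.log (Real.cosh t) :=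
  Real.continuous_cosh.log fun t => (Real.cosh_pos t).ne'

lemma intervalIntegrable_log_cosh_div_sq :
    IntervalIntegrable (fun t : ℝ => Real.log (Real.cosh t) / t ^ 2) volume 0 1 := by
  rw [intervalIntegrable_iff]
  refine Measure.integrableOn_of_bounded (M := 1 / 2) (by simp)
    ((continuous_log_cosh.measurable.div (measurable_id.pow_const 2)).aestronglyMeasurable) ?_
  refine ae_of_all _ fun t => ?_
  rw [Real.norm_of_nonneg (div_nonneg (log_cosh_nonneg t) (sq_nonneg t))]
  refine div_le_of_le_mul₀ (sq_nonneg t) (by norm_num) ?_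
  linarith [log_cosh_le_sq t]

lemma integrableOn_log_cosh_sub_self_div_sq :
    IntegrableOn (fun t : ℝ => (Real.log (Real.cosh t) - t) / t ^ 2) (Ioi 1) := by
  have h : IntegrableOn (fun t : ℝ => t ^ (-2 : ℝ)) (Ioi 1) :=
    integrableOn_Ioi_rpow_of_lt (by norm_num) one_pos
  refine Integrable.mono' h ?_ ?_
  · exact ((continuous_log_cosh.measurable.sub measurable_id).div
      (measurable_id.pow_const 2)).aestronglyMeasurable
  · refine (ae_restrict_iff' measurableSet_Ioi).2 (ae_of_all _ fun t ht => ?_)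
    have ht0 : 0 < t := one_pos.trans ht
    rw [Real.norm_eq_abs, abs_div, abs_of_nonneg (sq_nonneg t), Real.rpow_neg ht0.le,
      Real.rpow_two, ← one_div]
    gcongr
    exact abs_log_cosh_sub_self_le ht0.le

/-- Two integrations by parts in one: the integrand plus `log t / cosh^2 t` has the primitive `-log
cosh t / t + tanh t log t`, which vanishes at `0`. -/
lemma integral_zero_one_log_cosh_div_sq :
    ∫ t in (0 : ℝ)..1, Real.log (Real.cosh t) / t ^ 2
      = -Real.log (Real.cosh 1) - ∫ t in Ioc (0 : ℝ) 1, Real.log t / Real.cosh t ^ 2 := by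
  have hi : IntervalIntegrable (fun t : ℝ => Real.log t / Real.cosh t ^ 2) volume 0 1 := by
    rw [intervalIntegrable_iff_integrableOn_Ioc_of_le zero_le_one]
    exact integrableOn_log_div_cosh_sq.mono_set Ioc_subset_Ioi_self
  have hd : ∀ t ∈ Ioo (0 : ℝ) 1, HasDerivAt
      (fun t => -(Real.log (Real.cosh t) / t) + Real.tanh t * Real.log t)
      (Real.log (Real.cosh t) / t ^ 2 + Real.log t / Real.cosh t ^ 2) t := fun t ht => by
    have ht0 : t ≠ 0 := ht.1.ne'
    refine ((((hasDerivAt_log_cosh t).div (hasDerivAt_id t) ht0).neg).add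
      ((hasDerivAt_tanh t).mul (Real.hasDerivAt_log ht0))).congr_deriv ?_
    rw [one_sub_tanh_sq]
    have := (Real.cosh_pos t).ne'
    simp only [id]
    field_simp
    ring
  have h0 : Tendsto (fun t => -(Real.log (Real.cosh t) / t) + Real.tanh t * Real.log t)
      (𝓝[>] 0) (𝓝 0) := by
    have hb : Tendsto (fun t : ℝ => t / 2 + |t * Real.log t|) (𝓝[>] 0) (𝓝 0) := by
      have h1 : Tendsto (fun t : ℝ => t / 2 + |t * Real.log t|) (𝓝 0) (𝓝 (0 / 2 + |0 * Real.log 0|)) :=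
        Continuous.tendsto (by have := Real.continuous_mul_log; fun_prop) 0
      simpa using h1.mono_left nhdsWithin_le_nhds
    refine squeeze_zero_norm' ?_ hb
    filter_upwards [self_mem_nhdsWithin] with t ht
    have ht0 : (0 : ℝ) < t := ht
    refine (norm_add_le _ _).trans (add_le_add ?_ ?_)
    · rw [norm_neg, Real.norm_of_nonneg (div_nonneg (log_cosh_nonneg t) ht0.le), div_le_iff₀ ht0]
      linarith [log_cosh_le_sq t]
    · rw [Real.norm_eq_abs, abs_mul, abs_mul]
      exact mul_le_mul_of_nonneg_right (abs_tanh_le_abs t) (abs_nonneg _)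
  have h1 : Tendsto (fun t => -(Real.log (Real.cosh t) / t) + Real.tanh t * Real.log t)
      (𝓝[<] 1) (𝓝 (-Real.log (Real.cosh 1))) := by
    have hc : ContinuousAt (fun t => -(Real.log (Real.cosh t) / t) + Real.tanh t * Real.log t) 1 :=
      ((continuous_log_cosh.continuousAt.div continuousAt_id one_ne_zero).neg).add
        ((hasDerivAt_tanh 1).continuousAt.mul (Real.continuousAt_log one_ne_zero))
    have := hc.tendsto.mono_left (nhdsWithin_le_nhds (s := Iio 1))
    simpa using this
  have h := intervalIntegral.integral_eq_sub_of_hasDerivAt_of_tendsto zero_lt_one hd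
    (intervalIntegrable_log_cosh_div_sq.add hi) h0 h1
  rw [intervalIntegral.integral_add intervalIntegrable_log_cosh_div_sq hi,
    intervalIntegral.integral_of_le (f := fun t : ℝ => Real.log t / Real.cosh t ^ 2)
      zero_le_one] at h
  linarith

/-- As on `(0, 1)`, but with `tanh t - 1` as the primitive of `1 / cosh^2 t`, so that the boundary
term also vanishes at infinity. -/
lemma integral_Ioi_one_log_cosh_sub_self_div_sq :
    ∫ t in Ioi (1 : ℝ), (Real.log (Real.cosh t) - t) / t ^ 2
      = Real.log (Real.cosh 1) - 1 - ∫ t in Ioi (1 : ℝ), Real.log t / Real.cosh t ^ 2 := by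
  have hi : IntegrableOn (fun t : ℝ => Real.log t / Real.cosh t ^ 2) (Ioi 1) :=
    integrableOn_log_div_cosh_sq.mono_set (Ioi_subset_Ioi zero_le_one)
  have hd : ∀ t ∈ Ici (1 : ℝ), HasDerivAt
      (fun t => -((Real.log (Real.cosh t) - t) / t) + (Real.tanh t - 1) * Real.log t)
      ((Real.log (Real.cosh t) - t) / t ^ 2 + Real.log t / Real.cosh t ^ 2) t := fun t ht => by
    have ht0 : t ≠ 0 := (one_pos.trans_le ht).ne'
    refine (((((hasDerivAt_log_cosh t).sub (hasDerivAt_id t)).div (hasDerivAt_id t) ht0).neg).add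
      (((hasDerivAt_tanh t).sub_const 1).mul (Real.hasDerivAt_log ht0))).congr_deriv ?_
    rw [one_sub_tanh_sq]
    have := (Real.cosh_pos t).ne'
    simp only [id, Pi.sub_apply]
    field_simp
    ring
  have hlim : Tendsto
      (fun t => -((Real.log (Real.cosh t) - t) / t) + (Real.tanh t - 1) * Real.log t)
      atTop (𝓝 0) := by
    have hb : Tendsto (fun t : ℝ => t⁻¹ + 2 * (t ^ 1 * Real.exp (-t))) atTop (𝓝 (0 + 2 * 0)) :=
      tendsto_inv_atTop_zero.add
        ((Real.tendsto_pow_mul_exp_neg_atTop_nhds_zero 1).const_mul 2)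
    rw [mul_zero, add_zero] at hb
    refine squeeze_zero_norm' ?_ hb
    filter_upwards [eventually_ge_atTop 1] with t ht
    have ht0 : (0 : ℝ) < t := by linarith
    refine (norm_add_le _ _).trans (add_le_add ?_ ?_)
    · rw [norm_neg, Real.norm_eq_abs, abs_div, abs_of_pos ht0, ← one_div]
      gcongr
      exact abs_log_cosh_sub_self_le ht0.le
    · rw [Real.norm_eq_abs, abs_mul, abs_sub_comm, abs_of_nonneg (one_sub_tanh_nonneg t),
        abs_of_nonneg (Real.log_nonneg ht), pow_one]
      calc (1 - Real.tanh t) * Real.log t ≤ 2 * Real.exp (-t) * t := by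
            refine mul_le_mul ((one_sub_tanh_le t).trans ?_)
              ((Real.log_le_sub_one_of_pos ht0).trans (by linarith)) (Real.log_nonneg ht)
              (by positivity)
            gcongr
            linarith
        _ = _ := by ring
  have h := integral_Ioi_of_hasDerivAt_of_tendsto' hd
    (integrableOn_log_cosh_sub_self_div_sq.add hi) hlim
  have h2 := integral_add integrableOn_log_cosh_sub_self_div_sq hi
  rw [h2, Real.log_one, div_one] at h
  linarith

/-- The boundary terms `-log cosh 1` and `log cosh 1 - 1` cancel against the summand `1` of `A₀`. -/
lemma constA_eq_sechMean : constA = sechMean := by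
  have h := setIntegral_union (f := fun t : ℝ => Real.log t / Real.cosh t ^ 2) (μ := volume)
    (Ioc_disjoint_Ioi_same (a := (0 : ℝ)) (b := 1)) measurableSet_Ioi
    (integrableOn_log_div_cosh_sq.mono_set Ioc_subset_Ioi_self)
    (integrableOn_log_div_cosh_sq.mono_set (Ioi_subset_Ioi zero_le_one))
  rw [Ioc_union_Ioi_eq_Ioi zero_le_one, integral_log_div_cosh_sq] at h
  rw [constA, integral_zero_one_log_cosh_div_sq, integral_Ioi_one_log_cosh_sub_self_div_sq]
  linarith

end ConstantA

/-! ### The prime zeta function near `1`. -/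

section PrimeZeta

open Set Topology

lemma abs_log_one_sub_add_self_le {x : ℝ} (hx : |x| ≤ 1 / 2) :
    |Real.log (1 - x) + x| ≤ 2 * x ^ 2 := by
  have h := Real.abs_log_sub_add_sum_range_le (lt_of_le_of_lt hx (by norm_num)) 1
  simp only [Finset.sum_range_one, Nat.cast_zero, zero_add, pow_one, div_one] at h
  rw [add_comm]
  refine h.trans ?_
  rw [div_le_iff₀ (by linarith)]
  have : |x| ^ (1 + 1) = x ^ 2 := by rw [one_add_one_eq_two, sq_abs]
  rw [this]
  nlinarith [sq_nonneg x]

/-- The contribution of the higher prime powers to `log ζ`. -/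
noncomputable def primePowerWeight (x : ℝ) : ℝ := -Real.log (1 - x) - x

lemma abs_primePowerWeight_le {x : ℝ} (hx : |x| ≤ 1 / 2) : |primePowerWeight x| ≤ 2 * x ^ 2 := by
  rw [primePowerWeight, ← abs_neg]
  refine le_trans (le_of_eq ?_) (abs_log_one_sub_add_self_le hx)
  congr 1; ring

lemma inv_prime_le_half (p : Nat.Primes) : 1 / (p : ℝ) ≤ 1 / 2 :=
  one_div_le_one_div_of_le two_pos (two_le_prime_cast p)

lemma summable_primePowerWeight : Summable fun p : Nat.Primes => primePowerWeight (1 / p) := by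
  refine Summable.of_norm_bounded (summable_primes_inv_sq.mul_left 2) fun p => ?_
  have hp := prime_cast_pos p
  refine (abs_primePowerWeight_le ?_).trans (le_of_eq (by rw [one_div_pow]))
  rw [abs_of_pos (by positivity)]
  exact inv_prime_le_half p

/-- The sum over the primes of `-log (1 - 1 / p) - 1 / p`. -/
noncomputable def primePowerConst : ℝ := ∑' p : Nat.Primes, primePowerWeight (1 / p)

lemma rpow_neg_prime_le {σ : ℝ} (hσ : 1 ≤ σ) (p : Nat.Primes) : (p : ℝ) ^ (-σ) ≤ 1 / p := by
  have hp := two_le_prime_cast p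
  rw [one_div, ← Real.rpow_neg_one]
  exact Real.rpow_le_rpow_of_exponent_le (by linarith) (by linarith)

lemma log_riemannZeta_eq_tsum {σ : ℝ} (hσ : 1 < σ) :
    Real.log (riemannZeta σ).re = ∑' p : Nat.Primes, -Real.log (1 - (p : ℝ) ^ (-σ)) := by
  have h := riemannZeta_eulerProduct_exp_log (s := σ) (by simpa using hσ)
  have e : ∀ p : Nat.Primes, -Complex.log (1 - (p : ℂ) ^ (-(σ : ℂ)))
      = ((-Real.log (1 - (p : ℝ) ^ (-σ)) : ℝ) : ℂ) := fun p => by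
    have hp := prime_cast_pos p
    have h1 := (rpow_neg_prime_le hσ.le p).trans (inv_prime_le_half p)
    rw [Complex.ofReal_neg, Complex.ofReal_log (by linarith), Complex.ofReal_sub,
      Complex.ofReal_cpow hp.le]
    simp
  simp_rw [e] at h
  rw [← Complex.ofReal_tsum, ← Complex.ofReal_exp] at h
  rw [← h, Complex.ofReal_re, Real.log_exp]

/-- The prime zeta function near its singularity at `1`. -/
lemma tendsto_tsum_primes_rpow_sub_log :
    Tendsto (fun s : ℝ => (∑' p : Nat.Primes, (p : ℝ) ^ (-(1 + 1 / s))) - Real.log s) atTop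
      (𝓝 (-primePowerConst)) := by
  have hlim : Tendsto (fun s : ℝ => 1 + 1 / s) atTop (𝓝[>] 1) := by
    refine tendsto_nhdsWithin_iff.2 ⟨?_, ?_⟩
    · simpa using (tendsto_inv_atTop_zero (𝕜 := ℝ)).const_add 1
    · filter_upwards [eventually_gt_atTop 0] with s hs
      have : 0 < 1 / s := by positivity
      simp only [mem_Ioi]; linarith
  have h1 : Tendsto (fun s : ℝ => ∑' p : Nat.Primes, primePowerWeight ((p : ℝ) ^ (-(1 + 1 / s))))
      atTop (𝓝 primePowerConst) := by
    refine tendsto_tsum_of_dominated_convergence (summable_primes_inv_sq.mul_left 2) ?_ ?_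
    · intro p
      have hp := prime_cast_pos p
      have h2 := inv_prime_le_half p
      have h3 : Tendsto (fun s : ℝ => (p : ℝ) ^ (-(1 + 1 / s))) atTop (𝓝 (1 / p)) := by
        have : Tendsto (fun s : ℝ => (p : ℝ) ^ (-(1 + 1 / s))) atTop (𝓝 ((p : ℝ) ^ (-1 : ℝ))) :=
          ((Real.continuousAt_const_rpow hp.ne').tendsto).comp
            (hlim.mono_right nhdsWithin_le_nhds).neg
        rwa [Real.rpow_neg_one, ← one_div] at this
      have h4 : ContinuousAt primePowerWeight (1 / p) := by
        unfold primePowerWeight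
        have : (1 : ℝ) - 1 / p ≠ 0 := by linarith
        fun_prop (disch := assumption)
      exact h4.tendsto.comp h3
    · filter_upwards [eventually_gt_atTop 0] with s hs p
      have hp := prime_cast_pos p
      have h0 : 0 < 1 / s := by positivity
      have h2 := rpow_neg_prime_le (σ := 1 + 1 / s) (by linarith) p
      have h3 : 0 < (p : ℝ) ^ (-(1 + 1 / s)) := by positivity
      refine (abs_primePowerWeight_le ?_).trans ?_
      · rw [abs_of_pos h3]
        exact h2.trans (inv_prime_le_half p)
      · rw [← one_div_pow]
        gcongr
  -- The simple pole of `ζ` at `1` with residue one; removing the higher prime powers then leaves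
  -- the prime zeta function.
  have h2 : Tendsto (fun s : ℝ => Real.log (riemannZeta ((1 + 1 / s : ℝ) : ℂ)).re - Real.log s) atTop
      (𝓝 0) := by
    have := ((isLittleO_one_iff ℝ).1 log_riemannZeta_add_log_sub_isLittleO_ofReal).comp hlim
    refine this.congr fun s => ?_
    simp only [Function.comp, add_sub_cancel_left, one_div, Real.log_inv]
    ring
  have h3 := h2.sub h1
  rw [zero_sub] at h3
  refine h3.congr' ?_
  filter_upwards [eventually_gt_atTop 0] with s hs
  have h0 : 0 < 1 / s := by positivity
  have hs1 : 1 < 1 + 1 / s := by linarith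
  have hsum := summable_primes_rpow_neg hs1
  have hsum2 : Summable fun p : Nat.Primes => primePowerWeight ((p : ℝ) ^ (-(1 + 1 / s))) := by
    refine Summable.of_norm_bounded (summable_primes_inv_sq.mul_left 2) fun p => ?_
    have hp := prime_cast_pos p
    have h2 := rpow_neg_prime_le hs1.le p
    have h3 : 0 < (p : ℝ) ^ (-(1 + 1 / s)) := by positivity
    refine (abs_primePowerWeight_le ?_).trans ?_
    · rw [abs_of_pos h3]
      exact h2.trans (inv_prime_le_half p)
    · rw [← one_div_pow]
      gcongr
  have e : ∑' p : Nat.Primes, -Real.log (1 - (p : ℝ) ^ (-(1 + 1 / s)))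
      = ∑' p : Nat.Primes, (primePowerWeight ((p : ℝ) ^ (-(1 + 1 / s))) +
        (p : ℝ) ^ (-(1 + 1 / s))) :=
    tsum_congr fun p => by rw [primePowerWeight]; ring
  rw [log_riemannZeta_eq_tsum hs1, e, hsum2.tsum_add hsum]
  ring

end PrimeZeta

/-! ### Exponential averages of the sum of `tanh (u / p) / p`. -/

section AbelianLimit

open Set Topology

/-- Differentiating the Gamma integral under the integral sign at `1` identifies the value as
`Γ'(1)`. -/
lemma integral_log_mul_exp_neg :
    ∫ y in Ioi (0 : ℝ), Real.log y * Real.exp (-y) = -Real.eulerMascheroniConstant := by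
  have h1 := Complex.hasDerivAt_GammaIntegral (s := 1) (by simp)
  have h2 : HasDerivAt Complex.GammaIntegral (-Real.eulerMascheroniConstant : ℂ) 1 := by
    refine Complex.hasDerivAt_Gamma_one.congr_of_eventuallyEq ?_
    filter_upwards [(isOpen_lt continuous_const Complex.continuous_re).mem_nhds
      (by simp : (0 : ℝ) < (1 : ℂ).re)] with s hs
    exact (Complex.Gamma_eq_integral hs).symm
  have h3 := h1.unique h2
  simp only [sub_self, Complex.cpow_zero, one_mul] at h3
  norm_cast at h3

lemma integrableOn_abs_log_mul_exp_neg :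
    IntegrableOn (fun y : ℝ => |Real.log y| * Real.exp (-y)) (Ioi 0) := by
  have h1 := Real.GammaIntegral_convergent (s := 1 / 2) (by norm_num)
  have h2 := Real.GammaIntegral_convergent (s := 2) (by norm_num)
  refine Integrable.mono' ((h1.const_mul 2).add h2) ?_ ?_
  · exact ((Real.measurable_log.abs).mul (Real.measurable_exp.comp measurable_neg)).aestronglyMeasurable
  · refine (ae_restrict_iff' measurableSet_Ioi).2 (ae_of_all _ fun y hy => ?_)
    have hy0 : (0 : ℝ) < y := hy
    have he := Real.exp_pos (-y)
    rw [Real.norm_of_nonneg (by positivity)]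
    -- Below `1` the logarithm is at most `2 y^(-1/2)`, above `1` at most `y`; these are the
    -- integrands of `Γ(1/2)` and `Γ(2)`.
    have key : |Real.log y| ≤ 2 * y ^ ((1 : ℝ) / 2 - 1) + y ^ ((2 : ℝ) - 1) := by
      have p1 : 0 < y ^ ((1 : ℝ) / 2 - 1) := by positivity
      have p2 : y ^ ((2 : ℝ) - 1) = y := by norm_num
      rw [p2]
      rcases le_total y 1 with h | h
      · have hl := Real.abs_log_mul_self_rpow_lt y (1 / 2) hy0 h (by norm_num)
        rw [abs_mul, abs_of_pos (by positivity : 0 < y ^ ((1 : ℝ) / 2))] at hl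
        have e : y ^ ((1 : ℝ) / 2 - 1) * y ^ ((1 : ℝ) / 2) = 1 := by
          rw [← Real.rpow_add hy0]; norm_num
        have : |Real.log y| = |Real.log y| * y ^ ((1 : ℝ) / 2) * y ^ ((1 : ℝ) / 2 - 1) := by
          rw [mul_assoc, mul_comm (y ^ ((1 : ℝ) / 2)), e, mul_one]
        rw [this]
        nlinarith
      · rw [abs_of_nonneg (Real.log_nonneg h)]
        linarith [Real.log_le_sub_one_of_pos hy0]
    have := mul_le_mul_of_nonneg_right key he.le
    simp only [Pi.add_apply]
    linarith

lemma integrable_exp_neg_mul_abs {a : ℝ} (ha : 0 < a) :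
    Integrable fun y : ℝ => Real.exp (-a * |y|) := by
  have h1 : IntegrableOn (fun y : ℝ => Real.exp (-a * |y|)) (Iic 0) := by
    refine (integrableOn_exp_mul_Iic ha 0).congr_fun (fun y hy => ?_) measurableSet_Iic
    simp only [abs_of_nonpos (show y ≤ 0 from hy)]
    ring_nf
  have h2 : IntegrableOn (fun y : ℝ => Real.exp (-a * |y|)) (Ioi 0) := by
    refine (integrableOn_exp_mul_Ioi (neg_neg_of_pos ha) 0).congr_fun (fun y hy => ?_)
      measurableSet_Ioi
    simp only [abs_of_pos (show 0 < y from hy)]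
  have := h1.union h2
  rwa [Iic_union_Ioi, integrableOn_univ] at this

lemma integral_exp_neg_mul_abs {a : ℝ} (ha : 0 < a) :
    ∫ y : ℝ, Real.exp (-a * |y|) = 2 / a := by
  rw [integral_comp_abs (f := fun y => Real.exp (-a * y)), integral_exp_mul_Ioi (neg_neg_of_pos ha)]
  simp
  field_simp

/-- The deviation of `tanh (e ^ (s y))` from a step function, weighted by `e ^ (-y)`. -/
noncomputable def tanhStepError (s y : ℝ) : ℝ :=
  Real.tanh (Real.exp (s * y)) * Real.exp (-y) - (Ioi 0).indicator (fun y => Real.exp (-y)) y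

lemma continuous_tanh_exp_mul (s : ℝ) :
    Continuous fun y : ℝ => Real.tanh (Real.exp (s * y)) * Real.exp (-y) := by
  have := (contDiff_tanh (n := 0)).continuous
  fun_prop

lemma measurable_indicator_exp_neg :
    Measurable ((Ioi (0 : ℝ)).indicator fun y => Real.exp (-y)) :=
  (Real.measurable_exp.comp measurable_neg).indicator measurableSet_Ioi

/-- For large `s`, `tanh (exp (s y))` is nearly the indicator of `y > 0`, with an error concentrated
on the scale `1/s`. For `y ≤ 0` the hypothesis `s ≥ 2` turns `exp (s y - y)` into at most `exp (s y
/ 2)`. -/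
lemma abs_tanhStepError_le {s : ℝ} (hs : 2 ≤ s) (y : ℝ) :
    |tanhStepError s y| ≤ 2 * Real.exp (-(s / 2) * |y|) := by
  have he := Real.exp_pos (-y)
  by_cases hy : 0 < y
  · rw [tanhStepError, indicator_of_mem (mem_Ioi.2 hy), abs_of_pos hy]
    have e : Real.tanh (Real.exp (s * y)) * Real.exp (-y) - Real.exp (-y)
      = -((1 - Real.tanh (Real.exp (s * y))) * Real.exp (-y)) := by ring
    rw [e, abs_neg, abs_of_nonneg (mul_nonneg (one_sub_tanh_nonneg _) he.le)]
    have h1 := one_sub_tanh_le (Real.exp (s * y))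
    have h2 : Real.exp (-(2 * Real.exp (s * y))) ≤ Real.exp (-(s / 2) * y) := by
      refine Real.exp_le_exp.2 ?_
      have := Real.add_one_le_exp (s * y)
      nlinarith [mul_pos (by linarith : 0 < s) hy]
    have h3 : Real.exp (-y) ≤ 1 := Real.exp_le_one_iff.2 (by linarith)
    calc _ ≤ (1 - Real.tanh (Real.exp (s * y))) * 1 := by
          have := one_sub_tanh_nonneg (Real.exp (s * y))
          gcongr
      _ ≤ _ := by linarith
  · have hy0 : y ≤ 0 := not_lt.1 hy
    have ht := (Real.exp_pos (s * y)).le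
    rw [tanhStepError, indicator_of_notMem (by simpa using hy0), sub_zero, abs_of_nonpos hy0,
      abs_of_nonneg (mul_nonneg (tanh_nonneg ht) he.le)]
    calc _ ≤ Real.exp (s * y) * Real.exp (-y) := by gcongr; exact tanh_le_self ht
      _ ≤ Real.exp (-(s / 2) * -y) := by
        rw [← Real.exp_add]
        refine Real.exp_le_exp.2 ?_
        nlinarith
      _ ≤ _ := by linarith [Real.exp_pos (-(s / 2) * -y)]

lemma integrable_tanhStepError {s : ℝ} (hs : 2 ≤ s) : Integrable (tanhStepError s) := by
  refine Integrable.mono' ((integrable_exp_neg_mul_abs (a := s / 2) (by linarith)).const_mul 2) ?_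
    (ae_of_all _ (abs_tanhStepError_le hs))
  exact ((continuous_tanh_exp_mul s).measurable.sub measurable_indicator_exp_neg).aestronglyMeasurable

lemma integrable_indicator_exp_neg :
    Integrable ((Ioi (0 : ℝ)).indicator fun y => Real.exp (-y)) :=
  (integrable_indicator_iff measurableSet_Ioi).2 (integrableOn_exp_neg_Ioi 0)

lemma integrable_tanh_exp_mul {s : ℝ} (hs : 2 ≤ s) :
    Integrable fun y : ℝ => Real.tanh (Real.exp (s * y)) * Real.exp (-y) := by
  refine ((integrable_tanhStepError hs).add integrable_indicator_exp_neg).congr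
    (ae_of_all _ fun y => ?_)
  simp [tanhStepError]

/-- The integral of `tanh (e ^ (s y)) e ^ (-y)`. -/
noncomputable def tanhLaplace (s : ℝ) : ℝ := ∫ y : ℝ, Real.tanh (Real.exp (s * y)) * Real.exp (-y)

lemma abs_tanhLaplace_sub_one_le {s : ℝ} (hs : 2 ≤ s) : |tanhLaplace s - 1| ≤ 8 / s := by
  have e : tanhLaplace s - 1 = ∫ y, tanhStepError s y := by
    simp only [tanhStepError]
    rw [integral_sub (integrable_tanh_exp_mul hs) integrable_indicator_exp_neg,
      integral_indicator measurableSet_Ioi, integral_exp_neg_Ioi_zero, tanhLaplace]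
  rw [e, ← Real.norm_eq_abs]
  refine (norm_integral_le_of_norm_le
    ((integrable_exp_neg_mul_abs (a := s / 2) (by linarith)).const_mul 2)
    (ae_of_all _ (abs_tanhStepError_le hs))).trans (le_of_eq ?_)
  rw [integral_const_mul, integral_exp_neg_mul_abs (by linarith)]
  field_simp
  norm_num

lemma tanh_exp_mul_div_prime {s : ℝ} (hs : 0 < s) (p : Nat.Primes) (y : ℝ) :
    1 / (p : ℝ) * Real.tanh (Real.exp (s * y) / p) * Real.exp (-y)
      = (p : ℝ) ^ (-(1 + 1 / s)) * (Real.tanh (Real.exp (s * (y - Real.log p / s))) *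
        Real.exp (-(y - Real.log p / s))) := by
  have hp := prime_cast_pos p
  have e1 : Real.exp (s * (y - Real.log p / s)) = Real.exp (s * y) / p := by
    rw [mul_sub, mul_div_cancel₀ _ hs.ne', Real.exp_sub, Real.exp_log hp]
  have e2 : Real.exp (-(y - Real.log p / s)) = Real.exp (-y) * (p : ℝ) ^ (1 / s) := by
    rw [Real.rpow_def_of_pos hp, ← Real.exp_add]
    ring_nf
  have e3 : (p : ℝ) ^ (-(1 + 1 / s)) * (p : ℝ) ^ (1 / s) = 1 / p := by
    rw [← Real.rpow_add hp, one_div (p : ℝ), ← Real.rpow_neg_one]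
    congr 1; ring
  rw [e1, e2, ← e3]
  ring

/-- Translating `y` by `log p / s` makes the integral for each prime `p^(-(1 + 1/s))` times one and
the same integral, so the prime zeta function factors out. -/
lemma integral_tanhSum_exp_mul {s : ℝ} (hs : 2 ≤ s) :
    ∫ y : ℝ, tanhSum (Real.exp (s * y)) * Real.exp (-y)
      = (∑' p : Nat.Primes, (p : ℝ) ^ (-(1 + 1 / s))) * tanhLaplace s := by
  have hs0 : 0 < s := by linarith
  have hsum := summable_primes_rpow_neg (a := 1 + 1 / s) (by
    have : 0 < 1 / s := by positivity
    linarith)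
  have hint : ∀ p : Nat.Primes, ∫ y : ℝ, 1 / (p : ℝ) * Real.tanh (Real.exp (s * y) / p) *
      Real.exp (-y) = (p : ℝ) ^ (-(1 + 1 / s)) * tanhLaplace s := fun p => by
    simp_rw [tanh_exp_mul_div_prime hs0 p]
    rw [integral_const_mul, integral_sub_right_eq_self
      (fun y => Real.tanh (Real.exp (s * y)) * Real.exp (-y)), tanhLaplace]
  have hI : ∀ p : Nat.Primes, Integrable fun y : ℝ =>
      1 / (p : ℝ) * Real.tanh (Real.exp (s * y) / p) * Real.exp (-y) := fun p => by
    simp_rw [tanh_exp_mul_div_prime hs0 p]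
    exact ((integrable_tanh_exp_mul hs).comp_sub_right _).const_mul _
  have h := hasSum_integral_of_summable_integral_norm hI ?_
  · simp_rw [hint] at h
    rw [← tsum_mul_right, h.tsum_eq]
    refine integral_congr_ae (ae_of_all _ fun y => ?_)
    simp only [tanhSum]
    rw [tsum_mul_right]
  · refine (hsum.mul_right (tanhLaplace s)).congr fun p => ?_
    rw [← hint p]
    refine integral_congr_ae (ae_of_all _ fun y => ?_)
    have hp := prime_cast_pos p
    have := Real.exp_pos (s * y)
    have := tanh_nonneg (by positivity : 0 ≤ Real.exp (s * y) / p)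
    exact (Real.norm_of_nonneg (by positivity)).symm

end AbelianLimit

/-! ### The constant `M`, and the expansion of the `log cosh` sum. -/

section AbelianConstant

open Set Topology

lemma tanhSum_nonneg {u : ℝ} (hu : 0 ≤ u) : 0 ≤ tanhSum u := tsum_nonneg fun p => by
  have hp := prime_cast_pos p
  have := tanh_nonneg (by positivity : 0 ≤ u / p)
  positivity

lemma tanhSum_le {u : ℝ} (hu : 0 ≤ u) :
    tanhSum u ≤ u * ∑' p : Nat.Primes, 1 / (p : ℝ) ^ 2 := by
  rw [tanhSum, ← tsum_mul_left]
  refine (summable_tanhSum u).tsum_le_tsum (fun p => ?_) (summable_primes_inv_sq.mul_left u)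
  have hp := prime_cast_pos p
  calc 1 / (p : ℝ) * Real.tanh (u / p) ≤ 1 / (p : ℝ) * (u / p) := by
        gcongr; exact tanh_le_self (by positivity)
    _ = _ := by field_simp

lemma tendsto_tanhSum_exp_sub {M : ℝ} (hM : (fun u : ℝ => tanhSum u -
    (Real.log (Real.log u) + M + sechMean * (1 / Real.log u))) =O[atTop]
      fun u : ℝ => 1 / Real.log u ^ 2) :
    Tendsto (fun x => tanhSum (Real.exp x) - Real.log x) atTop (𝓝 M) := by
  have h0 : Tendsto (fun x : ℝ => 1 / x ^ 2) atTop (𝓝 0) := by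
    simpa using tendsto_pow_neg_atTop (𝕜 := ℝ) (n := 2) two_ne_zero
  have h1 : Tendsto (fun x : ℝ => 1 / x) atTop (𝓝 0) := by
    simpa using tendsto_inv_atTop_zero (𝕜 := ℝ)
  have h2 := hM.comp_tendsto Real.tendsto_exp_atTop
  simp only [Function.comp_def, Real.log_exp] at h2
  have h3 := (h2.trans_tendsto h0).add ((h1.const_mul sechMean).add_const M)
  rw [mul_zero, zero_add, zero_add] at h3
  refine h3.congr fun x => by ring

/-- A bound uniform down to `x = 0`, needed for domination; `log (1 + x)` replaces `log x` to avoid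
its singularity. The limit handles large `x`, and crude bounds on both terms handle the rest. -/
lemma exists_abs_tanhSum_exp_sub_le {M : ℝ}
    (hM : Tendsto (fun x => tanhSum (Real.exp x) - Real.log x) atTop (𝓝 M)) :
    ∃ K, ∀ x, 0 ≤ x → |tanhSum (Real.exp x) - Real.log (1 + x)| ≤ K := by
  obtain ⟨X, hX⟩ := eventually_atTop.1 ((hM.eventually (Metric.ball_mem_nhds M one_pos)).and
    (eventually_ge_atTop 1))
  set S := ∑' p : Nat.Primes, 1 / (p : ℝ) ^ 2
  have hS : 0 ≤ S := tsum_nonneg fun p => by positivity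
  refine ⟨max (|M| + 2) (Real.exp X * S + X), fun x hx => ?_⟩
  rcases le_total X x with h | h
  · refine le_trans ?_ (le_max_left _ _)
    obtain ⟨h1, h2⟩ := hX x h
    rw [Real.dist_eq] at h1
    have hx0 : 0 < x := by linarith
    have h3 : Real.log x ≤ Real.log (1 + x) := Real.log_le_log hx0 (by linarith)
    have h4 : Real.log (1 + x) ≤ Real.log x + 1 := by
      have : Real.log ((1 + x) / x) ≤ (1 + x) / x - 1 := Real.log_le_sub_one_of_pos (by positivity)
      rw [Real.log_div (by positivity) hx0.ne'] at this
      have e : (1 + x) / x - 1 = 1 / x := by field_simp; ring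
      have : 1 / x ≤ 1 := by rw [div_le_one hx0]; exact h2
      linarith
    have h5 := abs_le.1 h1.le
    have h6 := abs_le.1 (le_refl |M|)
    rw [abs_le]
    constructor <;> linarith
  · refine le_trans ?_ (le_max_right _ _)
    have h1 := tanhSum_nonneg (Real.exp_pos x).le
    have h2 := tanhSum_le (Real.exp_pos x).le
    have h3 : Real.exp x * S ≤ Real.exp X * S :=
      mul_le_mul_of_nonneg_right (Real.exp_le_exp.2 h) hS
    have h4 : 0 ≤ Real.log (1 + x) := Real.log_nonneg (by linarith)
    have h5 : Real.log (1 + x) ≤ x := by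
      have := Real.log_le_sub_one_of_pos (by linarith : 0 < 1 + x); linarith
    have h6 : 0 ≤ Real.exp X * S := mul_nonneg (Real.exp_pos _).le hS
    rw [abs_le]
    constructor <;> linarith

/-- `tanhSum (e ^ (s y)) e ^ (-y)` with the expected main term `log s` removed for `y > 0`. -/
noncomputable def tanhSumRemainder (s y : ℝ) : ℝ :=
  tanhSum (Real.exp (s * y)) * Real.exp (-y) -
    Real.log s * (Ioi 0).indicator (fun y => Real.exp (-y)) y

lemma tanhSumRemainder_of_pos (s : ℝ) {y : ℝ} (hy : 0 < y) :
    tanhSumRemainder s y = (tanhSum (Real.exp (s * y)) - Real.log s) * Real.exp (-y) := by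
  rw [tanhSumRemainder, indicator_of_mem (mem_Ioi.2 hy)]; ring

lemma tanhSumRemainder_of_nonpos (s : ℝ) {y : ℝ} (hy : y ≤ 0) :
    tanhSumRemainder s y = tanhSum (Real.exp (s * y)) * Real.exp (-y) := by
  rw [tanhSumRemainder, indicator_of_notMem (by simpa using hy)]; ring

lemma continuous_tanhSum_exp_mul (s : ℝ) :
    Continuous fun y : ℝ => tanhSum (Real.exp (s * y)) * Real.exp (-y) := by
  refine Continuous.mul (continuous_iff_continuousAt.2 fun y => ?_) (by fun_prop)
  exact (hasDerivAt_tanhSum (Real.exp_pos _)).continuousAt.comp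
    (f := fun y => Real.exp (s * y)) (by fun_prop)

/-- For `y > 0`, `log s = log (s y) - log y`, so the limit `M` is shifted by `log y`. For `y < 0`
the argument `exp (s y)` tends to `0` and `tanhSum` with it. -/
lemma tendsto_tanhSumRemainder {M : ℝ}
    (hM : Tendsto (fun x => tanhSum (Real.exp x) - Real.log x) atTop (𝓝 M)) {y : ℝ} (hy : y ≠ 0) :
    Tendsto (fun s => tanhSumRemainder s y) atTop
      (𝓝 ((Ioi 0).indicator (fun y => (M + Real.log y) * Real.exp (-y)) y)) := by
  rcases lt_or_gt_of_ne hy with h | h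
  · rw [indicator_of_notMem (by simpa using h.le)]
    have hlim : Tendsto (fun s : ℝ => Real.exp (s * y) * (∑' p : Nat.Primes, 1 / (p : ℝ) ^ 2) *
        Real.exp (-y)) atTop (𝓝 0) := by
      have := ((Real.tendsto_exp_atBot.comp (tendsto_id.atTop_mul_const_of_neg h)).mul_const
        (∑' p : Nat.Primes, 1 / (p : ℝ) ^ 2)).mul_const (Real.exp (-y))
      simpa using this
    refine squeeze_zero (fun s => ?_) (fun s => ?_) hlim
    · rw [tanhSumRemainder_of_nonpos s h.le]
      exact mul_nonneg (tanhSum_nonneg (Real.exp_pos _).le) (Real.exp_pos _).le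
    · rw [tanhSumRemainder_of_nonpos s h.le]
      exact mul_le_mul_of_nonneg_right (tanhSum_le (Real.exp_pos _).le) (Real.exp_pos _).le
  · rw [indicator_of_mem (mem_Ioi.2 h)]
    have h1 := ((hM.comp (tendsto_id.atTop_mul_const h)).add_const (Real.log y)).mul_const
      (Real.exp (-y))
    refine h1.congr' ?_
    filter_upwards [eventually_gt_atTop 0] with s hs
    rw [tanhSumRemainder_of_pos s h]
    simp only [Function.comp, id, Real.log_mul hs.ne' h.ne']
    ring

lemma exists_abs_tanhSumRemainder_le {M : ℝ}
    (hM : Tendsto (fun x => tanhSum (Real.exp x) - Real.log x) atTop (𝓝 M)) :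
    ∃ K, ∀ s, 2 ≤ s → ∀ y, |tanhSumRemainder s y| ≤ K * Real.exp (-(1 / 2) * |y|) +
      (Ioi 0).indicator (fun y => |Real.log y| * Real.exp (-y)) y := by
  obtain ⟨K, hK⟩ := exists_abs_tanhSum_exp_sub_le hM
  have hK0 : 0 ≤ K := (abs_nonneg _).trans (hK 0 le_rfl)
  set S := ∑' p : Nat.Primes, 1 / (p : ℝ) ^ 2
  have hS : 0 ≤ S := tsum_nonneg fun p => by positivity
  refine ⟨K + 2 + S, fun s hs y => ?_⟩
  have hE := Real.exp_pos (-(1 / 2) * |y|)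
  rcases lt_or_ge 0 y with h | h
  · rw [tanhSumRemainder_of_pos s h, indicator_of_mem (mem_Ioi.2 h), abs_mul,
      abs_of_pos (Real.exp_pos _), abs_of_pos h]
    rw [abs_of_pos h] at hE
    have hs0 : 0 < s := by linarith
    have h1 := hK (s * y) (by positivity)
    -- The difference equals `log (1/s + y)`, which lies between `log y` and `y` because `1/s ≤ 1`.
    have h2 : |Real.log (1 + s * y) - Real.log s| ≤ |Real.log y| + y := by
      have e : Real.log (1 + s * y) - Real.log s = Real.log (1 / s + y) := by
        rw [← Real.log_div (by positivity) hs0.ne']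
        congr 1
        field_simp
      have hs1 : 1 / s ≤ 1 := by rw [div_le_one hs0]; linarith
      have hs2 : 0 < 1 / s := by positivity
      rw [e, abs_le]
      have l1 : Real.log y ≤ Real.log (1 / s + y) := Real.log_le_log h (by linarith)
      have l2 := Real.log_le_sub_one_of_pos (by positivity : 0 < 1 / s + y)
      have l3 := abs_le.1 (le_refl |Real.log y|)
      constructor <;> linarith [abs_nonneg (Real.log y)]
    have h3 : |tanhSum (Real.exp (s * y)) - Real.log s| ≤ K + (|Real.log y| + y) := by
      refine le_trans (le_of_eq ?_) ((abs_add_le _ _).trans (add_le_add h1 h2))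
      congr 1; ring
    have h4 : y * Real.exp (-y) ≤ 2 * Real.exp (-(1 / 2) * y) := by
      have : y / 2 + 1 ≤ Real.exp (y / 2) := Real.add_one_le_exp _
      have e : Real.exp (-(1 / 2) * y) = Real.exp (y / 2) * Real.exp (-y) := by
        rw [← Real.exp_add]; ring_nf
      rw [e]
      nlinarith [Real.exp_pos (-y)]
    have h5 : Real.exp (-y) ≤ Real.exp (-(1 / 2) * y) := Real.exp_le_exp.2 (by linarith)
    calc _ ≤ (K + (|Real.log y| + y)) * Real.exp (-y) := by gcongr
      _ = K * Real.exp (-y) + y * Real.exp (-y) + |Real.log y| * Real.exp (-y) := by ring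
      _ ≤ K * Real.exp (-(1 / 2) * y) + 2 * Real.exp (-(1 / 2) * y) +
          |Real.log y| * Real.exp (-y) := by gcongr
      _ ≤ _ := by nlinarith
  · rw [tanhSumRemainder_of_nonpos s h, indicator_of_notMem (by simpa using h), add_zero,
      abs_of_nonneg (mul_nonneg (tanhSum_nonneg (Real.exp_pos _).le) (Real.exp_pos _).le)]
    have h1 : Real.exp (s * y) * Real.exp (-y) ≤ Real.exp (-(1 / 2) * |y|) := by
      rw [← Real.exp_add, abs_of_nonpos h]
      refine Real.exp_le_exp.2 ?_
      nlinarith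
    calc _ ≤ Real.exp (s * y) * S * Real.exp (-y) :=
          mul_le_mul_of_nonneg_right (tanhSum_le (Real.exp_pos _).le) (Real.exp_pos _).le
      _ = S * (Real.exp (s * y) * Real.exp (-y)) := by ring
      _ ≤ S * Real.exp (-(1 / 2) * |y|) := by gcongr
      _ ≤ _ := by nlinarith

lemma integral_indicator_add_log_mul_exp_neg (M : ℝ) :
    ∫ y, (Ioi (0 : ℝ)).indicator (fun y => (M + Real.log y) * Real.exp (-y)) y
      = M - Real.eulerMascheroniConstant := by
  have h2 : IntegrableOn (fun y : ℝ => Real.log y * Real.exp (-y)) (Ioi 0) := by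
    refine integrableOn_abs_log_mul_exp_neg.mono'
      (Real.measurable_log.mul (Real.measurable_exp.comp measurable_neg)).aestronglyMeasurable
      (ae_of_all _ fun y => ?_)
    rw [Real.norm_eq_abs, abs_mul, abs_of_pos (Real.exp_pos _)]
  rw [integral_indicator measurableSet_Ioi]
  simp_rw [add_mul]
  rw [integral_add ((integrableOn_exp_neg_Ioi 0).const_mul M) h2, integral_const_mul,
    integral_exp_neg_Ioi_zero, integral_log_mul_exp_neg]
  ring

/-- Two evaluations of the limit of the integral of `tanhSumRemainder s`: dominated convergence
gives `M - γ`, and the prime zeta function gives `-primePowerConst`. -/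
lemma eq_eulerMascheroniConstant_sub_primePowerConst {M : ℝ}
    (hM : Tendsto (fun x => tanhSum (Real.exp x) - Real.log x) atTop (𝓝 M)) :
    M = Real.eulerMascheroniConstant - primePowerConst := by
  obtain ⟨K, hK⟩ := exists_abs_tanhSumRemainder_le hM
  have hbint : Integrable fun y : ℝ => K * Real.exp (-(1 / 2) * |y|) +
      (Ioi 0).indicator (fun y => |Real.log y| * Real.exp (-y)) y :=
    ((integrable_exp_neg_mul_abs (by norm_num)).const_mul K).add
      ((integrable_indicator_iff measurableSet_Ioi).2 integrableOn_abs_log_mul_exp_neg)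
  have hmeas : ∀ s, AEStronglyMeasurable (tanhSumRemainder s) volume := fun s =>
    ((continuous_tanhSum_exp_mul s).measurable.sub
      (measurable_indicator_exp_neg.const_mul _)).aestronglyMeasurable
  have h1 : Tendsto (fun s => ∫ y, tanhSumRemainder s y) atTop
      (𝓝 (M - Real.eulerMascheroniConstant)) := by
    rw [← integral_indicator_add_log_mul_exp_neg M]
    refine tendsto_integral_filter_of_dominated_convergence _ (Eventually.of_forall hmeas) ?_
      hbint ?_
    · filter_upwards [eventually_ge_atTop 2] with s hs using ae_of_all _ (hK s hs)
    · filter_upwards [compl_mem_ae_iff.2 (measure_singleton (μ := volume) (0 : ℝ))] with y hy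
      exact tendsto_tanhSumRemainder hM hy
  have h2 : ∀ s : ℝ, 2 ≤ s → ∫ y, tanhSumRemainder s y =
      (∑' p : Nat.Primes, (p : ℝ) ^ (-(1 + 1 / s))) * tanhLaplace s - Real.log s := fun s hs => by
    have hi : Integrable (tanhSumRemainder s) :=
      hbint.mono' (hmeas s) (ae_of_all _ (hK s hs))
    have hi2 := integrable_indicator_exp_neg.const_mul (Real.log s)
    rw [← integral_tanhSum_exp_mul hs]
    have e : ∫ y : ℝ, tanhSum (Real.exp (s * y)) * Real.exp (-y) =
        ∫ y, (tanhSumRemainder s y +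
          Real.log s * (Ioi 0).indicator (fun y => Real.exp (-y)) y) :=
      integral_congr_ae (ae_of_all _ fun y => by simp [tanhSumRemainder])
    rw [e, integral_add hi hi2, integral_const_mul, integral_indicator measurableSet_Ioi,
      integral_exp_neg_Ioi_zero]
    ring
  have h3 := tendsto_tsum_primes_rpow_sub_log
  -- The prime zeta factor is `log s + O(1)`, and the other factor is `O(1/s)`.
  have h4 : Tendsto (fun s : ℝ => (∑' p : Nat.Primes, (p : ℝ) ^ (-(1 + 1 / s))) *
      (tanhLaplace s - 1)) atTop (𝓝 0) := by
    have hlog : Tendsto (fun s : ℝ => Real.log s * (8 / s)) atTop (𝓝 0) := by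
      have := Real.isLittleO_log_id_atTop.tendsto_div_nhds_zero.const_mul 8
      rw [mul_zero] at this
      refine this.congr fun s => ?_
      simp only [id]; ring
    have h8 : Tendsto (fun s : ℝ => 8 / s) atTop (𝓝 0) := tendsto_const_nhds.div_atTop tendsto_id
    have hb := ((h3.mul h8).add hlog).abs
    rw [mul_zero, zero_add, abs_zero] at hb
    refine squeeze_zero_norm' ?_ hb
    filter_upwards [eventually_ge_atTop 2] with s hs
    rw [Real.norm_eq_abs, ← add_mul, sub_add_cancel, abs_mul, abs_mul]
    exact mul_le_mul_of_nonneg_left ((abs_tanhLaplace_sub_one_le hs).trans (le_abs_self _))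
      (abs_nonneg _)
  have h5 : Tendsto (fun s => ∫ y, tanhSumRemainder s y) atTop (𝓝 (-primePowerConst)) := by
    have := h3.add h4
    rw [add_zero] at this
    refine this.congr' ?_
    filter_upwards [eventually_ge_atTop 2] with s hs
    rw [h2 s hs]
    ring
  have := tendsto_nhds_unique h1 h5
  linarith

/-- The asymptotic expansion of the sum over the primes of `log cosh (k / p)`. -/
theorem isBigO_logCoshSum_sub :
    (fun k : ℝ => logCoshSum k - (k * Real.log (Real.log k) +
      k * (Real.eulerMascheroniConstant - primePowerConst) +
      (constA - 1) * (k / Real.log k))) =O[atTop] fun k : ℝ => k / Real.log k ^ 2 := by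
  obtain ⟨M, hM⟩ := exists_isBigO_tanhSum
  rw [constA_eq_sechMean,
    ← eq_eulerMascheroniConstant_sub_primePowerConst (tendsto_tanhSum_exp_sub hM)]
  exact isBigO_logCoshSum hM

end AbelianConstant

/-! ### The binomial series with coefficients `d_k(p^a)`. -/

section BinomialSeries

open Set Topology

/-- The value `d_k(p^a)`. -/
noncomputable def gammaCoeff (k : ℝ) (a : ℕ) : ℝ :=
  Real.Gamma (k + a) / (Real.Gamma k * (a.factorial : ℝ))

lemma gammaCoeff_pos {k : ℝ} (hk : 0 < k) (a : ℕ) : 0 < gammaCoeff k a := by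
  have h1 := Real.Gamma_pos_of_pos hk
  have h2 := Real.Gamma_pos_of_pos (by positivity : 0 < k + a)
  have h3 : (0 : ℝ) < a.factorial := by exact_mod_cast a.factorial_pos
  rw [gammaCoeff]
  positivity

lemma gammaCoeff_zero {k : ℝ} (hk : 0 < k) : gammaCoeff k 0 = 1 := by
  have h1 := (Real.Gamma_pos_of_pos hk).ne'
  simp [gammaCoeff, h1]

lemma Gamma_add_natCast_eq_ascPochhammer {k : ℝ} (hk : 0 < k) (a : ℕ) :
    Real.Gamma (k + a) = (ascPochhammer ℝ a).eval k * Real.Gamma k := by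
  induction a with
  | zero => simp
  | succ a ih =>
    rw [Nat.cast_succ, ← add_assoc, Real.Gamma_add_one (by positivity), ih, ascPochhammer_succ_eval]
    ring

lemma choose_eq_gammaCoeff {k : ℝ} (hk : 0 < k) (a : ℕ) :
    Ring.choose (k + a - 1) a = gammaCoeff k a := by
  have h1 := (Real.Gamma_pos_of_pos hk).ne'
  have h3 : (a.factorial : ℝ) ≠ 0 := by exact_mod_cast a.factorial_ne_zero
  have h := Ring.factorial_nsmul_multichoose_eq_ascPochhammer k a
  rw [Polynomial.ascPochhammer_smeval_eq_eval, nsmul_eq_mul] at h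
  rw [← Ring.multichoose_eq, gammaCoeff, Gamma_add_natCast_eq_ascPochhammer hk, ← h]
  field_simp

lemma hasSum_gammaCoeff_mul_pow {k x : ℝ} (hk : 0 < k) (hx : |x| < 1) :
    HasSum (fun a => gammaCoeff k a * x ^ a) ((1 - x) ^ (-k)) := by
  have h := (Real.one_div_one_sub_rpow_hasFPowerSeriesOnBall_zero k).hasSum (y := x)
    (by simpa [Metric.mem_eball, edist_eq_enorm_sub, ← ofReal_norm] using hx)
  have hx1 : 0 ≤ 1 - x := by linarith [(abs_lt.1 hx).2]
  simp only [zero_add, FormalMultilinearSeries.ofScalars_apply_eq, choose_eq_gammaCoeff hk,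
    smul_eq_mul] at h
  rwa [one_div, ← Real.rpow_neg hx1] at h

lemma hasSum_gammaCoeff_mul_pow_succ {k x : ℝ} (hk : 0 < k) (hx : |x| < 1) :
    HasSum (fun a => gammaCoeff k (a + 1) * x ^ (a + 1)) ((1 - x) ^ (-k) - 1) := by
  have h := (hasSum_nat_add_iff' 1).2 (hasSum_gammaCoeff_mul_pow hk hx)
  simpa [gammaCoeff_zero hk] using h

end BinomialSeries

/-! ### Multiplicativity of the terms `d_k(m) g_k(m) / m`. -/

section Multiplicativity

lemma divisorFn_prime_pow (k : ℝ) {p a : ℕ} (hp : p.Prime) (ha : a ≠ 0) :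
    divisorFn k (p ^ a) = gammaCoeff k a := by
  rw [divisorFn, hp.factorization_pow, Finsupp.prod, Finsupp.support_single _ ha]
  simp [gammaCoeff]

lemma gFn_prime_pow (k : ℝ) {p a : ℕ} (hp : p.Prime) (ha : a ≠ 0) :
    gFn k (p ^ a) = gPrimePow k p a := by
  rw [gFn, hp.factorization_pow, Finsupp.prod, Finsupp.support_single _ ha]
  simp

lemma hTerm_prime_pow (k : ℝ) {p a : ℕ} (hp : p.Prime) (ha : a ≠ 0) :
    hTerm k (p ^ a) = gammaCoeff k a * gPrimePow k p a * (1 / (p : ℝ)) ^ a := by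
  rw [hTerm, divisorFn_prime_pow k hp ha, gFn_prime_pow k hp ha]
  push_cast
  rw [one_div_pow, mul_one_div]

lemma hTerm_one (k : ℝ) : hTerm k 1 = 1 := by simp [hTerm, divisorFn, gFn]

lemma hTerm_zero (k : ℝ) : hTerm k 0 = 0 := by simp [hTerm]

lemma hTerm_mul_of_coprime (k : ℝ) {m n : ℕ} (h : m.Coprime n) :
    hTerm k (m * n) = hTerm k m * hTerm k n := by
  have hprod : ∀ f : ℕ → ℕ → ℝ, (m * n).factorization.prod f =
      m.factorization.prod f * n.factorization.prod f := fun f => by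
    rw [Nat.factorization_mul_of_coprime h,
      Finsupp.prod_add_index_of_disjoint (by
        simpa using h.disjoint_primeFactors)]
  simp only [hTerm, divisorFn, gFn, hprod, Nat.cast_mul]
  rw [mul_mul_mul_comm, mul_div_mul_comm]

end Multiplicativity

/-! ### Closed form and bounds for the series at a single prime. -/

section LocalFactors

open Set Topology

lemma sq_le_rpow_sub_one {k x : ℝ} (hk : 1 ≤ k) (hx : 2 ≤ x) : x ^ 2 ≤ x ^ (k + 2) - 1 := by
  have h1 : x ^ (3 : ℝ) ≤ x ^ (k + 2) :=
    Real.rpow_le_rpow_of_exponent_le (by linarith) (by linarith)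
  have h2 : x ^ (3 : ℝ) = x ^ 3 := by norm_cast
  rw [h2] at h1
  nlinarith [sq_nonneg x, mul_nonneg (by linarith : 0 ≤ x) (by linarith : 0 ≤ x - 2)]

/-- The small quantity in the values of `g_k` at powers of `2`. -/
noncomputable def twoTail (k : ℝ) : ℝ := 1 / ((4 : ℝ) ^ (k + 2) * ((2 : ℝ) ^ (k + 2) - 1))

/-- The small quantity in the values of `g_k` at powers of an odd prime `p`. -/
noncomputable def oddTail (k p : ℝ) : ℝ := (p - 1) / (p * (p ^ (k + 2) - 1))

/-- The factor at `p` of the constant `C(k)`. -/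
noncomputable def constFactor (k : ℝ) (p : ℕ) : ℝ := if p = 2 then twoFactor k else oddFactor k p

/-- The coefficient of `(1 - 1 / p) ^ (-k)` in the factor at `p` of `H(k)`. -/
noncomputable def minusCoeff (k : ℝ) (p : ℕ) : ℝ :=
  if p = 2 then twoTail k else (1 - 3 / (p : ℝ)) / 2 + oddTail k p

/-- The coefficient of `(1 + 1 / p) ^ (-k)` in the factor at `p` of `H(k)`. -/
noncomputable def plusCoeff (k : ℝ) (p : ℕ) : ℝ :=
  if p = 2 then 1 / 2 + twoTail k else (1 - 1 / (p : ℝ)) / 2 + oddTail k p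

/-- The factor at `p` of `H(k)`. -/
noncomputable def localFactor (k : ℝ) (p : ℕ) : ℝ :=
  constFactor k p + minusCoeff k p * ((1 - 1 / (p : ℝ)) ^ (-k) - 1) +
    plusCoeff k p * ((1 + 1 / (p : ℝ)) ^ (-k) - 1)

lemma twoTail_nonneg {k : ℝ} (hk : 1 ≤ k) : 0 ≤ twoTail k := by
  have h := sq_le_rpow_sub_one hk (le_refl (2 : ℝ))
  have : 0 < (2 : ℝ) ^ (k + 2) - 1 := by linarith
  rw [twoTail]; positivity

/-- At `p = 2` the growing power `(1 - 1/2)^(-k) = 2^k` occurs only with the coefficient `twoTail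
k`; this bound keeps the whole factor bounded. -/
lemma twoTail_mul_two_rpow_le {k : ℝ} (hk : 1 ≤ k) : twoTail k * 2 ^ k ≤ 1 := by
  have h := sq_le_rpow_sub_one hk (le_refl (2 : ℝ))
  have h1 : (1 : ℝ) ≤ (2 : ℝ) ^ (k + 2) - 1 := by linarith
  have h2 : (2 : ℝ) ^ k ≤ (4 : ℝ) ^ (k + 2) := by
    calc (2 : ℝ) ^ k ≤ 4 ^ k := Real.rpow_le_rpow (by norm_num) (by norm_num) (by linarith)
      _ ≤ _ := Real.rpow_le_rpow_of_exponent_le (by norm_num) (by linarith)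
  have h4 : (0 : ℝ) < (4 : ℝ) ^ (k + 2) := by positivity
  rw [twoTail, one_div_mul_eq_div, div_le_one (by positivity)]
  nlinarith

lemma twoTail_le_one {k : ℝ} (hk : 1 ≤ k) : twoTail k ≤ 1 := by
  have h1 : (1 : ℝ) ≤ 2 ^ k := Real.one_le_rpow (by norm_num) (by linarith)
  have h0 := twoTail_nonneg hk
  have := twoTail_mul_two_rpow_le hk
  nlinarith

lemma one_le_twoFactor {k : ℝ} (hk : 1 ≤ k) : 1 ≤ twoFactor k := by
  have h := sq_le_rpow_sub_one hk (le_refl (2 : ℝ))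
  have : 0 < (2 : ℝ) ^ (k + 2) - 1 := by linarith
  have : 0 ≤ 1 / (2 : ℝ) ^ (k + 2) + 2 / (4 : ℝ) ^ (k + 2)
    + 4 / ((4 : ℝ) ^ (k + 2) * ((2 : ℝ) ^ (k + 2) - 1)) := by positivity
  rw [twoFactor]; linarith

lemma oddTail_nonneg {k p : ℝ} (hk : 1 ≤ k) (hp : 2 ≤ p) : 0 ≤ oddTail k p := by
  have h := sq_le_rpow_sub_one hk hp
  have h1 : 0 < p ^ (k + 2) - 1 := lt_of_lt_of_le (by positivity) h
  have h2 : 0 ≤ p - 1 := by linarith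
  rw [oddTail]; positivity

lemma oddTail_le {k p : ℝ} (hk : 1 ≤ k) (hp : 2 ≤ p) : oddTail k p ≤ 1 / p ^ 2 := by
  have h := sq_le_rpow_sub_one hk hp
  have hp0 : 0 < p := by linarith
  have h1 : 0 < p ^ (k + 2) - 1 := lt_of_lt_of_le (by positivity) h
  rw [oddTail, div_mul_eq_div_div, div_le_div_iff₀ h1 (by positivity), one_mul]
  refine le_trans ?_ h
  refine mul_le_of_le_one_left (by positivity) ?_
  rw [div_le_one hp0]; linarith

lemma one_le_oddFactor {k : ℝ} (hk : 1 ≤ k) {p : ℕ} (hp : 2 ≤ p) : 1 ≤ oddFactor k p := by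
  have hp' : (2 : ℝ) ≤ p := by exact_mod_cast hp
  have h := sq_le_rpow_sub_one hk hp'
  have h1 : 0 < (p : ℝ) ^ (k + 2) - 1 := lt_of_lt_of_le (by positivity) h
  have : 0 ≤ 2 / ((p : ℝ) ^ (k + 2) - 1) := by positivity
  rw [oddFactor]; linarith

lemma oddFactor_sub_one_le {k : ℝ} (hk : 1 ≤ k) {p : ℕ} (hp : 2 ≤ p) :
    oddFactor k p - 1 ≤ 2 * (1 / (p : ℝ) ^ 2) := by
  have hp' : (2 : ℝ) ≤ p := by exact_mod_cast hp
  have h := sq_le_rpow_sub_one hk hp'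
  have h0 : 0 < (p : ℝ) ^ 2 := by positivity
  rw [oddFactor, add_sub_cancel_left, div_eq_mul_one_div]
  gcongr

lemma one_le_constFactor {k : ℝ} (hk : 1 ≤ k) {p : ℕ} (hp : 2 ≤ p) : 1 ≤ constFactor k p := by
  rw [constFactor]
  split_ifs
  · exact one_le_twoFactor hk
  · exact one_le_oddFactor hk hp

/-- A function of the parity of `a` is a combination of `1` and `(-1)^a`, whose coefficients are
half the sum and half the difference of its even and odd values. This is what turns the series at
`p` into two binomial series, at `1/p` and `-1/p`. -/
lemma gPrimePow_eq {k : ℝ} (hk : 1 ≤ k) {p : ℕ} (hp : 2 ≤ p) (a : ℕ) :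
    gPrimePow k p a = (minusCoeff k p + (-1) ^ a * plusCoeff k p) * (constFactor k p)⁻¹ := by
  by_cases h2 : p = 2
  · simp only [gPrimePow, minusCoeff, plusCoeff, constFactor, if_pos h2, twoTail]
    congr 1
    rcases Nat.even_or_odd a with ha | ha
    · rw [ha.neg_one_pow]; ring
    · rw [ha.neg_one_pow]; ring
  · have hp3 : (3 : ℝ) ≤ p := by
      have : 3 ≤ p := by omega
      exact_mod_cast this
    have h := sq_le_rpow_sub_one hk (by linarith : (2 : ℝ) ≤ p)
    have h1 : (p : ℝ) ^ (k + 2) - 1 ≠ 0 :=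
      (lt_of_lt_of_le (by positivity : (0 : ℝ) < (p : ℝ) ^ 2) h).ne'
    have h3 : (p : ℝ) - 2 ≠ 0 := by linarith
    simp only [gPrimePow, minusCoeff, plusCoeff, constFactor, if_neg h2, oddTail]
    split_ifs with ha
    · rw [ha.neg_one_pow]; congr 1; ring
    · rw [(Nat.not_odd_iff_even.1 ha).neg_one_pow]
      congr 1
      field_simp
      ring

lemma minusCoeff_nonneg {k : ℝ} (hk : 1 ≤ k) {p : ℕ} (hp : 2 ≤ p) : 0 ≤ minusCoeff k p := by
  rw [minusCoeff]
  split_ifs with h2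
  · exact twoTail_nonneg hk
  · have hp3 : (3 : ℝ) ≤ p := by
      have : 3 ≤ p := by omega
      exact_mod_cast this
    have h3 : 3 / (p : ℝ) ≤ 1 := by rw [div_le_one (by linarith)]; exact hp3
    have := oddTail_nonneg hk (by linarith : (2 : ℝ) ≤ p)
    linarith

lemma hasSum_hTerm_prime_pow {k : ℝ} (hk : 1 ≤ k) {p : ℕ} (hp : p.Prime) :
    HasSum (fun a => hTerm k (p ^ a)) (localFactor k p * (constFactor k p)⁻¹) := by
  have hk0 : 0 < k := by linarith
  have hp2 : (2 : ℝ) ≤ p := by exact_mod_cast hp.two_le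
  have hx0 : 0 < 1 / (p : ℝ) := by positivity
  have hx1 : 1 / (p : ℝ) ≤ 1 / 2 := one_div_le_one_div_of_le two_pos hp2
  have hA := hasSum_gammaCoeff_mul_pow_succ hk0 (x := 1 / p) (by rw [abs_of_pos hx0]; linarith)
  have hB := hasSum_gammaCoeff_mul_pow_succ hk0 (x := -(1 / p))
    (by rw [abs_neg, abs_of_pos hx0]; linarith)
  rw [sub_neg_eq_add] at hB
  have h := ((hA.mul_left (minusCoeff k p)).add (hB.mul_left (plusCoeff k p))).mul_right
    (constFactor k p)⁻¹
  -- The formula for `g_k` holds only for `a ≥ 1`, so the term `a = 0` is split off; it accounts for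
  -- `constFactor` in `localFactor`.
  rw [← hasSum_nat_add_iff' 1]
  have hc : constFactor k p ≠ 0 := by have := one_le_constFactor hk hp.two_le; linarith
  have e : localFactor k p * (constFactor k p)⁻¹ - ∑ i ∈ Finset.range 1, hTerm k (p ^ i) =
      (minusCoeff k p * ((1 - 1 / (p : ℝ)) ^ (-k) - 1) +
        plusCoeff k p * ((1 + 1 / (p : ℝ)) ^ (-k) - 1)) * (constFactor k p)⁻¹ := by
    simp only [Finset.sum_range_one, pow_zero, hTerm_one, localFactor]
    field_simp
    ring
  rw [e]
  refine h.congr_fun fun a => ?_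
  rw [hTerm_prime_pow k hp a.add_one_ne_zero, gPrimePow_eq hk hp.two_le, neg_pow (1 / (p : ℝ))]
  ring

lemma abs_gPrimePow_le {k : ℝ} (hk : 1 ≤ k) {p : ℕ} (hp : 2 ≤ p) (a : ℕ) :
    |gPrimePow k p a| ≤ 3 := by
  have hc := one_le_constFactor hk hp
  have hm := minusCoeff_nonneg hk hp
  have hp' : (2 : ℝ) ≤ p := by exact_mod_cast hp
  have hx0 : 0 < 1 / (p : ℝ) := by positivity
  have hq : 1 / (p : ℝ) ^ 2 ≤ 1 := by
    rw [div_le_one (by positivity)]; nlinarith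
  have hx1 : 1 / (p : ℝ) ≤ 1 := by rw [div_le_one (by linarith)]; linarith
  have hb : 0 ≤ plusCoeff k p ∧ minusCoeff k p + plusCoeff k p ≤ 3 := by
    have h1 := oddTail_nonneg hk hp'
    have h2 := oddTail_le hk hp'
    have h3 := twoTail_nonneg hk
    have h4 := twoTail_le_one hk
    have h5 : 3 / (p : ℝ) = 3 * (1 / p) := by ring
    rw [minusCoeff, plusCoeff]
    split_ifs <;> constructor <;> linarith
  rw [gPrimePow_eq hk hp, abs_mul, abs_of_pos (by positivity : 0 < (constFactor k p)⁻¹)]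
  have h1 : |minusCoeff k p + (-1) ^ a * plusCoeff k p| ≤ 3 := by
    refine (abs_add_le _ _).trans ?_
    rw [abs_mul, abs_pow, abs_neg, abs_one, one_pow, one_mul, abs_of_nonneg hm, abs_of_nonneg hb.1]
    exact hb.2
  calc |minusCoeff k p + (-1) ^ a * plusCoeff k p| * (constFactor k p)⁻¹ ≤ 3 * 1 :=
        mul_le_mul h1 (inv_le_one_of_one_le₀ hc) (by positivity) (by norm_num)
    _ = 3 := by norm_num

lemma abs_gPrimePow_le_of_odd {k : ℝ} (hk : 1 ≤ k) {p : ℕ} (hp : 2 ≤ p) (h2 : p ≠ 2) {a : ℕ}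
    (ha : Odd a) : |gPrimePow k p a| ≤ 1 / p := by
  have hc := one_le_oddFactor hk hp
  have hx0 : 0 ≤ 1 / (p : ℝ) := by positivity
  rw [gPrimePow, if_neg h2, if_pos ha, abs_mul, abs_neg, abs_of_nonneg hx0,
    abs_of_pos (by positivity)]
  exact mul_le_of_le_one_right hx0 (inv_le_one_of_one_le₀ hc)

/-- Every term must carry `p^(-2)` for convergence over primes. Even exponents `a ≥ 2` supply it
through `p^(-a)`; at odd exponents and odd `p` one factor `1/p` comes from `g_k`. The remaining
`(1/2)^a` makes the series in `a` converge. -/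
lemma abs_hTerm_prime_pow_le {k : ℝ} (hk : 1 ≤ k) {p : ℕ} (hp : p.Prime) {a : ℕ} (ha : a ≠ 0) :
    |hTerm k (p ^ a)| ≤ 12 * (1 / (p : ℝ) ^ 2) * (gammaCoeff k a * (1 / 2) ^ a) := by
  have hg := gammaCoeff_pos (by linarith : 0 < k) a
  have hp' : (2 : ℝ) ≤ p := by exact_mod_cast hp.two_le
  have hx0 : 0 < 1 / (p : ℝ) := by positivity
  have hx1 : 2 * (1 / (p : ℝ)) ≤ 1 := by
    have := one_div_le_one_div_of_le two_pos hp'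
    linarith
  have key : |gPrimePow k p a| * (2 * (1 / (p : ℝ))) ^ a ≤ 3 * (2 * (1 / (p : ℝ))) ^ 2 := by
    by_cases h2 : p = 2
    · have e : 2 * (1 / (p : ℝ)) = 1 := by rw [h2]; norm_num
      rw [e, one_pow, one_pow]
      linarith [abs_gPrimePow_le hk hp.two_le a]
    · by_cases ho : Odd a
      · calc |gPrimePow k p a| * (2 * (1 / (p : ℝ))) ^ a
            ≤ (1 / p) * (2 * (1 / (p : ℝ))) ^ 1 := by
              gcongr ?_ * ?_
              · exact abs_gPrimePow_le_of_odd hk hp.two_le h2 ho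
              · exact pow_le_pow_of_le_one (by positivity) hx1 (by omega)
          _ ≤ _ := by nlinarith
      · have hae := Nat.not_odd_iff_even.1 ho
        have ha2 : 2 ≤ a := by
          obtain ⟨b, hb⟩ := hae
          omega
        gcongr ?_ * ?_
        · exact abs_gPrimePow_le hk hp.two_le a
        · exact pow_le_pow_of_le_one (by positivity) hx1 ha2
  have e : (1 / (p : ℝ)) ^ a = (2 * (1 / (p : ℝ))) ^ a * (1 / 2) ^ a := by
    rw [← mul_pow]; congr 1; ring
  rw [hTerm_prime_pow k hp ha, abs_mul, abs_mul, abs_of_pos hg,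
    abs_of_pos (by positivity : 0 < (1 / (p : ℝ)) ^ a), e]
  have h3 : 0 ≤ gammaCoeff k a * (1 / 2 : ℝ) ^ a := by positivity
  calc _ = |gPrimePow k p a| * (2 * (1 / (p : ℝ))) ^ a * (gammaCoeff k a * (1 / 2) ^ a) := by ring
    _ ≤ 3 * (2 * (1 / (p : ℝ))) ^ 2 * (gammaCoeff k a * (1 / 2) ^ a) := by gcongr
    _ = _ := by ring

lemma summable_abs_hTerm_prime_pow {k : ℝ} (hk : 1 ≤ k) {p : ℕ} (hp : p.Prime) :
    (Summable fun a => |hTerm k (p ^ a)|) ∧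
      ∑' a, |hTerm k (p ^ a)| ≤ 1 + 12 * 2 ^ k * (1 / (p : ℝ) ^ 2) := by
  have hk0 : 0 < k := by linarith
  have h := (hasSum_gammaCoeff_mul_pow_succ hk0 (x := 1 / 2)
    (by rw [abs_of_pos] <;> norm_num)).mul_left (12 * (1 / (p : ℝ) ^ 2))
  have hle : ∀ a, |hTerm k (p ^ (a + 1))| ≤
      12 * (1 / (p : ℝ) ^ 2) * (gammaCoeff k (a + 1) * (1 / 2) ^ (a + 1)) := fun a =>
    abs_hTerm_prime_pow_le hk hp a.succ_ne_zero
  have hs : Summable fun a => |hTerm k (p ^ (a + 1))| :=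
    Summable.of_nonneg_of_le (fun a => abs_nonneg _) hle h.summable
  have hs' : Summable fun a => |hTerm k (p ^ a)| := (summable_nat_add_iff 1).1 hs
  refine ⟨hs', ?_⟩
  rw [hs'.tsum_eq_zero_add, pow_zero, hTerm_one, abs_one]
  have h1 := hs.tsum_le_tsum hle h.summable
  rw [h.tsum_eq] at h1
  have e : (1 - 1 / 2 : ℝ) ^ (-k) = 2 ^ k := by
    rw [Real.rpow_neg (by norm_num), ← Real.inv_rpow (by norm_num)]; norm_num
  rw [e] at h1
  have : 0 ≤ 1 / (p : ℝ) ^ 2 := by positivity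
  nlinarith

end LocalFactors

/-! ### Absolute convergence and the Euler product of `H(k)`. -/

section EulerProduct

open Set Topology

/-- A nonnegative multiplicative function is summable if its local factors converge. -/
lemma summable_of_multiplicative {f : ℕ → ℝ} (hf : ∀ n, 0 ≤ f n) (hf0 : f 0 = 0) (hf1 : f 1 = 1)
    (hmul : ∀ {m n : ℕ}, m.Coprime n → f (m * n) = f m * f n) {b : ℕ → ℝ} (hb : ∀ n, 0 ≤ b n)
    (hsum : ∀ {p : ℕ}, p.Prime → Summable fun a => f (p ^ a))
    (hle : ∀ {p : ℕ}, p.Prime → ∑' a, f (p ^ a) ≤ 1 + b p) (hbs : Summable b) : Summable f := by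
  refine summable_of_sum_range_le (c := Real.exp (∑' n, b n)) hf fun N => ?_
  -- All `0 < i < N` are `N`-smooth, so a partial sum is at most the finite Euler product over
  -- primes below `N`, hence at most `exp (∑ b)`.
  obtain ⟨h1, h2⟩ := EulerProduct.summable_and_hasSum_smoothNumbers_prod_primesBelow_tsum hf1 hmul
    (fun hp => (hsum hp).norm) N
  have h3 := hasSum_subtype_iff_indicator.1 h2
  have h4 : ∑ i ∈ Finset.range N, f i ≤ ∑ i ∈ Finset.range N, indicator N.smoothNumbers f i := by
    refine Finset.sum_le_sum fun i hi => ?_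
    rcases Nat.eq_zero_or_pos i with rfl | hi0
    · rw [hf0]; exact indicator_nonneg (fun n _ => hf n) 0
    · rw [indicator_of_mem]
      exact Nat.mem_smoothNumbers_of_lt hi0 (Finset.mem_range.1 hi)
  refine h4.trans ((sum_le_hasSum _ (fun i _ => indicator_nonneg (fun n _ => hf n) i) h3).trans ?_)
  calc ∏ p ∈ N.primesBelow, ∑' a, f (p ^ a) ≤ ∏ p ∈ N.primesBelow, Real.exp (b p) := by
        refine Finset.prod_le_prod (fun p _ => tsum_nonneg fun a => hf _) fun p hp => ?_
        refine (hle (Nat.prime_of_mem_primesBelow hp)).trans ?_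
        linarith [Real.add_one_le_exp (b p)]
    _ = Real.exp (∑ p ∈ N.primesBelow, b p) := (Real.exp_sum _ _).symm
    _ ≤ _ := Real.exp_le_exp.2 (hbs.sum_le_tsum _ fun n _ => hb n)

lemma summable_one_div_natCast_sq : Summable fun n : ℕ => 1 / (n : ℝ) ^ 2 :=
  Real.summable_one_div_nat_pow.2 one_lt_two

lemma summable_abs_hTerm {k : ℝ} (hk : 1 ≤ k) : Summable fun m => |hTerm k m| := by
  refine summable_of_multiplicative (b := fun n => 12 * 2 ^ k * (1 / (n : ℝ) ^ 2))
    (fun n => abs_nonneg _) (by rw [hTerm_zero, abs_zero]) (by rw [hTerm_one, abs_one])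
    (fun h => by rw [hTerm_mul_of_coprime k h, abs_mul]) (fun n => by positivity)
    (fun hp => (summable_abs_hTerm_prime_pow hk hp).1)
    (fun hp => (summable_abs_hTerm_prime_pow hk hp).2)
    (summable_one_div_natCast_sq.mul_left _)

lemma summable_hTerm {k : ℝ} (hk : 1 ≤ k) : Summable (hTerm k) := (summable_abs_hTerm hk).of_abs

lemma multipliable_oddFactor {k : ℝ} (hk : 1 ≤ k) :
    Multipliable fun p : {p : ℕ // p.Prime ∧ 2 < p} => oddFactor k p := by
  have hs : Summable fun p : {p : ℕ // p.Prime ∧ 2 < p} => oddFactor k p - 1 := by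
    refine Summable.of_nonneg_of_le (fun p => ?_) (fun p => oddFactor_sub_one_le hk p.2.1.two_le)
      ((summable_one_div_natCast_sq.mul_left 2).comp_injective Subtype.val_injective)
    linarith [one_le_oddFactor hk p.2.1.two_le]
  refine (Real.multipliable_one_add_of_summable hs).congr fun p => ?_
  ring

lemma hasProd_constFactor {k : ℝ} (hk : 1 ≤ k) :
    HasProd (fun p : Nat.Primes => constFactor k p) (constC k) := by
  have h1 := (multipliable_oddFactor hk).hasProd
  have h2 : HasProd ({p : ℕ | p.Prime ∧ 2 < p}.mulIndicator (oddFactor k)) _ :=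
    hasProd_subtype_iff_mulIndicator.1 h1
  have h3 := (hasProd_ite_eq (2 : ℕ) (twoFactor k)).mul h2
  refine (hasProd_subtype_iff_mulIndicator (s := {p : ℕ | p.Prime}) (f := constFactor k)).2 ?_
  refine h3.congr_fun fun p => ?_
  by_cases hp : p.Prime
  · rw [mulIndicator_of_mem (s := {p : ℕ | p.Prime}) hp, constFactor]
    split_ifs with h2
    · rw [mulIndicator_of_notMem (fun h => h.2.ne' h2), mul_one]
    · rw [mulIndicator_of_mem (s := {p : ℕ | p.Prime ∧ 2 < p})
        ⟨hp, lt_of_le_of_ne hp.two_le (Ne.symm h2)⟩, one_mul]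
  · have h2 : p ≠ 2 := fun h => hp (h ▸ Nat.prime_two)
    rw [mulIndicator_of_notMem (s := {p : ℕ | p.Prime}) hp, if_neg h2,
      mulIndicator_of_notMem (fun h => hp h.1), one_mul]

/-- The Euler product of `H(k)`. -/
theorem hasProd_localFactor {k : ℝ} (hk : 1 ≤ k) :
    HasProd (fun p : Nat.Primes => localFactor k p) (constH k) := by
  have h := (hasProd_constFactor hk).mul (EulerProduct.eulerProduct_hasProd (hTerm_one k)
    (hTerm_mul_of_coprime k) (summable_abs_hTerm hk) (hTerm_zero k))
  refine h.congr_fun fun p => ?_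
  have hc : constFactor k p ≠ 0 := by have := one_le_constFactor hk p.2.two_le; linarith
  rw [(hasSum_hTerm_prime_pow hk p.2).tsum_eq]
  field_simp

end EulerProduct

/-! ### Logarithms of the local factors, uniformly in the prime. -/

section LocalEstimates

open Set Topology

lemma abs_exp_sub_exp_le (u v : ℝ) :
    |Real.exp u - Real.exp v| ≤ |u - v| * max (Real.exp u) (Real.exp v) := by
  wlog h : v ≤ u generalizing u v
  · rw [abs_sub_comm, abs_sub_comm u v, max_comm]
    exact this v u (le_of_not_ge h)
  rw [max_eq_left (Real.exp_le_exp.2 h), abs_of_nonneg (sub_nonneg.2 (Real.exp_le_exp.2 h)),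
    abs_of_nonneg (sub_nonneg.2 h)]
  have h1 := Real.add_one_le_exp (v - u)
  have h2 : Real.exp v = Real.exp u * Real.exp (v - u) := by rw [← Real.exp_add]; ring_nf
  rw [h2]
  nlinarith [Real.exp_pos u]

lemma abs_log_le_div {r c : ℝ} (hc : 0 < c) (hr : c ≤ r) (hc1 : c ≤ 1) :
    |Real.log r| ≤ |r - 1| / c := by
  have hr0 : 0 < r := hc.trans_le hr
  have h1 := Real.log_le_sub_one_of_pos hr0
  have h2 := Real.one_sub_inv_le_log_of_pos hr0
  have h3 : |r - 1| ≤ |r - 1| / c := by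
    rw [le_div_iff₀ hc]; exact mul_le_of_le_one_right (abs_nonneg _) hc1
  have h4 : -(|r - 1| / c) ≤ 1 - r⁻¹ := by
    have e : 1 - r⁻¹ = (r - 1) / r := by field_simp
    rw [e, neg_le, ← neg_div]
    calc -(r - 1) / r ≤ |r - 1| / r := by gcongr; exact neg_le_abs _
      _ ≤ |r - 1| / c := by gcongr
  rw [abs_le]
  exact ⟨h4.trans h2, (h1.trans (le_abs_self _)).trans h3⟩

lemma one_sub_rpow_eq_exp {k x : ℝ} (hx : x < 1) :
    (1 - x) ^ (-k) = Real.exp (k * primePowerWeight x + k * x) := by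
  rw [Real.rpow_def_of_pos (by linarith), primePowerWeight]
  ring_nf

lemma one_add_rpow_eq_exp {k x : ℝ} (hx : 0 ≤ x) :
    (1 + x) ^ (-k) = Real.exp (-(k * Real.log (1 + x))) := by
  rw [Real.rpow_def_of_pos (by linarith)]
  ring_nf

lemma primePowerWeight_nonneg {x : ℝ} (hx : x < 1) : 0 ≤ primePowerWeight x := by
  have := Real.log_le_sub_one_of_pos (by linarith : 0 < 1 - x)
  rw [primePowerWeight]; linarith

/-- The comparison quantity `exp (k w) cosh (k x)`, as a mean of two exponentials. -/
lemma exp_mul_cosh_eq {k x : ℝ} (hx : x < 1) :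
    Real.exp (k * primePowerWeight x) * Real.cosh (k * x) =
      ((1 - x) ^ (-k) + Real.exp (k * primePowerWeight x - k * x)) / 2 := by
  rw [one_sub_rpow_eq_exp hx, Real.cosh_eq, Real.exp_add, sub_eq_add_neg, Real.exp_add]
  ring

lemma one_le_one_sub_rpow {k x : ℝ} (hk : 0 ≤ k) (h0 : 0 ≤ x) (hx : x < 1) :
    1 ≤ (1 - x) ^ (-k) := by
  rw [one_sub_rpow_eq_exp hx]
  have := primePowerWeight_nonneg hx
  exact Real.one_le_exp (by positivity)

lemma one_add_rpow_le_one {k x : ℝ} (hk : 0 ≤ k) (h0 : 0 ≤ x) : (1 + x) ^ (-k) ≤ 1 :=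
  Real.rpow_le_one_of_one_le_of_nonpos (by linarith) (by linarith)

lemma one_sub_one_add_rpow_le {k x : ℝ} (hk : 0 ≤ k) (h0 : 0 ≤ x) :
    1 - (1 + x) ^ (-k) ≤ k * x := by
  rw [one_add_rpow_eq_exp h0]
  have h1 := Real.add_one_le_exp (-(k * Real.log (1 + x)))
  have h2 : Real.log (1 + x) ≤ x := by
    have := Real.log_le_sub_one_of_pos (by linarith : 0 < 1 + x); linarith
  have := mul_le_mul_of_nonneg_left h2 hk
  linarith

/-- It makes the contribution `oddTail * (A + B - 2)` to the factors at odd primes nonnegative. -/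
lemma two_le_rpow_add_rpow {k x : ℝ} (hk : 0 ≤ k) (h0 : 0 ≤ x) (hx : x < 1) :
    2 ≤ (1 - x) ^ (-k) + (1 + x) ^ (-k) := by
  have h1 := one_sub_one_add_rpow_le hk h0
  have h2 : 1 + k * x ≤ (1 - x) ^ (-k) := by
    rw [one_sub_rpow_eq_exp hx]
    have := mul_nonneg hk (primePowerWeight_nonneg hx)
    linarith [Real.add_one_le_exp (k * primePowerWeight x + k * x)]
  linarith

lemma one_sub_rpow_sub_one_le {k x : ℝ} (hk : 0 ≤ k) (h0 : 0 ≤ x) (hx : x ≤ 1 / 2) :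
    (1 - x) ^ (-k) - 1 ≤ 2 * k * x * (1 - x) ^ (-k) := by
  have hx1 : x < 1 := by linarith
  set A := (1 - x) ^ (-k) with hA
  have hA0 : 0 < A := Real.rpow_pos_of_pos (by linarith) _
  have h1 := Real.one_sub_inv_le_log_of_pos (by linarith : 0 < 1 - x)
  have h2 : -Real.log (1 - x) ≤ 2 * x := by
    have : (1 - x)⁻¹ ≤ 1 + 2 * x := by
      rw [inv_le_iff_one_le_mul₀ (by linarith)]; nlinarith
    linarith
  have h3 : Real.log A = k * -Real.log (1 - x) := by
    rw [hA, Real.log_rpow (by linarith)]; ring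
  -- From `1 - A⁻¹ ≤ log A ≤ 2 k x`, multiplied by `A`.
  have h4 := Real.one_sub_inv_le_log_of_pos hA0
  have h5 : 1 - A⁻¹ ≤ 2 * k * x := by
    have := mul_le_mul_of_nonneg_left h2 hk
    linarith
  have h6 := mul_le_mul_of_nonneg_right h5 hA0.le
  have e : (1 - A⁻¹) * A = A - 1 := by field_simp
  linarith

/-- Both terms are exponentials of `-k x + O(k x^2)`, and neither exceeds `(1 - x)^(-k)`. -/
lemma abs_one_add_rpow_sub_exp_le {k x : ℝ} (hk : 0 ≤ k) (h0 : 0 ≤ x) (hx : x ≤ 1 / 2) :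
    |(1 + x) ^ (-k) - Real.exp (k * primePowerWeight x - k * x)| ≤
      4 * k * x ^ 2 * (1 - x) ^ (-k) := by
  have hx1 : x < 1 := by linarith
  have hA := one_le_one_sub_rpow hk h0 hx1
  have hB := one_add_rpow_le_one hk h0
  have hkx : 0 ≤ k * x := by positivity
  have hle : Real.exp (k * primePowerWeight x - k * x) ≤ (1 - x) ^ (-k) := by
    rw [one_sub_rpow_eq_exp hx1]
    exact Real.exp_le_exp.2 (by linarith)
  have h1 : |primePowerWeight x| ≤ 2 * x ^ 2 := abs_primePowerWeight_le (by rwa [abs_of_nonneg h0])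
  have h2 := abs_log_one_sub_add_self_le (x := -x) (by rwa [abs_neg, abs_of_nonneg h0])
  rw [sub_neg_eq_add, neg_sq] at h2
  rw [one_add_rpow_eq_exp h0] at hB ⊢
  refine (abs_exp_sub_exp_le _ _).trans ?_
  refine mul_le_mul ?_ (max_le (hB.trans hA) hle) (by positivity) (by positivity)
  have e : -(k * Real.log (1 + x)) - (k * primePowerWeight x - k * x) =
      k * (-(Real.log (1 + x) + -x) - primePowerWeight x) := by ring
  rw [e, abs_mul, abs_of_nonneg hk]
  have h3 : |-(Real.log (1 + x) + -x) - primePowerWeight x| ≤ 2 * x ^ 2 + 2 * x ^ 2 :=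
    (abs_sub _ _).trans (add_le_add (by rwa [abs_neg]) h1)
  calc _ ≤ k * (2 * x ^ 2 + 2 * x ^ 2) := by gcongr
    _ = _ := by ring

/-- The comparison of the factor at `p ≥ 5` with `exp (k w) cosh (k / p)`. -/
lemma localFactor_comparison {k : ℝ} (hk : 1 ≤ k) {p : ℕ} (hp : 5 ≤ p) :
    let T := Real.exp (k * primePowerWeight (1 / p)) * Real.cosh (k * (1 / p))
    T / 5 ≤ localFactor k p ∧ localFactor k p ≤ 4 * T ∧
      |localFactor k p - T| ≤ 20 * (k / (p : ℝ) ^ 2) * T := by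
  intro T
  have hp' : (5 : ℝ) ≤ p := by exact_mod_cast hp
  have hk0 : 0 ≤ k := by linarith
  have h2 : p ≠ 2 := by omega
  have hη := oddFactor_sub_one_le hk (by omega : 2 ≤ p)
  have hη0 := one_le_oddFactor hk (by omega : 2 ≤ p)
  have hε0 := oddTail_nonneg hk (by linarith : (2 : ℝ) ≤ p)
  have hε := oddTail_le hk (by linarith : (2 : ℝ) ≤ p)
  set x : ℝ := 1 / p with hx
  have hx0 : 0 < x := by positivity
  have hx5 : x ≤ 1 / 5 := one_div_le_one_div_of_le (by norm_num) hp'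
  have hxsq : 1 / (p : ℝ) ^ 2 = x ^ 2 := by rw [hx, one_div_pow]
  have hx3 : 3 / (p : ℝ) = 3 * x := by rw [hx]; ring
  have hA := one_le_one_sub_rpow hk0 hx0.le (by linarith)
  have hA2 := one_sub_rpow_sub_one_le hk0 hx0.le (by linarith)
  have hB0 : 0 < (1 + x) ^ (-k) := Real.rpow_pos_of_pos (by linarith) _
  have hB := one_add_rpow_le_one hk0 hx0.le
  have hB2 := one_sub_one_add_rpow_le hk0 hx0.le
  have hAB := two_le_rpow_add_rpow hk0 hx0.le (by linarith)
  have hBB := abs_one_add_rpow_sub_exp_le hk0 hx0.le (by linarith)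
  have hT : T = ((1 - x) ^ (-k) + Real.exp (k * primePowerWeight x - k * x)) / 2 :=
    exp_mul_cosh_eq (by linarith)
  have hL : localFactor k p = oddFactor k p + ((1 - 3 * x) / 2 + oddTail k p) *
      ((1 - x) ^ (-k) - 1) + ((1 - x) / 2 + oddTail k p) * ((1 + x) ^ (-k) - 1) := by
    rw [localFactor, constFactor, minusCoeff, plusCoeff, if_neg h2, if_neg h2, if_neg h2, hx3]
  have hB'0 := Real.exp_pos (k * primePowerWeight x - k * x)
  have hB' : Real.exp (k * primePowerWeight x - k * x) ≤ (1 - x) ^ (-k) := by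
    have : 0 ≤ k * x := by positivity
    rw [one_sub_rpow_eq_exp (by linarith)]
    exact Real.exp_le_exp.2 (by linarith)
  rw [div_eq_mul_one_div k, hxsq]
  rw [hxsq] at hη hε
  set A := (1 - x) ^ (-k)
  set B := (1 + x) ^ (-k)
  set B' := Real.exp (k * primePowerWeight x - k * x)
  set ε := oddTail k p
  set η := oddFactor k p - 1 with hηd
  have hη1 : oddFactor k p = 1 + η := by rw [hηd]; ring
  rw [hη1] at hL hη0
  have hTA : T ≤ A := by linarith
  have hTA2 : A ≤ 2 * T := by linarith
  have hx2 : x ^ 2 ≤ 1 / 25 := by nlinarith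
  have hεAB : 0 ≤ ε * (A + B - 2) := mul_nonneg hε0 (by linarith)
  have hεAB2 : ε * (A + B - 2) ≤ x ^ 2 * A :=
    mul_le_mul hε (by linarith) (by linarith) (by positivity)
  have hL2 : localFactor k p = 2 * x + (1 - 3 * x) / 2 * A + (1 - x) / 2 * B + η +
      ε * (A + B - 2) := by rw [hL]; ring
  have hA0 : 0 < A := by linarith
  refine ⟨?_, ?_, ?_⟩
  · have h1 : 1 / 5 * A ≤ (1 - 3 * x) / 2 * A :=
      mul_le_mul_of_nonneg_right (by linarith) hA0.le
    have h3 : 0 ≤ (1 - x) / 2 * B := mul_nonneg (by linarith) hB0.le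
    linarith
  · have h1 : (1 - 3 * x) / 2 * A ≤ 1 / 2 * A := by gcongr; linarith
    have h3 : (1 - x) / 2 * B ≤ 1 / 2 * 1 := by gcongr; linarith
    have h4 : x ^ 2 * A ≤ 1 / 25 * A := by gcongr
    linarith
  · have e : localFactor k p - T = (B - B') / 2 - 3 / 2 * (x * (A - 1)) + 1 / 2 * (x * (1 - B)) + η +
        ε * (A + B - 2) := by rw [hL2, hT]; ring
    have hkx : 0 ≤ k * x ^ 2 := by positivity
    have hkA : k * x ^ 2 ≤ k * x ^ 2 * A := le_mul_of_one_le_right hkx hA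
    have h1 := abs_le.1 hBB
    have h3 : x * (A - 1) ≤ x * (2 * k * x * A) := by gcongr
    have h3' : 0 ≤ x * (A - 1) := mul_nonneg hx0.le (by linarith)
    have h4 : x * (1 - B) ≤ x * (k * x) := by gcongr
    have h4' : 0 ≤ x * (1 - B) := mul_nonneg hx0.le (by linarith)
    have h5 : x ^ 2 ≤ k * x ^ 2 := le_mul_of_one_le_left (by positivity) hk
    have h6 : x ^ 2 * A ≤ k * x ^ 2 * A := by gcongr
    have h7 : k * x ^ 2 * A ≤ k * x ^ 2 * (2 * T) := by gcongr
    rw [e, abs_le]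
    constructor <;> linarith

/-- The logarithmic correction at the primes `2` and `3`. -/
noncomputable def smallPrimeWeight (p : ℕ) : ℝ :=
  if p = 2 then Real.log 2 else if p = 3 then Real.log (3 / 2) else 0

/-- The error in the approximation of the logarithm of the factor at `p` of `H(k)`. -/
noncomputable def localError (k : ℝ) (p : ℕ) : ℝ :=
  Real.log (localFactor k p) - (Real.log (Real.cosh (k / p)) + k * primePowerWeight (1 / p))
    + k * smallPrimeWeight p

lemma localError_of_five_le {k : ℝ} (hk : 1 ≤ k) {p : ℕ} (hp : 5 ≤ p) :
    0 < localFactor k p ∧ |localError k p| ≤ 100 ∧ |localError k p| ≤ 100 * (k / (p : ℝ) ^ 2) := by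
  obtain ⟨h1, h2, h3⟩ := localFactor_comparison hk hp
  set T := Real.exp (k * primePowerWeight (1 / p)) * Real.cosh (k * (1 / p)) with hT
  have hc := Real.cosh_pos (k * (1 / p))
  have hT0 : 0 < T := by positivity
  have hL0 : 0 < localFactor k p := lt_of_lt_of_le (by positivity) h1
  have e : localError k p = Real.log (localFactor k p / T) := by
    rw [Real.log_div hL0.ne' hT0.ne', hT, Real.log_mul (Real.exp_pos _).ne' hc.ne', Real.log_exp,
      localError, smallPrimeWeight, if_neg (by omega), if_neg (by omega), mul_one_div]
    ring
  have h4 : 1 / 5 ≤ localFactor k p / T := by rw [le_div_iff₀ hT0]; linarith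
  have h5 : localFactor k p / T ≤ 4 := by rw [div_le_iff₀ hT0]; exact h2
  have h6 := abs_log_le_div (by norm_num) h4 (by norm_num)
  rw [← e] at h6
  refine ⟨hL0, h6.trans ?_, h6.trans ?_⟩
  · have : |localFactor k p / T - 1| ≤ 3 := by rw [abs_le]; constructor <;> linarith
    linarith
  · have : |localFactor k p / T - 1| ≤ 20 * (k / (p : ℝ) ^ 2) := by
      rw [div_sub_one hT0.ne', abs_div, abs_of_pos hT0, div_le_iff₀ hT0]
      exact h3
    linarith

lemma localFactor_two_bounds {k : ℝ} (hk : 1 ≤ k) :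
    1 / 2 ≤ localFactor k 2 ∧ localFactor k 2 ≤ 9 := by
  have hB := one_add_rpow_le_one (k := k) (x := 1 / 2) (by linarith) (by norm_num)
  have hB0 : 0 < (1 + 1 / 2 : ℝ) ^ (-k) := by positivity
  have hT0 := twoTail_nonneg hk
  have hT1 := twoTail_le_one hk
  have hTA := twoTail_mul_two_rpow_le hk
  have hc := one_le_twoFactor hk
  have eA : (1 - 1 / 2 : ℝ) ^ (-k) = 2 ^ k := by
    rw [Real.rpow_neg (by norm_num), ← Real.inv_rpow (by norm_num)]; norm_num
  have hA : (2 : ℝ) ≤ 2 ^ k := by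
    simpa using Real.rpow_le_rpow_of_exponent_le (one_le_two (α := ℝ)) hk
  have hc2 : twoFactor k ≤ 8 := by
    have h2 : (1 : ℝ) ≤ 2 ^ (k + 2) := Real.one_le_rpow (by norm_num) (by linarith)
    have h4 : (1 : ℝ) ≤ 4 ^ (k + 2) := Real.one_le_rpow (by norm_num) (by linarith)
    have i1 : 1 / (2 : ℝ) ^ (k + 2) ≤ 1 := by rw [div_le_one (by positivity)]; exact h2
    have i2 : 2 / (4 : ℝ) ^ (k + 2) ≤ 2 := by rw [div_le_iff₀ (by positivity)]; linarith
    have i3 : 4 / ((4 : ℝ) ^ (k + 2) * ((2 : ℝ) ^ (k + 2) - 1)) = 4 * twoTail k := by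
      rw [twoTail]; ring
    rw [twoFactor, i3]; linarith
  have hL : localFactor k 2 = twoFactor k + twoTail k * (2 ^ k - 1) +
      (1 / 2 + twoTail k) * ((1 + 1 / 2 : ℝ) ^ (-k) - 1) := by
    simp only [localFactor, constFactor, minusCoeff, plusCoeff, if_true, Nat.cast_ofNat, eA]
  rw [hL]
  set B := (1 + 1 / 2 : ℝ) ^ (-k)
  have h1 : twoTail k * 2 ≤ twoTail k * 2 ^ k := by gcongr
  have h2 : 0 ≤ (1 / 2 + twoTail k) * B := by positivity
  have h3 : 0 ≤ (1 / 2 + twoTail k) * (1 - B) := mul_nonneg (by positivity) (by linarith)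
  constructor <;> linarith

/-- At `p = 3` the main coefficient `(1 - 3/p) / 2` vanishes, and `oddTail k 3` is too small for the
growth of `(1 - 1/3)^(-k)`. -/
lemma localFactor_three_bounds {k : ℝ} (hk : 1 ≤ k) :
    1 / 2 ≤ localFactor k 3 ∧ localFactor k 3 ≤ 9 := by
  have hk0 : 0 ≤ k := by linarith
  have hB := one_add_rpow_le_one (k := k) (x := 1 / 3) hk0 (by norm_num)
  have hB0 : 0 < (1 + 1 / 3 : ℝ) ^ (-k) := by positivity
  have hA := one_le_one_sub_rpow (k := k) (x := 1 / 3) hk0 (by norm_num) (by norm_num)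
  have hAB := two_le_rpow_add_rpow (k := k) (x := 1 / 3) hk0 (by norm_num) (by norm_num)
  have hη := oddFactor_sub_one_le hk (by norm_num : 2 ≤ 3)
  have hη0 := one_le_oddFactor hk (by norm_num : 2 ≤ 3)
  have hε0 := oddTail_nonneg hk (by norm_num : (2 : ℝ) ≤ 3)
  have hεA : oddTail k 3 * (1 - 1 / 3 : ℝ) ^ (-k) ≤ 1 := by
    have e : (1 - 1 / 3 : ℝ) ^ (-k) = (3 / 2) ^ k := by
      rw [Real.rpow_neg (by norm_num), ← Real.inv_rpow (by norm_num)]; norm_num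
    have h1 : (3 / 2 : ℝ) ^ k ≤ 3 ^ k := Real.rpow_le_rpow (by norm_num) (by norm_num) hk0
    have h3 : (1 : ℝ) ≤ 3 ^ k := Real.one_le_rpow (by norm_num) hk0
    have h2 : (3 : ℝ) ^ (k + 2) = 3 ^ k * 9 := by
      rw [Real.rpow_add (by norm_num)]; norm_num
    rw [e, oddTail, h2, div_mul_eq_mul_div, div_le_one (by linarith)]
    linarith
  have hL : localFactor k 3 = 2 / 3 + (oddFactor k 3 - 1) + 1 / 3 * (1 + 1 / 3 : ℝ) ^ (-k) +
      oddTail k 3 * ((1 - 1 / 3 : ℝ) ^ (-k) + (1 + 1 / 3 : ℝ) ^ (-k) - 2) := by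
    simp only [localFactor, constFactor, minusCoeff, plusCoeff, if_neg (by norm_num : (3 : ℕ) ≠ 2),
      Nat.cast_ofNat]
    ring
  rw [hL]
  push_cast at hη
  set A := (1 - 1 / 3 : ℝ) ^ (-k)
  set B := (1 + 1 / 3 : ℝ) ^ (-k)
  have h1 : 0 ≤ oddTail k 3 * (A + B - 2) := mul_nonneg hε0 (by linarith)
  have h2 : oddTail k 3 * (A + B - 2) ≤ oddTail k 3 * A := by gcongr; linarith
  constructor <;> linarith

lemma abs_log_le_eight {L : ℝ} (h1 : 1 / 2 ≤ L) (h2 : L ≤ 9) : |Real.log L| ≤ 8 := by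
  have hL : 0 < L := by linarith
  have h3 := Real.log_le_sub_one_of_pos hL
  have h4 := Real.one_sub_inv_le_log_of_pos hL
  have h5 : L⁻¹ ≤ 2 := by rw [inv_le_comm₀ hL two_pos]; linarith
  rw [abs_le]
  constructor <;> linarith

lemma primePowerWeight_half : primePowerWeight (1 / 2) = Real.log 2 - 1 / 2 := by
  rw [primePowerWeight, show (1 - 1 / 2 : ℝ) = 2⁻¹ by norm_num, Real.log_inv]; ring

lemma primePowerWeight_third : primePowerWeight (1 / 3) = Real.log (3 / 2) - 1 / 3 := by
  rw [primePowerWeight, show (1 - 1 / 3 : ℝ) = (3 / 2)⁻¹ by norm_num, Real.log_inv]; ring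

/-- The logarithm of the factor at `p` of `H(k)` is well approximated, uniformly in `p`. -/
lemma localError_bounds {k : ℝ} (hk : 1 ≤ k) {p : ℕ} (hp : p.Prime) :
    0 < localFactor k p ∧ |localError k p| ≤ 100 ∧ |localError k p| ≤ 100 * (k / (p : ℝ) ^ 2) := by
  rcases le_or_gt 5 p with h | h
  · exact localError_of_five_le hk h
  have h23 : p = 2 ∨ p = 3 := by
    have := hp.two_le
    interval_cases p
    · exact Or.inl rfl
    · exact Or.inr rfl
    · exact absurd hp (by norm_num)
  have key : 0 < localFactor k p ∧ |localError k p| ≤ 9 := by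
    rcases h23 with rfl | rfl
    · obtain ⟨h1, h2⟩ := localFactor_two_bounds hk
      refine ⟨by linarith, ?_⟩
      have h3 := abs_log_le_eight h1 h2
      have h4 := abs_log_cosh_sub_self_le (by linarith : 0 ≤ k / 2)
      -- At `2` the general approximation is `log cosh (k/2) + k (log 2 - 1/2) = k log 2 + O(1)`,
      -- whereas the factor is bounded; `smallPrimeWeight` removes the `k log 2`.
      have e : localError k 2 = Real.log (localFactor k 2) -
          (Real.log (Real.cosh (k / 2)) - k / 2) := by
        simp only [localError, smallPrimeWeight, if_true, Nat.cast_ofNat, primePowerWeight_half]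
        ring
      rw [e]
      exact (abs_sub _ _).trans (by linarith)
    · obtain ⟨h1, h2⟩ := localFactor_three_bounds hk
      refine ⟨by linarith, ?_⟩
      have h3 := abs_log_le_eight h1 h2
      have h4 := abs_log_cosh_sub_self_le (by linarith : 0 ≤ k / 3)
      have e : localError k 3 = Real.log (localFactor k 3) -
          (Real.log (Real.cosh (k / 3)) - k / 3) := by
        simp only [localError, smallPrimeWeight, if_true, if_neg (by norm_num : (3 : ℕ) ≠ 2),
          Nat.cast_ofNat, primePowerWeight_third]
        ring
      rw [e]
      exact (abs_sub _ _).trans (by linarith)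
  refine ⟨key.1, by linarith, ?_⟩
  have h1 : 1 / 9 ≤ k / (p : ℝ) ^ 2 := by
    have h2 : (p : ℝ) ^ 2 ≤ 9 := by
      rcases h23 with rfl | rfl <;> norm_num
    have h3 : 0 < (p : ℝ) ^ 2 := by have := hp.pos; positivity
    rw [div_le_div_iff₀ (by norm_num) h3]
    linarith
  linarith

/-- Interpolation `min(1, t) ≤ t^(3/4)` at `t = k / p^2`: the exponent exceeds `1/2`, so the sum
over primes converges, and is below `1`, so a power of `k` is saved. -/
lemma abs_localError_le {k : ℝ} (hk : 1 ≤ k) {p : ℕ} (hp : p.Prime) :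
    |localError k p| ≤ 100 * k ^ (3 / 4 : ℝ) * (p : ℝ) ^ (-(3 / 2) : ℝ) := by
  obtain ⟨-, h1, h2⟩ := localError_bounds hk hp
  have hp0 : (0 : ℝ) < p := by exact_mod_cast hp.pos
  set t := k / (p : ℝ) ^ 2 with ht
  have ht0 : 0 < t := by positivity
  have e : k ^ (3 / 4 : ℝ) * (p : ℝ) ^ (-(3 / 2) : ℝ) = t ^ (3 / 4 : ℝ) := by
    rw [ht, Real.div_rpow (by linarith) (by positivity), ← Real.rpow_two, ← Real.rpow_mul hp0.le,
      Real.rpow_neg hp0.le]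
    norm_num
    exact (div_eq_mul_inv _ _).symm
  rw [mul_assoc, e]
  rcases le_total t 1 with h | h
  · have : t ≤ t ^ (3 / 4 : ℝ) := by
      simpa using Real.rpow_le_rpow_of_exponent_ge ht0 h (by norm_num : (3 / 4 : ℝ) ≤ 1)
    linarith
  · have : 1 ≤ t ^ (3 / 4 : ℝ) := Real.one_le_rpow h (by norm_num)
    linarith

end LocalEstimates

/-! ### Taking logarithms of the Euler product and summing the errors. -/

section Assembly

open Set Topology

/-- The source of `-k log 3` in the theorem: `log 2 + log (3/2) = log 3`. -/
lemma hasSum_smallPrimeWeight :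
    HasSum (fun p : Nat.Primes => smallPrimeWeight p) (Real.log 3) := by
  have h := (hasSum_ite_eq (⟨2, Nat.prime_two⟩ : Nat.Primes) (Real.log 2)).add
    (hasSum_ite_eq (⟨3, Nat.prime_three⟩ : Nat.Primes) (Real.log (3 / 2)))
  rw [← Real.log_mul two_ne_zero (by norm_num), mul_div_cancel₀ (3 : ℝ) two_ne_zero] at h
  refine h.congr_fun fun p => ?_
  have e2 : p = ⟨2, Nat.prime_two⟩ ↔ (p : ℕ) = 2 := Subtype.ext_iff
  have e3 : p = ⟨3, Nat.prime_three⟩ ↔ (p : ℕ) = 3 := Subtype.ext_iff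
  simp only [e2, e3, smallPrimeWeight]
  split_ifs <;> simp_all

lemma summable_localError {k : ℝ} (hk : 1 ≤ k) :
    Summable fun p : Nat.Primes => localError k p :=
  Summable.of_norm_bounded ((summable_primes_rpow_neg (a := 3 / 2) (by norm_num)).mul_left _)
    fun p => abs_localError_le hk p.2

lemma hasSum_log_localFactor {k : ℝ} (hk : 1 ≤ k) :
    HasSum (fun p : Nat.Primes => Real.log (localFactor k p))
      ((∑' p : Nat.Primes, localError k p) + (logCoshSum k + k * primePowerConst)
        - k * Real.log 3) := by
  refine (((summable_localError hk).hasSum.add ((summable_logCoshSum k).hasSum.add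
    (summable_primePowerWeight.hasSum.mul_left k))).sub
    (hasSum_smallPrimeWeight.mul_left k)).congr_fun fun p => ?_
  rw [localError]; ring

lemma constH_eq_exp {k : ℝ} (hk : 1 ≤ k) :
    constH k = Real.exp ((∑' p : Nat.Primes, localError k p) +
      (logCoshSum k + k * primePowerConst) - k * Real.log 3) :=
  (hasProd_localFactor hk).unique (Real.hasProd_of_hasSum_log
    (fun p => (localError_bounds hk p.2).1) (hasSum_log_localFactor hk))

lemma isBigO_tsum_localError :
    (fun k : ℝ => ∑' p : Nat.Primes, localError k p) =O[atTop]
      fun k : ℝ => k / Real.log k ^ 2 := by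
  have hs := summable_primes_rpow_neg (a := 3 / 2) (by norm_num)
  have h1 : (fun k : ℝ => ∑' p : Nat.Primes, localError k p) =O[atTop]
      fun k : ℝ => k ^ (3 / 4 : ℝ) := by
    refine IsBigO.of_bound (100 * ∑' p : Nat.Primes, (p : ℝ) ^ (-(3 / 2) : ℝ)) ?_
    filter_upwards [eventually_ge_atTop 1] with k hk
    rw [Real.norm_of_nonneg (by positivity : 0 ≤ k ^ (3 / 4 : ℝ))]
    refine (tsum_of_norm_bounded (hs.hasSum.mul_left (100 * k ^ (3 / 4 : ℝ)))
      fun p => abs_localError_le hk p.2).trans (le_of_eq (by ring))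
  refine h1.trans (IsBigO.of_bound 1 ?_)
  -- With `log k ≤ k^(1/8)`, the square of the logarithm costs `k^(1/4)`, exactly the saving over
  -- `k` in the error sum.
  filter_upwards [(isLittleO_log_rpow_atTop (by norm_num : (0 : ℝ) < 1 / 8)).bound one_pos,
    eventually_gt_atTop 1] with k hk hk1
  have hl : 0 < Real.log k := Real.log_pos hk1
  have hk0 : 0 < k := by linarith
  rw [Real.norm_of_nonneg hl.le, Real.norm_of_nonneg (by positivity), one_mul] at hk
  rw [Real.norm_of_nonneg (by positivity), Real.norm_of_nonneg (by positivity), one_mul,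
    le_div_iff₀ (by positivity)]
  calc k ^ (3 / 4 : ℝ) * Real.log k ^ 2 ≤ k ^ (3 / 4 : ℝ) * (k ^ (1 / 8 : ℝ)) ^ 2 := by gcongr
    _ = k := by
      rw [← Real.rpow_two, ← Real.rpow_mul hk0.le, ← Real.rpow_add hk0]
      norm_num

end Assembly

end ClassNumberMoments

/-- The first three conjuncts say that the integrals, the series and the product which define
`A₀` and `H(k)` converge and that `H(k) > 0`, so that `log H(k)` has its usual meaning. -/
theorem mainTheorem7 :
    IntervalIntegrable (fun t : ℝ => Real.log (Real.cosh t) / t ^ 2) volume 0 1 ∧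
    IntegrableOn (fun t : ℝ => (Real.log (Real.cosh t) - t) / t ^ 2) (Set.Ioi 1) volume ∧
    (∀ᶠ k : ℝ in atTop,
      Summable (ClassNumberMoments.hTerm k) ∧
      Multipliable (fun p : {p : ℕ // p.Prime ∧ 2 < p} => ClassNumberMoments.oddFactor k p) ∧
      0 < ClassNumberMoments.constH k) ∧
    (fun k : ℝ => Real.log (ClassNumberMoments.constH k)
        - (k * Real.log (Real.log k) + k * (Real.eulerMascheroniConstant - Real.log 3)
          + (ClassNumberMoments.constA - 1) * (k / Real.log k)))
      =O[atTop] (fun k : ℝ => k / (Real.log k) ^ 2) := by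
  refine ⟨ClassNumberMoments.intervalIntegrable_log_cosh_div_sq,
    ClassNumberMoments.integrableOn_log_cosh_sub_self_div_sq, ?_, ?_⟩
  · filter_upwards [eventually_ge_atTop 1] with k hk
    refine ⟨ClassNumberMoments.summable_hTerm hk, ClassNumberMoments.multipliable_oddFactor hk, ?_⟩
    rw [ClassNumberMoments.constH_eq_exp hk]
    exact Real.exp_pos _
  · refine (ClassNumberMoments.isBigO_logCoshSum_sub.add
      ClassNumberMoments.isBigO_tsum_localError).congr' ?_ EventuallyEq.rfl
    filter_upwards [eventually_ge_atTop 1] with k hk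
    -- The term `k * primePowerConst` from the Euler product cancels the one in the expansion of
    -- `logCoshSum`.
    rw [ClassNumberMoments.constH_eq_exp hk, Real.log_exp]
    ring
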